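/- Let $\Sigma$ be a non-empty finite alphabet, $\mathcal{X}=\{x_1,\dots,x_m\}$ a finite set of $m\ge 1$ variables, and $\Gamma_{\mathcal X}=\{\vdash_x,\dashv_x\mid x\in\mathcal X\}$ a set of opening and closing brackets. A multiref-word is a word over $\Sigma\cup\Gamma_{\mathcal X}$ in which, for each $x$, the brackets of $x$ form a sequence $(\vdash_x\dashv_x)^k$. A multiref-word $w$ describes the document $D\in\Sigma^*$ obtained by erasing the brackets and the multispan-tuple $t$ that maps each $x$ to the set of the (pairwise disjoint) spans of $D$ enclosed by the matching pairs $\vdash_x,\dashv_x$ of $w$. A set $L$ of multiref-words defines the multispanner that maps each document $D$ to the set $E(D)$ of the multispan-tuples described by words $w\in L$ with document $D$. A multispanner-expression $r$ is built by $R ::= \varepsilon \mid a\in\Sigma \mid R\cdot R\mid R+R\mid R^*\mid x\{R\}$ ($x\{R\}$ only if $x$ does not appear in $R$), where $x\{R\}$ denotes $\{\vdash_x\}\cdot L(R)\cdot\{\dashv_x\}$. Let $|r|$ be its number of symbols. For a multispan-tuple $t$ over $D$ let $\mathrm{enc}(t,D)=t[1]\,D[1]\,t[2]\,D[2]\cdots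 D[|D|]\,t[|D|+1]$, where $t[i]=t[i,x_1]\cdots t[i,x_m]$ and $t[i,x]=(\dashv_x)^c(\vdash_x\dashv_x)^e(\vdash_x)^o$ with $c,e,o\in\{0,1\}$ telling whether $t(x)$ contains a non-empty span ending at $i$, the empty span at $i$, and a non-empty span starting at $i$, respectively. For a multispanner $E$ and a partial function $T:(\Sigma\cup\Gamma_{\mathcal X})^*\rightharpoonup\Omega^*$, the ET program $E\cdot T$ maps $D$ to the bag of all $T(\mathrm{enc}(t,D))$ with $t\in E(D)$ (and $T$ defined there). A DSST is a deterministic streaming string transducer with finitely many registers, copyless partial assignments on its transitions (partial transition function) and a partial final output function in which each register occurs at most once per state. An NSST is its nondeterministic version with a bag of transitions and, for each initial state, an initial valuation of the registers; its bag semantics maps $D$ to the bag of the outputs of all accepting runs. Running times refer to a random access machine with uniform cost measure and addition and subtraction as basic operations, in which the register assignments and the final output strings are atomic data: reading, writing or composing assignments, and copying a final output string, are unit-cost operations. Then: (a) There are an algorithm and a constant $C$ such that, given a multispanner-expression $r$ over $\Sigma$ and $\mathcal X$ that represents a multispanner $E$, and a DSST with $h$ states and input alphabet $\Sigma\cup\Gamma_{\mathcal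 X}$ that computes a function $T$, the algorithm constructs, in time at most $C\cdot 2^{4|r|+9|\mathcal X|}\,|\Sigma|^3\,|\mathcal X|^2\,h^2$, an NSST $\mathcal T$ with $[\![\mathcal T]\!](D)=[\![E\cdot T]\!](D)$, as bags, for all $D\in\Sigma^*$. (b) The same holds if $E$ is represented by an NFA with $n$ states that accepts only multiref-words, with the time bound $C\cdot 2^{4n+9|\mathcal X|}\,|\Sigma|^3\,|\mathcal X|^2\,h^2$. -/

import Mathlib

namespace ET

/-! ### Spans, multispan-tuples, multispanners

The variables are `x_1 ≼ … ≼ x_m`, represented by `Fin m` with its usual order. -/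

/-- The spans of a document of length `n`. Positions are counted from `0`, so that `left = i` and
`right = j` is the span usually written `[i+1, j+1⟩`. -/
@[ext]
structure Span (n : ℕ) where
  left : ℕ
  right : ℕ
  left_le : left ≤ right
  right_le : right ≤ n

instance (n : ℕ) : Finite (Span n) :=
  Finite.of_injective
    (fun s : Span n => ((⟨s.left, by have := s.left_le; have := s.right_le; omega⟩,
      ⟨s.right, by have := s.right_le; omega⟩) : Fin (n + 1) × Fin (n + 1)))
    fun s t h => by
      simp only [Prod.mk.injEq, Fin.mk.injEq] at h
      exact Span.ext h.1 h.2

/-- Disjointness of two spans. -/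
def Span.Disjoint {n : ℕ} (s t : Span n) : Prop := s.right ≤ t.left ∨ t.right ≤ s.left

/-- Multispan-tuples over a document of length `n` and `m` variables: every variable is mapped to a
set of pairwise disjoint spans. -/
@[ext]
structure MultispanTuple (m n : ℕ) where
  spans : Fin m → Set (Span n)
  disjoint : ∀ x, (spans x).Pairwise Span.Disjoint

instance (m n : ℕ) : Finite (MultispanTuple m n) :=
  Finite.of_injective MultispanTuple.spans fun _ _ h => MultispanTuple.ext h

/-- A multispanner over the alphabet `A` and `m` variables. -/
def Multispanner (A : Type*) (m : ℕ) : Type _ :=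
  (D : List A) → Set (MultispanTuple m D.length)

/-! ### Multiref-words -/

/-- The alphabet `Σ ∪ Γ_X`: letters, opening brackets `⊢x` and closing brackets `⊣x`. -/
inductive RefSym (A : Type*) (m : ℕ) where
  | letter (a : A)
  | opn (x : Fin m)
  | cls (x : Fin m)

/-- The document of a word over `Σ ∪ Γ_X`: erase all brackets. -/
def doc {A : Type*} {m : ℕ} (w : List (RefSym A m)) : List A :=
  w.filterMap fun s => match s with
    | .letter a => some a
    | _ => none

open Classical in
/-- A multiref-word: for every `x`, the subsequence of the brackets of `x` is `(⊢x ⊣x)^k`. -/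
def IsMultirefWord {A : Type*} {m : ℕ} (w : List (RefSym A m)) : Prop :=
  ∀ x : Fin m, ∃ k : ℕ,
    w.filter (fun s => s = .opn x ∨ s = .cls x) =
      (List.replicate k [RefSym.opn x, RefSym.cls x]).flatten

/-- The span `s` is defined by an occurrence of `⊢x` in `w` and the next occurrence of `⊣x`. -/
def Marks {A : Type*} {m n : ℕ} (w : List (RefSym A m)) (x : Fin m) (s : Span n) : Prop :=
  ∃ u v z : List (RefSym A m), w = u ++ [.opn x] ++ v ++ [.cls x] ++ z ∧ .cls x ∉ v ∧
    s.left = (doc u).length ∧ s.right = (doc (u ++ v)).length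

/-- `t` is the multispan-tuple described by the word `w`. -/
def IsTupleOf {A : Type*} {m n : ℕ} (t : MultispanTuple m n) (w : List (RefSym A m)) : Prop :=
  ∀ (x : Fin m) (s : Span n), s ∈ t.spans x ↔ Marks w x s

/-- The multispanner described by a language of multiref-words. -/
def spannerOf {A : Type*} {m : ℕ} (L : Language (RefSym A m)) : Multispanner A m :=
  fun D => {t | ∃ w ∈ L, doc w = D ∧ IsTupleOf t w}

/-! ### Multispanner-expressions -/

/-- Expressions `ε`, `a`, `R · R`, `R + R`, `R*`, `x{R}`. -/
inductive MExpr (A : Type*) (m : ℕ) where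
  | eps
  | letter (a : A)
  | mul (R S : MExpr A m)
  | add (R S : MExpr A m)
  | star (R : MExpr A m)
  | bind (x : Fin m) (R : MExpr A m)

namespace MExpr

variable {A : Type*} {m : ℕ}

/-- The variable `x` appears in the expression. -/
def Mentions (x : Fin m) : MExpr A m → Prop
  | eps => False
  | letter _ => False
  | mul R S => R.Mentions x ∨ S.Mentions x
  | add R S => R.Mentions x ∨ S.Mentions x
  | star R => R.Mentions x
  | bind y R => x = y ∨ R.Mentions x

/-- The side condition of the grammar: `x{R}` is allowed only if `x` does not appear in `R`. -/
def WellFormed : MExpr A m → Prop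
  | eps => True
  | letter _ => True
  | mul R S => R.WellFormed ∧ S.WellFormed
  | add R S => R.WellFormed ∧ S.WellFormed
  | star R => R.WellFormed
  | bind x R => ¬ R.Mentions x ∧ R.WellFormed

/-- The set of multiref-words defined by an expression. -/
def lang : MExpr A m → Language (RefSym A m)
  | eps => 1
  | letter a => {[RefSym.letter a]}
  | mul R S => R.lang * S.lang
  | add R S => R.lang + S.lang
  | star R => KStar.kstar R.lang
  | bind x R => ({[RefSym.opn x]} : Language (RefSym A m)) * R.lang * {[RefSym.cls x]}

/-- The size of an expression: its number of symbols, where the parentheses around `R · S` and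
`R + S` are not counted and `x{R}` counts two for its opening part `x{` and its closing part `}`. -/
def size : MExpr A m → ℕ
  | eps => 1
  | letter _ => 1
  | mul R S => R.size + S.size + 1
  | add R S => R.size + S.size + 1
  | star R => R.size + 1
  | bind _ R => R.size + 2

/-- The multispanner specified by an expression. -/
def spanner (R : MExpr A m) : Multispanner A m := spannerOf R.lang

end MExpr

/-! ### The encoding of a document and a multispan-tuple as a multiref-word -/

open Classical in
/-- The word `t[i, x] = (⊣x)^c (⊢x ⊣x)^e (⊢x)^o`. -/
noncomputable def MultispanTuple.blockVar {m n : ℕ} (A : Type*) (t : MultispanTuple m n) (i : ℕ)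
    (x : Fin m) : List (RefSym A m) :=
  (if ∃ s ∈ t.spans x, s.right = i ∧ s.left ≠ i then [.cls x] else []) ++
  (if ∃ s ∈ t.spans x, s.left = i ∧ s.right = i then [.opn x, .cls x] else []) ++
  (if ∃ s ∈ t.spans x, s.left = i ∧ s.right ≠ i then [.opn x] else [])

/-- The word `t[i] = t[i, x_1] ⋯ t[i, x_m]`. -/
noncomputable def MultispanTuple.block {m n : ℕ} (A : Type*) (t : MultispanTuple m n) (i : ℕ) :
    List (RefSym A m) :=
  (List.finRange m).flatMap (t.blockVar A i)

/-- The multiref-word `t[1] D[1] t[2] D[2] ⋯ D[n] t[n+1]`. -/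
noncomputable def MultispanTuple.encode {A : Type*} {m : ℕ} (D : List A)
    (t : MultispanTuple m D.length) : List (RefSym A m) :=
  (D.zipIdx.flatMap fun p => t.block A p.2 ++ [.letter p.1]) ++ t.block A D.length

/-- The bag semantics of an extract-transform program `(E, T)`: the bag of all `T(enc(t, D))` for
`t ∈ E(D)` (tuples on which the partial function `T` is undefined contribute nothing). -/
noncomputable def etSem {A Ω : Type*} {m : ℕ} (E : Multispanner A m)
    (T : List (RefSym A m) → Option (List Ω)) (D : List A) : Multiset (List Ω) :=
  (Set.toFinite (E D)).toFinset.val.filterMap fun t => T (t.encode D)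

/-! ### Assignments and valuations -/

/-- Assignments: partial functions from registers to strings of registers and letters. -/
abbrev Assignment (R Ω : Type*) : Type _ := R → Option (List (R ⊕ Ω))

/-- Valuations: partial functions from registers to strings of letters. -/
abbrev Valuation (R Ω : Type*) : Type _ := R → Option (List Ω)

/-- The sequence of the occurrences of registers in a string. -/
def registers {R Ω : Type*} (w : List (R ⊕ Ω)) : List R := w.filterMap Sum.getLeft?

/-- The extension of an assignment to strings; it is undefined as soon as one of the registers
of the string is. -/
def Assignment.hat {R Ω : Type*} (σ : Assignment R Ω) : List (R ⊕ Ω) → Option (List (R ⊕ Ω))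
  | [] => some []
  | .inl X :: w => (σ X).bind fun u => (Assignment.hat σ w).map (u ++ ·)
  | .inr o :: w => (Assignment.hat σ w).map (.inr o :: ·)

/-- Composition: `[σ ∘ τ](X) = σ^(τ(X))`. -/
def Assignment.comp {R Ω : Type*} (σ τ : Assignment R Ω) : Assignment R Ω :=
  fun X => (τ X).bind (Assignment.hat σ)

/-- Every register occurs at most once in all the strings `σ(Y)` together. -/
def Assignment.Copyless {R Ω : Type*} (σ : Assignment R Ω) : Prop :=
  (∀ Y w, σ Y = some w → (registers w).Nodup) ∧
  ∀ Y Z w v, Y ≠ Z → σ Y = some w → σ Z = some v → (registers w).Disjoint (registers v)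

/-- The value of a string of registers and letters under a valuation. -/
def Valuation.hat {R Ω : Type*} (ν : Valuation R Ω) : List (R ⊕ Ω) → Option (List Ω)
  | [] => some []
  | .inl X :: w => (ν X).bind fun u => (Valuation.hat ν w).map (u ++ ·)
  | .inr o :: w => (Valuation.hat ν w).map (o :: ·)

/-- The valuation `ν ∘ σ`. -/
def Valuation.comp {R Ω : Type*} (ν : Valuation R Ω) (σ : Assignment R Ω) : Valuation R Ω :=
  fun X => (σ X).bind (Valuation.hat ν)

/-- A valuation seen as an assignment. -/
def Valuation.toAssignment {R Ω : Type*} (ν : Valuation R Ω) : Assignment R Ω :=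
  fun X => (ν X).map (List.map Sum.inr)

/-- The valuation that maps every register to the empty string. -/
def Valuation.empty (R Ω : Type*) : Valuation R Ω := fun _ => some []

/-! ### Streaming string transducers -/

/-- Deterministic streaming string transducers with states `Q`, input alphabet `B`, registers `R`
and output alphabet `Ω`. -/
structure DSST (Q B R Ω : Type*) where
  step : Q → B → Option (Assignment R Ω × Q)
  step_copyless : ∀ q b σ p, step q b = some (σ, p) → σ.Copyless
  start : Q
  final : Q → Option (List (R ⊕ Ω))
  final_nodup : ∀ q w, final q = some w → (registers w).Nodup

/-- The configuration reached from `c` by reading a word, if there is one. -/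
def DSST.runFrom {Q B R Ω : Type*} (T : DSST Q B R Ω) :
    Q × Valuation R Ω → List B → Option (Q × Valuation R Ω)
  | c, [] => some c
  | c, b :: w => (T.step c.1 b).bind fun τ => T.runFrom (τ.2, Valuation.comp c.2 τ.1) w

/-- The string-to-string function of a DSST. -/
def DSST.eval {Q B R Ω : Type*} (T : DSST Q B R Ω) (w : List B) : Option (List Ω) :=
  (T.runFrom (T.start, Valuation.empty R Ω) w).bind fun c =>
    (T.final c.1).bind (Valuation.hat c.2)

/-- Nondeterministic streaming string transducers; the transitions form a bag. -/
structure NSST (Q B R Ω : Type*) where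
  init : Q → Option (Valuation R Ω)
  trans : Multiset (Q × B × Assignment R Ω × Q)
  trans_copyless : ∀ τ ∈ trans, Assignment.Copyless τ.2.2.1
  final : Q → Option (List (R ⊕ Ω))
  final_nodup : ∀ q w, final q = some w → (registers w).Nodup

open Classical in
/-- The bag of the last configurations of all runs over `w` that start in the configuration `c`;
every run contributes one element, and copies of a transition in the bag `trans` give different
runs. -/
noncomputable def NSST.runsFrom {Q B R Ω : Type*} (T : NSST Q B R Ω) :
    Q × Valuation R Ω → List B → Multiset (Q × Valuation R Ω)
  | c, [] => {c}
  | c, b :: w => (T.trans.filter fun τ => τ.1 = c.1 ∧ τ.2.1 = b).bind fun τ =>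
      T.runsFrom (τ.2.2.2, Valuation.comp c.2 τ.2.2.1) w

/-- The bag of the initial configurations. -/
def NSST.initial {Q B R Ω : Type*} [Fintype Q] (T : NSST Q B R Ω) :
    Multiset (Q × Valuation R Ω) :=
  (Finset.univ : Finset Q).val.filterMap fun q => (T.init q).map fun ν => (q, ν)

/-- The bag semantics of an NSST: the bag of the outputs of all accepting runs. -/
noncomputable def NSST.sem {Q B R Ω : Type*} [Fintype Q] (T : NSST Q B R Ω) (w : List B) :
    Multiset (List Ω) :=
  (T.initial.bind fun c => T.runsFrom c w).filterMap fun c =>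
    (T.final c.1).bind (Valuation.hat c.2)

/-! ### Random access machines with uniform cost

The memory consists of arrays of natural numbers, of assignments, and of strings of registers and
letters. A program addresses finitely many arrays, each of them by a constant; the position in an
array is computed. The basic operations on numbers are addition and (truncated) subtraction, the
only test is the one for zero, and a step on assignments is to read, write or compose them. The
contents of assignments and of strings cannot be inspected: they are atomic labels of
transitions and states. Every operation costs one time unit. -/

/-- The memory. -/
structure Store (R Ω : Type*) where
  num : ℕ → ℕ → ℕ
  asg : ℕ → ℕ → Assignment R Ω
  str : ℕ → ℕ → List (R ⊕ Ω)

/-- Numerical expressions: constants, array access, addition, subtraction. -/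
inductive NExpr where
  | lit (n : ℕ)
  | get (a : ℕ) (i : NExpr)
  | add (e f : NExpr)
  | sub (e f : NExpr)

/-- Expressions for assignments: the assignment that maps every register to the empty string,
array access, composition. -/
inductive AExpr where
  | empty
  | get (a : ℕ) (i : NExpr)
  | comp (e f : AExpr)

def NExpr.eval {R Ω : Type*} (s : Store R Ω) : NExpr → ℕ
  | lit n => n
  | get a i => s.num a (i.eval s)
  | add e f => e.eval s + f.eval s
  | sub e f => e.eval s - f.eval s

def NExpr.cost : NExpr → ℕ
  | lit _ => 1
  | get _ i => i.cost + 1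
  | add e f => e.cost + f.cost + 1
  | sub e f => e.cost + f.cost + 1

def AExpr.eval {R Ω : Type*} (s : Store R Ω) : AExpr → Assignment R Ω
  | empty => (Valuation.empty R Ω).toAssignment
  | get a i => s.asg a (i.eval s)
  | comp e f => Assignment.comp (e.eval s) (f.eval s)

def AExpr.cost : AExpr → ℕ
  | empty => 1
  | get _ i => i.cost + 1
  | comp e f => e.cost + f.cost + 1

/-- Programs. -/
inductive Prog where
  | skip
  /-- Write the value of `e` into cell `i` of the number array `a`. -/
  | setNum (a : ℕ) (i e : NExpr)
  /-- Write the value of `e` into cell `i` of the assignment array `a`. -/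
  | setAsg (a : ℕ) (i : NExpr) (e : AExpr)
  /-- Copy cell `j` of the string array `b` into cell `i` of the string array `a`. -/
  | setStr (a : ℕ) (i : NExpr) (b : ℕ) (j : NExpr)
  | seq (P P₂ : Prog)
  /-- If `e` is not zero, then `P`, else `P₂`. -/
  | ite (e : NExpr) (P P₂ : Prog)
  /-- While `e` is not zero, do `P`. -/
  | loop (e : NExpr) (P : Prog)

def Store.setNum {R Ω : Type*} (s : Store R Ω) (a i v : ℕ) : Store R Ω :=
  { s with num := Function.update s.num a (Function.update (s.num a) i v) }

def Store.setAsg {R Ω : Type*} (s : Store R Ω) (a i : ℕ) (v : Assignment R Ω) : Store R Ω :=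
  { s with asg := Function.update s.asg a (Function.update (s.asg a) i v) }

def Store.setStr {R Ω : Type*} (s : Store R Ω) (a i : ℕ) (v : List (R ⊕ Ω)) : Store R Ω :=
  { s with str := Function.update s.str a (Function.update (s.str a) i v) }

/-- `Exec P s s₂ t`: started on the memory `s`, the program `P` halts after exactly `t` steps with
the memory `s₂`. -/
inductive Exec {R Ω : Type*} : Prog → Store R Ω → Store R Ω → ℕ → Prop
  | skip (s : Store R Ω) : Exec .skip s s 1
  | setNum (s : Store R Ω) (a : ℕ) (i e : NExpr) :
      Exec (.setNum a i e) s (s.setNum a (i.eval s) (e.eval s)) (i.cost + e.cost + 1)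
  | setAsg (s : Store R Ω) (a : ℕ) (i : NExpr) (e : AExpr) :
      Exec (.setAsg a i e) s (s.setAsg a (i.eval s) (e.eval s)) (i.cost + e.cost + 1)
  | setStr (s : Store R Ω) (a : ℕ) (i : NExpr) (b : ℕ) (j : NExpr) :
      Exec (.setStr a i b j) s (s.setStr a (i.eval s) (s.str b (j.eval s))) (i.cost + j.cost + 1)
  | seq {P P₂ : Prog} {s s₁ s₂ : Store R Ω} {t t₂ : ℕ} :
      Exec P s s₁ t → Exec P₂ s₁ s₂ t₂ → Exec (.seq P P₂) s s₂ (t + t₂)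
  | iteTrue {e : NExpr} {P P₂ : Prog} {s s₁ : Store R Ω} {t : ℕ} :
      e.eval s ≠ 0 → Exec P s s₁ t → Exec (.ite e P P₂) s s₁ (e.cost + 1 + t)
  | iteFalse {e : NExpr} {P P₂ : Prog} {s s₁ : Store R Ω} {t : ℕ} :
      e.eval s = 0 → Exec P₂ s s₁ t → Exec (.ite e P P₂) s s₁ (e.cost + 1 + t)
  | loopDone {e : NExpr} {P : Prog} {s : Store R Ω} :
      e.eval s = 0 → Exec (.loop e P) s s (e.cost + 1)
  | loopStep {e : NExpr} {P : Prog} {s s₁ s₂ : Store R Ω} {t t₂ : ℕ} :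
      e.eval s ≠ 0 → Exec P s s₁ t → Exec (.loop e P) s₁ s₂ t₂ →
      Exec (.loop e P) s s₂ (e.cost + 1 + t + t₂)

/-! ### Representation of the input in the memory -/

/-- The symbols of `Σ ∪ Γ_X` for `Σ = {0, …, k-1}` are numbered `0, …, k+2m-1`: first the letters,
then the opening brackets, then the closing brackets. -/
def symAt (k m j : ℕ) : Option (RefSym (Fin k) m) :=
  if h : j < k then some (.letter ⟨j, h⟩)
  else if h : j - k < m then some (.opn ⟨j - k, h⟩)
  else if h : j - k - m < m then some (.cls ⟨j - k - m, h⟩)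
  else none

/-- Entry `q * (k + 2 * m) + j` of a table with `h` rows belongs to row `q` and symbol `j`. -/
def entryAt (h k m i : ℕ) : Option (Fin h × RefSym (Fin k) m) :=
  if hq : i / (k + 2 * m) < h then
    (symAt k m (i % (k + 2 * m))).map fun s => (⟨i / (k + 2 * m), hq⟩, s)
  else none

/-- An expression as a sequence of numbers, in postfix notation: `ε, ·, +, *` are `0, 1, 2, 3`, the
letter `a` is `4 + a`, and the operator `x{ }` is `4 + k + x`. -/
def MExpr.code {k m : ℕ} : MExpr (Fin k) m → List ℕ
  | eps => [0]
  | letter a => [4 + a]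
  | mul R S => R.code ++ S.code ++ [1]
  | add R S => R.code ++ S.code ++ [2]
  | star R => R.code ++ [3]
  | bind x R => R.code ++ [4 + k + x]

/-- The transition of a DSST that is stored at position `i` of the transition table. -/
def DSST.entry {h k m : ℕ} {R Ω : Type*} (T : DSST (Fin h) (RefSym (Fin k) m) R Ω) (i : ℕ) :
    Option (Assignment R Ω × Fin h) :=
  (entryAt h k m i).bind fun e => T.step e.1 e.2

/-- The memory that holds a DSST and nothing else. Number array `0` holds `k`, `m`, `h` and the
initial state. Number array `1` holds, for every entry of the transition table, `0` if there is
no transition and `p + 1` if the transition leads to state `p`; assignment array `1` holds the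
assignments of the transitions. Number array `2` tells whether the final function is defined on
a state (`1`) or not (`0`), and string array `2` holds its values. -/
def DSST.store {h k m : ℕ} {R Ω : Type*} (T : DSST (Fin h) (RefSym (Fin k) m) R Ω) :
    Store R Ω where
  num a i := match a with
    | 0 => [k, m, h, (T.start : ℕ)].getD i 0
    | 1 => ((T.entry i).map fun e => (e.2 : ℕ) + 1).getD 0
    | 2 => if hq : i < h then (if (T.final ⟨i, hq⟩).isSome then 1 else 0) else 0
    | _ => 0
  asg a i := match a with
    | 1 => ((T.entry i).map Prod.fst).getD (Valuation.empty R Ω).toAssignment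
    | _ => (Valuation.empty R Ω).toAssignment
  str a i := match a with
    | 2 => if hq : i < h then (T.final ⟨i, hq⟩).getD [] else []
    | _ => []

/-- The input that consists of a DSST and an expression: the length of the code of the expression
is in cell `4` of number array `0`, and the code itself in number array `3`. -/
def inputExpr {h k m : ℕ} {R Ω : Type*} (r : MExpr (Fin k) m)
    (T : DSST (Fin h) (RefSym (Fin k) m) R Ω) : Store R Ω :=
  { T.store with
    num := fun a i =>
      if a = 0 ∧ i = 4 then r.code.length
      else if a = 3 then r.code.getD i 0
      else T.store.num a i }

open Classical in
/-- The input that consists of a DSST and an NFA with states `0, …, n-1`: cell `4` of number array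
`0` holds `n`; cell `(p * (k + 2 * m) + j) * n + p₂` of number array `3` tells whether there is
a transition from `p` to `p₂` labelled with the symbol number `j`; number arrays `4` and `5` tell
which states are initial and which are accepting. -/
noncomputable def inputNFA {h k m n : ℕ} {R Ω : Type*} (M : NFA (RefSym (Fin k) m) (Fin n))
    (T : DSST (Fin h) (RefSym (Fin k) m) R Ω) : Store R Ω :=
  { T.store with
    num := fun a i =>
      if a = 0 ∧ i = 4 then n
      else if a = 3 then
        if ∃ (e : Fin n × RefSym (Fin k) m) (p₂ : Fin n), entryAt n k m (i / n) = some e ∧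
            (p₂ : ℕ) = i % n ∧ p₂ ∈ M.step e.1 e.2
        then 1 else 0
      else if a = 4 then if ∃ p ∈ M.start, (p : ℕ) = i then 1 else 0
      else if a = 5 then if ∃ p ∈ M.accept, (p : ℕ) = i then 1 else 0
      else T.store.num a i }

/-! ### Representation of the output in the memory -/

/-- The memory holds the NSST `T` with states `0, …, N-1` in the arrays with names `10` to `15`.
Cells `0` and `1` of number array `10` hold the numbers of states and of transitions. The arrays
`11` hold, for every state, whether it is initial (`0` means no) and its initial valuation, and the
arrays `12` whether the final function is defined and its value. For each transition, number arrays
`13`, `14`, `15` hold its source, letter and target, and assignment array `13` its assignment. -/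
structure Store.Represents {N k : ℕ} {R Ω : Type*} (s : Store R Ω)
    (T : NSST (Fin N) (Fin k) R Ω) : Prop where
  states : s.num 10 0 = N
  init : ∀ q : Fin N, (T.init q).map Valuation.toAssignment =
    if s.num 11 q = 0 then none else some (s.asg 11 q)
  final : ∀ q : Fin N, T.final q = if s.num 12 q = 0 then none else some (s.str 12 q)
  trans : T.trans.map (fun τ => ((τ.1 : ℕ), (τ.2.1 : ℕ), τ.2.2.1, (τ.2.2.2 : ℕ))) =
    (Multiset.range (s.num 10 1)).map fun j =>
      (s.num 13 j, s.num 14 j, s.asg 13 j, s.num 15 j)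

/-- On the input `s`, the program `P` halts within `time` steps and leaves in the memory an NSST
whose bag semantics is `f`. -/
def Constructs {k : ℕ} {R Ω : Type*} (P : Prog) (s : Store R Ω) (time : ℕ)
    (f : List (Fin k) → Multiset (List Ω)) : Prop :=
  ∃ (s₂ : Store R Ω) (t : ℕ), Exec P s s₂ t ∧ t ≤ time ∧
    ∃ (N : ℕ) (T : NSST (Fin N) (Fin k) R Ω), s₂.Represents T ∧ ∀ D, T.sem D = f D

end ET

/-! Many words of `L` can describe the same tuple: brackets of different variables between two
letters may be interleaved in several ways, and an empty span may be marked repeatedly. What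
survives is, at each position, the pattern of the flags `c`, `e`, `o` of all variables; there are `2
^ (3 * m)` patterns. A tuple is determined by its sequence of `|D| + 1` patterns
(`blocks_injective`), its encoding is the canonical word with these patterns (`encode_eq_weave`),
and every multiref-word that describes the tuple has this very pattern sequence
(`IsTupleOf.patSeq_eq`). Hence the bag `etSem` can be indexed by the accepted pattern sequences,
each counted once (`etSem_eq_filterMap_seqs`).

Acceptance of a pattern sequence is decided by a subset construction: from a set of states one reads
a letter and then an arbitrary block of brackets with a given pattern (`letterSet`, `blockSet`,
`acceptsPat_iff`). This automaton is deterministic over letters and patterns. Its product with the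
DSST reads a letter and the canonical word of a pattern in one transition, whose assignment is the
composition of those of the DSST; compositions of copyless assignments are copyless. Accepting runs
that yield an output therefore correspond one to one to the accepted pattern sequences on which `T`
is defined (`prodNSST_sem`, `prodNSST_sem_eq_etSem`). A state of the product also remembers the last
pattern, because an NSST has only one initial valuation per state, whereas two first patterns may
lead to the same set and the same state of the DSST with different valuations.

For the running time, sets and patterns are binary numbers. The machine neither multiplies nor
shifts, so tables of multiples, powers of two and halves replace these operations. All the sets
`blockSet` of one set of states are found together by a search in the graph of pairs of a state and
a pattern number. With `P = 2 ^ (3 * m)` and `ne` edges, the total cost is a constant times `2 ^ n *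
k * P * (n + 1) * h * P * (m + ne + 1)` (`Loaded.halts_constructProg`). An NFA has `ne ≤ n * (k + 2
* m) * n`, and three factors `n + 1 ≤ 2 ^ n` turn `2 ^ n` into `2 ^ (4 * n)`. An expression with `ℓ`
tokens is turned into an automaton in the manner of Thompson with `2 * ℓ` states and at most `4 * ℓ`
edges, and `(2 * ℓ + 1) ^ 2 ≤ 3 * 2 ^ (2 * ℓ)` leads to `2 ^ (4 * ℓ)`. -/

namespace ET

/-! ### Patterns of brackets between two letters -/

section Patterns

variable {A : Type*} {m : ℕ}

/-- The pattern of the brackets between two letters: for every variable, the flags `c`, `e`, `o`. -/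
abbrev Pat (m : ℕ) : Type := Fin m → Fin 3 → Bool

/-- The pattern without brackets. -/
def Pat.zero (m : ℕ) : Pat m := fun _ _ => false

/-- The change of the pattern when one more bracket is read. -/
def Pat.step (π : Pat m) : RefSym A m → Option (Pat m)
  | .letter _ => none
  | .opn x => if π x 2 then none else some (Function.update π x ![π x 0, π x 1, true])
  | .cls x =>
      if π x 2 then some (Function.update π x ![π x 0, true, false])
      else if π x 0 || π x 1 then none
      else some (Function.update π x ![true, false, false])

/-- The brackets of a variable in the canonical order. -/
def Pat.wordVar (A : Type*) (π : Pat m) (x : Fin m) : List (RefSym A m) :=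
  (if π x 0 then [.cls x] else []) ++ (if π x 1 then [.opn x, .cls x] else []) ++
  (if π x 2 then [.opn x] else [])

/-- The canonical sequence of brackets with a given pattern. -/
def Pat.word (A : Type*) (π : Pat m) : List (RefSym A m) :=
  (List.finRange m).flatMap (π.wordVar A)

/-- The sequence of the patterns of a word, where `π` is the pattern of what has been read since
the last letter. -/
def patSeq : Pat m → List (RefSym A m) → Option (List (Pat m))
  | π, [] => some [π]
  | π, .letter _ :: w => (patSeq (Pat.zero m) w).map (π :: ·)
  | π, .opn x :: w => (π.step (A := A) (.opn x)).bind (patSeq · w)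
  | π, .cls x :: w => (π.step (A := A) (.cls x)).bind (patSeq · w)

/-- The canonical word with given document and given patterns. -/
def weave : List A → List (Pat m) → List (RefSym A m)
  | a :: D, π :: bs => π.word A ++ .letter a :: weave D bs
  | [], π :: _ => π.word A
  | _, [] => []

/-- The spans of `x` closed in a word that starts at position `i`, where `o` is the position of
the bracket of `x` that is open at the beginning. -/
def closed (x : Fin m) : ℕ → Option ℕ → List (RefSym A m) → Set (ℕ × ℕ)
  | _, _, [] => ∅
  | i, o, .letter _ :: w => closed x (i + 1) o w
  | i, o, .opn y :: w => if y = x then closed x i (some i) w else closed x i o w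
  | i, o, .cls y :: w =>
      if y = x then {p | o = some p.1 ∧ p.2 = i} ∪ closed x i none w else closed x i o w

/-- The brackets of `x` alternate, where `b` tells whether a bracket is open at the beginning. -/
def Alternates (x : Fin m) : Bool → List (RefSym A m) → Prop
  | b, [] => b = false
  | b, .letter _ :: w => Alternates x b w
  | b, .opn y :: w => if y = x then b = false ∧ Alternates x true w else Alternates x b w
  | b, .cls y :: w => if y = x then b = true ∧ Alternates x false w else Alternates x b w

-- Each bracket of `x` switches between the two implications, so they are proved together; in the
-- second one a bracket is open, and the remaining sequence starts with a closing one.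
open Classical in
theorem alternates_of_filter (x : Fin m) (w : List (RefSym A m)) : ∀ k : ℕ,
    (w.filter (fun s => s = .opn x ∨ s = .cls x) =
      (List.replicate k [RefSym.opn x, RefSym.cls x]).flatten → Alternates x false w) ∧
    (w.filter (fun s => s = .opn x ∨ s = .cls x) =
      .cls x :: (List.replicate k [RefSym.opn x, RefSym.cls x]).flatten → Alternates x true w) := by
  induction w with
  | nil => intro k; simp [Alternates]
  | cons s w ih =>
    intro k
    cases s with
    | letter a => simpa [Alternates] using ih k
    | opn y =>
      by_cases hy : y = x
      · subst hy
        cases k with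
        | zero => simp
        | succ k => simpa [Alternates, List.replicate_succ] using (ih k).2
      · simpa [Alternates, hy] using ih k
    | cls y =>
      by_cases hy : y = x
      · subst hy
        cases k with
        | zero => simpa [Alternates] using (ih 0).1
        | succ k => simpa [Alternates, List.replicate_succ] using (ih (k + 1)).1
      · simpa [Alternates, hy] using ih k

theorem IsMultirefWord.alternates {w : List (RefSym A m)} (h : IsMultirefWord w) (x : Fin m) :
    Alternates x false w := by
  obtain ⟨k, hk⟩ := h x
  exact (alternates_of_filter x w k).1 hk

@[simp] theorem doc_nil : doc ([] : List (RefSym A m)) = [] := rfl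

@[simp] theorem doc_letter (a : A) (w : List (RefSym A m)) : doc (.letter a :: w) = a :: doc w := rfl

@[simp] theorem doc_opn (x : Fin m) (w : List (RefSym A m)) : doc (.opn x :: w) = doc w := rfl

@[simp] theorem doc_cls (x : Fin m) (w : List (RefSym A m)) : doc (.cls x :: w) = doc w := rfl

/-- Every span starts inside the word, except possibly the one whose bracket is open at the
beginning. With `o = none` the second alternative disappears. -/
theorem closed_bounds (x : Fin m) (w : List (RefSym A m)) : ∀ (i : ℕ) (o : Option ℕ) (p : ℕ × ℕ),
    p ∈ closed x i o w → (i ≤ p.1 ∧ p.1 ≤ p.2 ∨ o = some p.1) ∧ i ≤ p.2 ∧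
      p.2 ≤ i + (doc w).length := by
  induction w with
  | nil => simp [closed]
  | cons s w ih =>
    intro i o p hp
    cases s with
    | letter a =>
      have := ih _ _ _ hp
      simp only [doc_letter, List.length_cons]
      refine ⟨this.1.imp (fun h => ⟨by omega, h.2⟩) id, by omega, by omega⟩
    | opn y =>
      simp only [closed] at hp
      split_ifs at hp with hy
      · have := ih _ _ _ hp
        simp only [doc_opn]
        refine ⟨.inl ?_, this.2⟩
        rcases this.1 with h | h
        · exact h
        · have h := Option.some.inj h; omega
      · exact ih _ _ _ hp
    | cls y =>
      simp only [closed] at hp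
      split_ifs at hp with hy
      · simp only [doc_cls]
        rcases hp with hp | hp
        · exact ⟨.inr hp.1, hp.2.ge, by have := hp.2; omega⟩
        · have := ih _ _ _ hp
          exact ⟨.inl (this.1.resolve_right (by simp)), this.2⟩
      · exact ih _ _ _ hp

/-- After a closing bracket of `x` nothing is open, so all spans closed later start at this position
or after it. -/
theorem closed_disjoint (x : Fin m) (w : List (RefSym A m)) : ∀ (i : ℕ) (o : Option ℕ)
    (p q : ℕ × ℕ), p ∈ closed x i o w → q ∈ closed x i o w → p ≠ q → p.2 ≤ q.1 ∨ q.2 ≤ p.1 := by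
  induction w with
  | nil => simp [closed]
  | cons s w ih =>
    intro i o p q hp hq hpq
    cases s with
    | letter a => exact ih _ _ _ _ hp hq hpq
    | opn y =>
      simp only [closed] at hp hq
      split_ifs at hp hq with hy <;> exact ih _ _ _ _ hp hq hpq
    | cls y =>
      simp only [closed] at hp hq
      split_ifs at hp hq with hy
      · have key : ∀ p q : ℕ × ℕ, p ∈ {p : ℕ × ℕ | o = some p.1 ∧ p.2 = i} →
            q ∈ closed x i none w → p.2 ≤ q.1 := by
          intro p q hp hq
          have h := closed_bounds x w _ _ _ hq
          rw [hp.2]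
          exact (h.1.resolve_right (by simp)).1
        rcases hp with hp | hp <;> rcases hq with hq | hq
        · exact absurd (Prod.ext (Option.some.inj (hp.1.symm.trans hq.1)) (hp.2.trans hq.2.symm)) hpq
        · exact .inl (key p q hp hq)
        · exact .inr (key q p hq hp)
        · exact ih _ _ _ _ hp hq hpq
      · exact ih _ _ _ _ hp hq hpq

theorem exists_closed (x : Fin m) (w : List (RefSym A m)) : ∀ (i l : ℕ),
    Alternates x true w → ∃ r, i ≤ r ∧ (l, r) ∈ closed x i (some l) w := by
  induction w with
  | nil => simp [Alternates]
  | cons s w ih =>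
    intro i l h
    cases s with
    | letter a =>
      obtain ⟨r, hr, h⟩ := ih (i + 1) l h
      exact ⟨r, by omega, h⟩
    | opn y =>
      simp only [Alternates] at h
      split_ifs at h with hy
      · exact absurd h.1 (by simp)
      · simpa [closed, hy] using ih i l h
    | cls y =>
      simp only [Alternates] at h
      split_ifs at h with hy
      · exact ⟨i, le_rfl, by simp [closed, hy]⟩
      · simpa [closed, hy] using ih i l h

/-- Alternation is needed here: in `⊢x ⊢x ⊣x` both opening brackets have a next closing one, but the
scan in `closed` remembers only the last. The second disjunct covers the bracket that is open at the
beginning and makes the induction work. -/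
theorem mem_closed_iff (x : Fin m) (w : List (RefSym A m)) : ∀ (i : ℕ) (o : Option ℕ) (l r : ℕ),
    Alternates x o.isSome w → ((l, r) ∈ closed x i o w ↔
      (∃ u v z : List (RefSym A m), w = u ++ [.opn x] ++ v ++ [.cls x] ++ z ∧ .cls x ∉ v ∧
        l = i + (doc u).length ∧ r = i + (doc (u ++ v)).length) ∨
      (∃ v z : List (RefSym A m), w = v ++ [.cls x] ++ z ∧ .cls x ∉ v ∧ o = some l ∧
        r = i + (doc v).length)) := by
  induction w with
  | nil => simp [closed]
  | cons s w ih =>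
    intro i o l r halt
    -- Both kinds of factorization are divided according to whether the first marked bracket is `s`
    -- itself, that is, whether the leading factor is empty.
    have split : ((∃ u v z : List (RefSym A m), s :: w = u ++ [.opn x] ++ v ++ [.cls x] ++ z ∧
          .cls x ∉ v ∧ l = i + (doc u).length ∧ r = i + (doc (u ++ v)).length) ∨
        (∃ v z : List (RefSym A m), s :: w = v ++ [.cls x] ++ z ∧ .cls x ∉ v ∧ o = some l ∧
          r = i + (doc v).length)) ↔
        ((s = .opn x ∧ ∃ v z, w = v ++ [.cls x] ++ z ∧ .cls x ∉ v ∧ l = i ∧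
          r = i + (doc v).length) ∨
        (∃ u v z, w = u ++ [.opn x] ++ v ++ [.cls x] ++ z ∧ .cls x ∉ v ∧
          l = i + (doc (s :: u)).length ∧ r = i + (doc (s :: (u ++ v))).length)) ∨
        ((s = .cls x ∧ o = some l ∧ r = i) ∨
        (s ≠ .cls x ∧ ∃ v z, w = v ++ [.cls x] ++ z ∧ .cls x ∉ v ∧ o = some l ∧
          r = i + (doc (s :: v)).length)) := by
      refine or_congr ⟨?_, ?_⟩ ⟨?_, ?_⟩
      · rintro ⟨u, v, z, hw, h⟩
        cases u with
        | nil =>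
          simp only [List.nil_append, List.cons_append, List.cons.injEq] at hw
          exact .inl ⟨hw.1, v, z, by simpa using hw.2, by simpa using h⟩
        | cons s' u =>
          simp only [List.cons_append, List.cons.injEq] at hw
          obtain ⟨rfl, hw⟩ := hw
          exact .inr ⟨u, v, z, hw, h⟩
      · rintro (⟨hs, v, z, hw, h⟩ | ⟨u, v, z, hw, h⟩)
        · exact ⟨[], v, z, by simp [hs, hw], by simpa using h⟩
        · exact ⟨s :: u, v, z, by simp [hw], by simpa using h⟩
      · rintro ⟨v, z, hw, h⟩
        cases v with
        | nil =>
          simp only [List.nil_append, List.singleton_append, List.cons.injEq] at hw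
          exact .inl ⟨hw.1, by simpa using h⟩
        | cons s' v =>
          simp only [List.cons_append, List.cons.injEq] at hw
          obtain ⟨rfl, hw⟩ := hw
          simp only [List.mem_cons, not_or] at h
          exact .inr ⟨fun e => h.1.1 e.symm, v, z, hw, h.1.2, h.2⟩
      · rintro (⟨hs, h⟩ | ⟨hs, v, z, hw, h⟩)
        · exact ⟨[], w, by simp [hs], by simpa using h⟩
        · refine ⟨s :: v, z, by simp [hw], ?_, h.2⟩
          simp only [List.mem_cons, not_or]
          exact ⟨fun e => hs e.symm, h.1⟩
    rw [split]
    cases s with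
    | letter a =>
      rw [show closed x i o (.letter a :: w) = closed x (i + 1) o w from rfl, ih _ _ _ _ halt]
      simp [add_assoc, add_comm 1]
    | opn y =>
      by_cases hy : y = x
      · subst hy
        simp only [Alternates, if_true] at halt
        have ho : o = none := by simpa using halt.1
        subst ho
        rw [show closed y i none (.opn y :: w) = closed y i (some i) w by simp [closed],
          ih i (some i) l r halt.2]
        simp only [doc_opn, true_and]
        constructor
        · rintro (h | ⟨v, z, h⟩)
          · exact .inl (.inr h)
          · exact .inl (.inl ⟨v, z, h.1, h.2.1, (Option.some.inj h.2.2.1).symm, h.2.2.2⟩)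
        · rintro ((⟨v, z, h⟩ | h) | h)
          · exact .inr ⟨v, z, h.1, h.2.1, by rw [h.2.2.1], h.2.2.2⟩
          · exact .inl h
          · simp at h
      · rw [show closed x i o (.opn y :: w) = closed x i o w by simp [closed, hy],
          ih _ _ _ _ (by simpa [Alternates, hy] using halt)]
        simp [hy]
    | cls y =>
      by_cases hy : y = x
      · subst hy
        simp only [Alternates, if_true] at halt
        have e1 : ((l, r) ∈ closed y i o (.cls y :: w)) ↔ (o = some l ∧ r = i) ∨
            (l, r) ∈ closed y i none w := by simp [closed]
        rw [e1, ih i none l r halt.2]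
        simp [or_comm]
      · rw [show closed x i o (.cls y :: w) = closed x i o w by simp [closed, hy],
          ih _ _ _ _ (by simpa [Alternates, hy] using halt)]
        simp [hy]

theorem marks_iff_mem_closed {w : List (RefSym A m)} (hw : IsMultirefWord w) {n : ℕ} (x : Fin m)
    (s : Span n) : Marks w x s ↔ (s.left, s.right) ∈ closed x 0 none w := by
  rw [mem_closed_iff x w 0 none _ _ (hw.alternates x)]
  simp [Marks]

open Classical in
/-- The pattern at position `j` that is given by the sets of the spans of the variables. -/
noncomputable def flags (M : Fin m → Set (ℕ × ℕ)) (j : ℕ) : Pat m := fun x =>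
  ![decide (∃ l < j, (l, j) ∈ M x), decide ((j, j) ∈ M x), decide (∃ r > j, (j, r) ∈ M x)]

/-- What remains to be read is added to a pattern. -/
def Pat.comb (π g : Pat m) : Pat m := fun x => ![π x 0 || g x 0, π x 1 || g x 1, g x 2]

theorem Pat.ext_iff3 {f g : Fin 3 → Bool} : f = g ↔ f 0 = g 0 ∧ f 1 = g 1 ∧ f 2 = g 2 :=
  ⟨fun h => by simp [h], fun h => by ext i; fin_cases i <;> simp [h]⟩

theorem Pat.zero_comb (g : Pat m) : (Pat.zero m).comb g = g := by
  funext x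
  rw [Pat.ext_iff3]
  simp [Pat.comb, Pat.zero]

/-- `π` is the pattern of the part of the current block that has been read, and `o x` is where the
open bracket of `x` started. It started in this block exactly if the flag `π x 2` is set; if it
started earlier, no bracket of `x` has occurred in this block, so the flags `0` and `1` are clear.
In `Pat.comb` the last flag comes only from the rest of the word: a bracket opened in this block may
still be closed in it and then marks an empty span. -/
theorem patSeq_eq (w : List (RefSym A m)) : ∀ (i : ℕ) (o : Fin m → Option ℕ) (π : Pat m),
    (∀ x, Alternates x (o x).isSome w) → (∀ x, o x = none → π x 2 = false) →
    (∀ x l, o x = some l → l ≤ i ∧ (l = i ↔ π x 2 = true) ∧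
      (l < i → π x 0 = false ∧ π x 1 = false)) →
    patSeq π w = some (π.comb (flags (fun x => closed x i (o x) w) i) ::
      (List.range (doc w).length).map fun j =>
        flags (fun x => closed x i (o x) w) (i + 1 + j)) := by
  induction w with
  | nil =>
    intro i o π halt hn hs
    simp only [patSeq, doc_nil, List.length_nil, List.range_zero, List.map_nil, Option.some.injEq,
      List.cons.injEq, and_true]
    funext x
    rw [Pat.ext_iff3]
    have : o x = none := by simpa [Alternates] using halt x
    simp [Pat.comb, flags, closed, hn x this]
  | cons s w ih =>
    intro i o π halt hn hs
    cases s with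
    | letter a =>
      rw [show (fun x => closed x i (o x) (.letter a :: w)) = fun x => closed x (i + 1) (o x) w
        from rfl, patSeq, ih (i + 1) o (Pat.zero m) halt (fun _ _ => rfl) ?_]
      · simp only [Pat.zero_comb, Option.map_some, doc_letter, List.length_cons, Option.some.injEq]
        rw [List.range_succ_eq_map, List.map_cons, List.map_map]
        simp only [List.cons.injEq]
        -- The letter ends the block at `i`. All spans closed afterwards end after `i`, so the rest
        -- of the word contributes nothing to the flags `0` and `1`.
        refine ⟨?_, trivial, ?_⟩
        · funext x
          rw [Pat.ext_iff3]
          have b := closed_bounds x w (i + 1) (o x)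
          simp only [Pat.comb, flags, Matrix.cons_val]
          refine ⟨?_, ?_, ?_⟩
          · have : ¬ ∃ l < i, (l, i) ∈ closed x (i + 1) (o x) w := by
              rintro ⟨l, _, h⟩
              have := (b _ h).2.1
              simp at this
            simp [this]
          · have : ¬ (i, i) ∈ closed x (i + 1) (o x) w := by
              intro h
              have := (b _ h).2.1
              simp at this
            simp [this]
          · obtain ho | ⟨l, ho⟩ : o x = none ∨ ∃ l, o x = some l := by
              cases o x <;> simp
            · rw [hn x ho, eq_comm, decide_eq_false_iff_not]
              rintro ⟨r, _, h⟩
              have := (b _ h).1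
              simp [ho] at this
            · obtain ⟨h1, h2, -⟩ := hs x l ho
              -- A bracket opened at `i` survives the letter and, by alternation, is closed later:
              -- it starts a non-empty span. One opened before `i` starts no span at `i`.
              by_cases hl : l = i
              · have ha := halt x
                simp only [Alternates, ho, Option.isSome_some] at ha
                obtain ⟨r, hr, h⟩ := exists_closed x w (i + 1) l ha
                have : ∃ r > i, (i, r) ∈ closed x (i + 1) (o x) w :=
                  ⟨r, by omega, by rw [ho]; exact hl ▸ h⟩
                simp [h2.1 hl, this]
              · have : π x 2 = false := by simpa using mt h2.2 hl
                rw [this, eq_comm, decide_eq_false_iff_not]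
                rintro ⟨r, _, h⟩
                have := (b _ h).1
                simp [ho, hl] at this
        · apply List.map_congr_left
          intro j _
          simp only [Function.comp]
          congr 1
          omega
      · intro x l ho
        obtain ⟨h1, -, -⟩ := hs x l ho
        refine ⟨by omega, ⟨fun h => by omega, fun h => by simp [Pat.zero] at h⟩, fun _ => ⟨rfl, rfl⟩⟩
    | opn y =>
      have hy := halt y
      simp only [Alternates, if_true] at hy
      have hoy : o y = none := by simpa using hy.1
      have e : ∀ x, closed x i (o x) (.opn y :: w) =
          closed x i (Function.update o y (some i) x) w := by
        intro x
        by_cases hx : y = x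
        · subst hx; simp [closed]
        · simp [closed, hx, Function.update_of_ne (Ne.symm hx)]
      simp only [patSeq, Pat.step, hn y hoy, e, doc_opn]
      simp only [Bool.false_eq_true, if_false, Option.bind_some]
      rw [ih i (Function.update o y (some i))]
      · congr 2
        funext x
        rw [Pat.ext_iff3]
        by_cases hx : x = y
        · subst hx; simp [Pat.comb]
        · simp [Pat.comb, Function.update_of_ne hx]
      · intro x
        by_cases hx : x = y
        · subst hx; simpa using hy.2
        · have := halt x
          simp only [Alternates, Ne.symm hx, if_false] at this
          simpa [Function.update_of_ne hx] using this
      · intro x hox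
        by_cases hx : x = y
        · subst hx; simp at hox
        · rw [Function.update_of_ne hx] at hox ⊢
          exact hn x hox
      · intro x l hox
        by_cases hx : x = y
        · subst hx
          simp only [Function.update_self, Option.some.injEq] at hox
          subst hox
          simp
        · rw [Function.update_of_ne hx] at hox ⊢
          exact hs x l hox
    | cls y =>
      have hy := halt y
      simp only [Alternates, if_true] at hy
      obtain ⟨l, hoy⟩ := Option.isSome_iff_exists.1 hy.1
      obtain ⟨hl, hl2, hl3⟩ := hs y l hoy
      set M := fun x => closed x i (o x) (.cls y :: w) with hM
      have e : ∀ x, M x = (if x = y then {(l, i)} else ∅) ∪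
          closed x i (Function.update o y none x) w := by
        intro x
        by_cases hx : y = x
        · subst hx
          ext ⟨a, b⟩
          simp [hM, closed, hoy, eq_comm]
        · simp [hM, closed, hx, Ne.symm hx]
      -- The induction hypothesis after the closing bracket, for any new pattern that differs from
      -- `π` only at `y` and in which `y` is not open.
      have hcond : ∀ π' : Pat m, (∀ x, x ≠ y → π' x = π x) → π' y 2 = false →
          patSeq π' w = some (π'.comb (flags (fun x => closed x i (Function.update o y none x) w) i)
            :: (List.range (doc w).length).map fun j =>
              flags (fun x => closed x i (Function.update o y none x) w) (i + 1 + j)) := by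
        intro π' h1 h2
        apply ih
        · intro x
          by_cases hx : x = y
          · subst hx; simpa using hy.2
          · have := halt x
            simp only [Alternates, Ne.symm hx, if_false] at this
            simpa [Function.update_of_ne hx] using this
        · intro x hox
          by_cases hx : x = y
          · subst hx; exact h2
          · rw [Function.update_of_ne hx] at hox
            rw [h1 x hx]
            exact hn x hox
        · intro x l' hox
          by_cases hx : x = y
          · subst hx; simp at hox
          · rw [Function.update_of_ne hx] at hox
            rw [h1 x hx]
            exact hs x l' hox
      have htail : ∀ j, flags (fun x => closed x i (Function.update o y none x) w) (i + 1 + j) =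
          flags M (i + 1 + j) := by
        intro j
        funext x
        rw [Pat.ext_iff3]
        by_cases hx : x = y
        · subst hx
          have n1 : i + 1 + j ≠ i := by omega
          have n2 : i + 1 + j ≠ l := by omega
          simp [flags, e, n1, n2]
        · simp [flags, e, hx]
      have hhead : ∀ x, x ≠ y → flags (fun x => closed x i (Function.update o y none x) w) i x =
          flags M i x := by
        intro x hx
        simp [flags, e, hx]
      -- All other variables and all later positions are unaffected, so the claim reduces to the
      -- three flags of `y`.
      have fin : ∀ v : Fin 3 → Bool, v 2 = false →
          (![v 0 || flags (fun x => closed x i (Function.update o y none x) w) i y 0,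
            v 1 || flags (fun x => closed x i (Function.update o y none x) w) i y 1,
            flags (fun x => closed x i (Function.update o y none x) w) i y 2] : Fin 3 → Bool) =
            ![π y 0 || flags M i y 0, π y 1 || flags M i y 1, flags M i y 2] →
          patSeq (Function.update π y v) w = some (π.comb (flags M i) ::
            (List.range (doc (.cls y :: w)).length).map fun j => flags M (i + 1 + j)) := by
        intro v hv h
        rw [hcond _ (fun x hx => Function.update_of_ne hx _ _) (by simpa using hv)]
        simp only [htail, doc_cls]
        congr 2
        funext x
        by_cases hx : x = y
        · subst hx; simpa [Pat.comb] using h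
        · simp [Pat.comb, Function.update_of_ne hx, hhead x hx]
      simp only [patSeq, Pat.step]
      -- The span that is closed here is empty exactly if its bracket was opened in the current
      -- block.
      by_cases hli : l = i
      · rw [if_pos (hl2.1 hli), Option.bind_some]
        refine fin _ (by simp) ?_
        subst hli
        rw [Pat.ext_iff3]
        refine ⟨?_, ?_, ?_⟩
        · simp only [flags, Matrix.cons_val]
          congr 1
          simp only [decide_eq_decide]
          refine exists_congr fun a => and_congr_right fun ha => ?_
          simp [e, ha.ne]
        · simp [flags, e]
        · simp only [flags, Matrix.cons_val, decide_eq_decide]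
          refine exists_congr fun a => and_congr_right fun ha => ?_
          simp [e, ha.ne']
      · have hlt : l < i := by omega
        have h2 : π y 2 = false := by simpa using mt hl2.2 hli
        rw [if_neg (by simp [h2]), if_neg (by simp [hl3 hlt]), Option.bind_some]
        refine fin _ (by simp) ?_
        rw [Pat.ext_iff3]
        refine ⟨?_, ?_, ?_⟩
        · have : ∃ a < i, (a, i) ∈ M y := ⟨l, hlt, by simp [e]⟩
          simp [flags, this]
        · have : i ≠ l := Ne.symm hli
          simp [flags, e, hl3 hlt, this]
        · have : i ≠ l := Ne.symm hli
          simp [flags, e, this]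

/-! ### Multispan-tuples as sequences of patterns -/

/-- The pairs of positions of the spans of a variable. -/
def MultispanTuple.pairs {n : ℕ} (t : MultispanTuple m n) (x : Fin m) : Set (ℕ × ℕ) :=
  {p | ∃ s ∈ t.spans x, (s.left, s.right) = p}

/-- The patterns of a multispan-tuple. -/
noncomputable def MultispanTuple.blocks {n : ℕ} (t : MultispanTuple m n) : List (Pat m) :=
  (List.range (n + 1)).map (flags t.pairs)

theorem MultispanTuple.length_blocks {n : ℕ} (t : MultispanTuple m n) :
    t.blocks.length = n + 1 := by simp [MultispanTuple.blocks]

theorem mem_spans_iff {n : ℕ} (t : MultispanTuple m n) (x : Fin m) (s : Span n) :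
    s ∈ t.spans x ↔ (s.left, s.right) ∈ t.pairs x := by
  constructor
  · exact fun h => ⟨s, h, rfl⟩
  · rintro ⟨s', h, e⟩
    simp only [Prod.mk.injEq] at e
    rwa [← Span.ext e.1 e.2]

theorem pairs_disjoint {n : ℕ} (t : MultispanTuple m n) (x : Fin m) (p q : ℕ × ℕ)
    (hp : p ∈ t.pairs x) (hq : q ∈ t.pairs x) (hpq : p ≠ q) : p.2 ≤ q.1 ∨ q.2 ≤ p.1 := by
  obtain ⟨s, hs, rfl⟩ := hp
  obtain ⟨s', hs', rfl⟩ := hq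
  exact t.disjoint x hs hs' (fun h => hpq (by rw [h]))

theorem pairs_bounds {n : ℕ} (t : MultispanTuple m n) (x : Fin m) (p : ℕ × ℕ)
    (hp : p ∈ t.pairs x) : p.1 ≤ p.2 ∧ p.2 ≤ n := by
  obtain ⟨s, hs, rfl⟩ := hp
  exact ⟨s.left_le, s.right_le⟩

/-- For a non-empty span `(l, r)` the opening flag at `l` yields some `(l, r')` in the other tuple.
If `r ≠ r'`, the closing flag at the smaller of the two right ends yields, in the tuple that has the
longer span, a second span ending strictly inside the longer one, which contradicts disjointness. -/
theorem pairs_subset_of_flags {n : ℕ} (t t' : MultispanTuple m n)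
    (h : ∀ j ≤ n, flags t.pairs j = flags t'.pairs j) (x : Fin m) : t.pairs x ⊆ t'.pairs x := by
  classical
  rintro ⟨l, r⟩ hp
  have hc : ∀ j ≤ n, (∃ l < j, (l, j) ∈ t.pairs x) ↔ ∃ l < j, (l, j) ∈ t'.pairs x := by
    intro j hj
    simpa [flags] using congrFun (congrFun (h j hj) x) 0
  have he : ∀ j ≤ n, (j, j) ∈ t.pairs x ↔ (j, j) ∈ t'.pairs x := by
    intro j hj
    simpa [flags] using congrFun (congrFun (h j hj) x) 1
  have ho : ∀ j ≤ n, (∃ r > j, (j, r) ∈ t.pairs x) ↔ ∃ r > j, (j, r) ∈ t'.pairs x := by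
    intro j hj
    simpa [flags] using congrFun (congrFun (h j hj) x) 2
  obtain ⟨b1, b2⟩ := pairs_bounds t x _ hp
  simp only at b1 b2
  rcases b1.eq_or_lt with rfl | hlt
  · exact (he l b2).1 hp
  · obtain ⟨r', hr', hp'⟩ := (ho l (by omega)).1 ⟨r, hlt, hp⟩
    have b3 := (pairs_bounds t' x _ hp').2
    simp only at b3
    rcases lt_trichotomy r r' with h1 | rfl | h1
    · obtain ⟨l₂, hl₂, hp₂⟩ := (hc r b2).1 ⟨l, hlt, hp⟩
      have := pairs_disjoint t' x _ _ hp' hp₂ (by simp; omega)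
      simp only at this
      omega
    · exact hp'
    · obtain ⟨l₂, hl₂, hp₂⟩ := (hc r' b3).2 ⟨l, hr', hp'⟩
      have := pairs_disjoint t x _ _ hp hp₂ (by simp; omega)
      simp only at this
      omega

/-- This is what allows tuples to be counted by their pattern sequences without changing
multiplicities. -/
theorem blocks_injective {n : ℕ} :
    Function.Injective (MultispanTuple.blocks : MultispanTuple m n → List (Pat m)) := by
  intro t t' h
  have h' : ∀ j ≤ n, flags t.pairs j = flags t'.pairs j := by
    intro j hj
    have := List.map_inj_left.1 h j (by simp; omega)
    exact this
  refine MultispanTuple.ext (funext fun x => Set.ext fun s => ?_)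
  rw [mem_spans_iff, mem_spans_iff]
  exact ⟨fun hs => pairs_subset_of_flags t t' h' x hs,
    fun hs => pairs_subset_of_flags t' t (fun j hj => (h' j hj).symm) x hs⟩

/-- The spans marked in a multiref-word are pairwise disjoint by `closed_disjoint`, so they do form
a multispan-tuple. -/
theorem exists_isTupleOf {w : List (RefSym A m)} (hw : IsMultirefWord w) {n : ℕ} :
    ∃ t : MultispanTuple m n, IsTupleOf t w := by
  refine ⟨⟨fun x => {s | Marks w x s}, fun x s hs s' hs' hne => ?_⟩, fun x s => Iff.rfl⟩
  simp only [Set.mem_ofPred_eq, marks_iff_mem_closed hw] at hs hs'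
  refine closed_disjoint x w _ _ _ _ hs hs' fun h => hne ?_
  simp only [Prod.mk.injEq] at h
  exact Span.ext h.1 h.2

/-- The patterns are computed from the marked spans alone, hence all words that describe the same
tuple have the same pattern sequence. -/
theorem IsTupleOf.patSeq_eq {w : List (RefSym A m)} (hw : IsMultirefWord w)
    {t : MultispanTuple m (doc w).length} (ht : IsTupleOf t w) :
    patSeq (Pat.zero m) w = some t.blocks := by
  have hp : t.pairs = fun x => closed x 0 none w := by
    funext x
    ext ⟨l, r⟩
    constructor
    · rintro ⟨s, hs, e⟩
      rw [← e, ← marks_iff_mem_closed hw]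
      exact (ht x s).1 hs
    · intro h
      have b := closed_bounds x w _ _ _ h
      simp only [reduceCtorEq, or_false, zero_add] at b
      refine ⟨⟨l, r, b.1.2, b.2.2⟩, ?_, rfl⟩
      rw [ht, marks_iff_mem_closed hw]
      exact h
  rw [ET.patSeq_eq w 0 (fun _ => none) (Pat.zero m) (fun x => hw.alternates x) (fun _ _ => rfl)
    (by simp), Pat.zero_comb, MultispanTuple.blocks, hp, List.range_succ_eq_map, List.map_cons,
    List.map_map]
  simp [Function.comp_def, add_comm]

theorem block_eq_word {n : ℕ} (t : MultispanTuple m n) (i : ℕ) :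
    t.block A i = (flags t.pairs i).word A := by
  classical
  unfold MultispanTuple.block Pat.word
  congr 1
  funext x
  have hc : (∃ s ∈ t.spans x, s.right = i ∧ s.left ≠ i) ↔ ∃ l < i, (l, i) ∈ t.pairs x := by
    constructor
    · rintro ⟨s, hs, h1, h2⟩
      exact ⟨s.left, by have := s.left_le; omega, s, hs, by simp [h1]⟩
    · rintro ⟨l, hl, s, hs, e⟩
      simp only [Prod.mk.injEq] at e
      exact ⟨s, hs, e.2, by omega⟩
  have he : (∃ s ∈ t.spans x, s.left = i ∧ s.right = i) ↔ (i, i) ∈ t.pairs x := by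
    simp [MultispanTuple.pairs]
  have ho : (∃ s ∈ t.spans x, s.left = i ∧ s.right ≠ i) ↔ ∃ r > i, (i, r) ∈ t.pairs x := by
    constructor
    · rintro ⟨s, hs, h1, h2⟩
      exact ⟨s.right, by have := s.left_le; omega, s, hs, by simp [h1]⟩
    · rintro ⟨r, hr, s, hs, e⟩
      simp only [Prod.mk.injEq] at e
      exact ⟨s, hs, e.1, by omega⟩
  simp only [MultispanTuple.blockVar, Pat.wordVar, flags, hc, he, ho, Matrix.cons_val,
    decide_eq_true_eq]

/-- The induction on the document shifts the positions, hence the general offset `i`. -/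
theorem weave_range (f : ℕ → Pat m) (D : List A) : ∀ i : ℕ,
    (D.zipIdx i).flatMap (fun p => (f p.2).word A ++ [RefSym.letter p.1]) ++
      (f (i + D.length)).word A = weave D ((List.range (D.length + 1)).map fun j => f (i + j)) := by
  induction D with
  | nil => intro i; simp [weave]
  | cons a D ih =>
    intro i
    rw [List.length_cons, List.range_succ_eq_map, List.map_cons, List.map_map, weave,
      List.zipIdx_cons, List.flatMap_cons]
    have := ih (i + 1)
    simp only [List.append_assoc, List.cons_append] at this ⊢
    rw [show i + (D.length + 1) = i + 1 + D.length by omega]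
    simp only [Nat.add_zero]
    rw [List.nil_append, this]
    congr 4
    funext j
    simp only [Function.comp]
    congr 1
    omega

theorem encode_eq_weave (D : List A) (t : MultispanTuple m D.length) :
    t.encode D = weave D t.blocks := by
  have := weave_range (flags t.pairs) D 0
  simp only [Nat.zero_add] at this
  rw [MultispanTuple.encode, MultispanTuple.blocks, ← this]
  simp only [block_eq_word]

end Patterns

/-! ### Automata with numbered symbols -/

section Automata

variable {k m : ℕ}

/-- The words that label the paths of a graph whose edges carry numbers of symbols; an edge whose
number belongs to no symbol is labelled with the empty word. -/
inductive Path (E : ℕ → ℕ → ℕ → Prop) : ℕ → List (RefSym (Fin k) m) → ℕ → Prop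
  | nil (p : ℕ) : Path E p [] p
  | eps {p j q r : ℕ} {w : List (RefSym (Fin k) m)} :
      E p j q → symAt k m j = none → Path E q w r → Path E p w r
  | sym {p j q r : ℕ} {s : RefSym (Fin k) m} {w : List (RefSym (Fin k) m)} :
      E p j q → symAt k m j = some s → Path E q w r → Path E p (s :: w) r

/-- One step inside of a block of brackets. -/
def Link (k : ℕ) (E : ℕ → ℕ → ℕ → Prop) (v w : ℕ × Pat m) : Prop :=
  ∃ j, E v.1 j w.1 ∧ ((symAt k m j = none ∧ w.2 = v.2) ∨
    ∃ s, symAt k m j = some s ∧ v.2.step s = some w.2)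

/-- The states that are reached from `S` by a block of brackets with pattern `π`. -/
def blockSet (k : ℕ) (E : ℕ → ℕ → ℕ → Prop) (S : Set ℕ) (π : Pat m) : Set ℕ :=
  {q | ∃ p ∈ S, Relation.ReflTransGen (Link k E) (p, Pat.zero m) (q, π)}

/-- The states that are reached from `S` by a letter. -/
def letterSet (E : ℕ → ℕ → ℕ → Prop) (S : Set ℕ) (a : ℕ) : Set ℕ := {q | ∃ p ∈ S, E p a q}

theorem symAt_eq_letter {j : ℕ} {a : Fin k} :
    symAt k m j = some (.letter a) ↔ j = a := by
  unfold symAt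
  split_ifs with h1 h2 h3
  · simp [Fin.ext_iff]
  · simp; omega
  · simp; omega
  · simp; omega

/-- Acceptance of the rest of a document with given patterns. -/
def AcceptsFrom (E : ℕ → ℕ → ℕ → Prop) (F : ℕ → Prop) : Set ℕ → List (Fin k) → List (Pat m) → Prop
  | S, [], [] => ∃ q ∈ S, F q
  | S, a :: D, π :: bs => AcceptsFrom E F (blockSet k E (letterSet E S a) π) D bs
  | _, _, _ => False

/-- Acceptance of a document with given patterns. -/
def AcceptsPat (E : ℕ → ℕ → ℕ → Prop) (I F : ℕ → Prop) (D : List (Fin k)) : List (Pat m) → Prop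
  | π :: bs => AcceptsFrom E F (blockSet k E {p | I p} π) D bs
  | [] => False

/-- The language of an automaton. -/
def pathLang (k m : ℕ) (E : ℕ → ℕ → ℕ → Prop) (I F : ℕ → Prop) : Language (RefSym (Fin k) m) :=
  {w | ∃ p q, I p ∧ F q ∧ Path E p w q}

variable {E : ℕ → ℕ → ℕ → Prop} {I F : ℕ → Prop}

theorem AcceptsFrom.mono {D : List (Fin k)} : ∀ {S S' : Set ℕ} {bs : List (Pat m)}, S ⊆ S' →
    AcceptsFrom E F S D bs → AcceptsFrom E F S' D bs := by
  induction D with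
  | nil =>
    intro S S' bs hS h
    cases bs with
    | nil => obtain ⟨q, hq, h⟩ := h; exact ⟨q, hS hq, h⟩
    | cons => exact h
  | cons a D ih =>
    intro S S' bs hS h
    cases bs with
    | nil => exact h
    | cons π bs =>
      refine ih ?_ h
      rintro q ⟨p, ⟨p', hp', h1⟩, h2⟩
      exact ⟨p, ⟨p', hS hp', h1⟩, h2⟩

/-- The induction follows the path, so it has to start in the middle of a block with pattern `π`.
Brackets and empty labels extend the chain of links; a letter closes the block and opens the next
one with the empty pattern. -/
theorem acceptsFrom_of_path {p q : ℕ} {w : List (RefSym (Fin k) m)} (hw : Path E p w q) (hq : F q) :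
    ∀ (π : Pat m) (bs : List (Pat m)), patSeq π w = some bs → ∃ π₁ bs' q', bs = π₁ :: bs' ∧
      Relation.ReflTransGen (Link k E) (p, π) (q', π₁) ∧ AcceptsFrom E F {q'} (doc w) bs' := by
  induction hw with
  | nil p =>
    intro π bs h
    simp only [patSeq, Option.some.injEq] at h
    exact ⟨π, [], p, h.symm, .refl, p, rfl, hq⟩
  | @eps p j p' r w he hj hp ih =>
    intro π bs h
    obtain ⟨π₁, bs', q', h1, h2, h3⟩ := ih hq π bs h
    exact ⟨π₁, bs', q', h1, .head (b := (p', π)) ⟨j, he, .inl ⟨hj, rfl⟩⟩ h2, h3⟩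
  | @sym p j p' r s w he hj hp ih =>
    intro π bs h
    cases s with
    | letter a =>
      simp only [patSeq, Option.map_eq_some_iff] at h
      obtain ⟨bs₁, h, rfl⟩ := h
      obtain ⟨π₁, bs', q', rfl, h2, h3⟩ := ih hq _ _ h
      refine ⟨π, _, p, rfl, .refl, ?_⟩
      simp only [doc_letter, AcceptsFrom]
      refine AcceptsFrom.mono ?_ h3
      rw [symAt_eq_letter] at hj
      subst hj
      rintro _ rfl
      exact ⟨p', ⟨p, rfl, he⟩, h2⟩
    | opn x =>
      simp only [patSeq, Option.bind_eq_some_iff] at h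
      obtain ⟨π', hs, h⟩ := h
      obtain ⟨π₁, bs', q', h1, h2, h3⟩ := ih hq π' bs h
      exact ⟨π₁, bs', q', h1, .head ⟨j, he, .inr ⟨_, hj, hs⟩⟩ h2, h3⟩
    | cls x =>
      simp only [patSeq, Option.bind_eq_some_iff] at h
      obtain ⟨π', hs, h⟩ := h
      obtain ⟨π₁, bs', q', h1, h2, h3⟩ := ih hq π' bs h
      exact ⟨π₁, bs', q', h1, .head ⟨j, he, .inr ⟨_, hj, hs⟩⟩ h2, h3⟩

/-- A chain of links spells a block of brackets that can be put in front of a word without changing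
its document. -/
theorem path_of_links {v v' : ℕ × Pat m} (h : Relation.ReflTransGen (Link k E) v v') {q : ℕ}
    {w : List (RefSym (Fin k) m)} {bs : List (Pat m)} (hw : Path E v'.1 w q)
    (hbs : patSeq v'.2 w = some bs) : ∃ w' : List (RefSym (Fin k) m), doc w' = doc w ∧
      Path E v.1 w' q ∧ patSeq v.2 w' = some bs := by
  induction h using Relation.ReflTransGen.head_induction_on with
  | refl => exact ⟨w, rfl, hw, hbs⟩
  | @head u u' hl _ ih =>
    obtain ⟨w', h1, h2, h3⟩ := ih
    obtain ⟨j, he, ⟨hj, hu⟩ | ⟨s, hj, hs⟩⟩ := hl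
    · exact ⟨w', h1, .eps he hj h2, hu ▸ h3⟩
    · cases s with
      | letter a => simp [Pat.step] at hs
      | opn x => exact ⟨.opn x :: w', h1, .sym he hj h2, by simp [patSeq, hs, h3]⟩
      | cls x => exact ⟨.cls x :: w', h1, .sym he hj h2, by simp [patSeq, hs, h3]⟩

/-- The word found here is empty or starts with a letter, so whatever pattern `π` precedes it is
recorded unchanged. This is why the last conclusion holds for every `π` and a block can be attached
in front. -/
theorem path_of_acceptsFrom {D : List (Fin k)} : ∀ {S : Set ℕ} {bs : List (Pat m)},
    AcceptsFrom E F S D bs → ∃ p ∈ S, ∃ (w : List (RefSym (Fin k) m)) (q : ℕ), doc w = D ∧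
      Path E p w q ∧ F q ∧ ∀ π, patSeq π w = some (π :: bs) := by
  induction D with
  | nil =>
    intro S bs h
    cases bs with
    | nil => obtain ⟨q, hq, h⟩ := h; exact ⟨q, hq, [], q, rfl, .nil q, h, fun _ => rfl⟩
    | cons => exact h.elim
  | cons a D ih =>
    intro S bs h
    cases bs with
    | nil => exact h.elim
    | cons π bs =>
      obtain ⟨p₁, ⟨p₀, ⟨p, hp, he⟩, hl⟩, w, q, h1, h2, h3, h4⟩ := ih h
      obtain ⟨w', h5, h6, h7⟩ := path_of_links hl h2 (h4 π)
      refine ⟨p, hp, .letter a :: w', q, by simp [h5, h1], .sym he (symAt_eq_letter.2 rfl) h6, h3,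
        fun π' => by simp only [patSeq] at *; simp [h7]⟩

/-- The set automaton tracks all words with the same patterns at once; different words of the
language with the same pattern sequence are thereby merged into one acceptance. -/
theorem acceptsPat_iff {D : List (Fin k)} {bs : List (Pat m)} : AcceptsPat E I F D bs ↔
    ∃ w ∈ pathLang k m E I F, doc w = D ∧ patSeq (Pat.zero m) w = some bs := by
  constructor
  · cases bs with
    | nil => exact fun h => h.elim
    | cons π bs =>
      intro h
      obtain ⟨p₁, ⟨p, hp, hl⟩, w, q, h1, h2, h3, h4⟩ := path_of_acceptsFrom h
      obtain ⟨w', h5, h6, h7⟩ := path_of_links hl h2 (h4 π)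
      exact ⟨w', ⟨p, q, hp, h3, h6⟩, by rw [h5, h1], h7⟩
  · rintro ⟨w, ⟨p, q, hp, hq, hw⟩, rfl, h⟩
    obtain ⟨π₁, bs', q', rfl, h2, h3⟩ := acceptsFrom_of_path hw hq _ _ h
    refine AcceptsFrom.mono ?_ h3
    rintro _ rfl
    exact ⟨p, hp, h2⟩

end Automata

/-! ### Sequences of patterns -/

/-- All sequences of `n` patterns. -/
def seqs (m : ℕ) : ℕ → Multiset (List (Pat m))
  | 0 => {[]}
  | n + 1 => (Finset.univ : Finset (Pat m)).val.bind fun π => (seqs m n).map (π :: ·)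

theorem mem_seqs {m : ℕ} : ∀ {n : ℕ} {bs : List (Pat m)}, bs ∈ seqs m n ↔ bs.length = n
  | 0, bs => by simp [seqs]
  | n + 1, bs => by
    cases bs with
    | nil => simp [seqs]
    | cons π bs => simp [seqs, mem_seqs]

theorem nodup_seqs (m : ℕ) : ∀ n : ℕ, (seqs m n).Nodup
  | 0 => by simp [seqs]
  | n + 1 => by
    rw [seqs, Multiset.nodup_bind]
    refine ⟨fun π _ => (nodup_seqs m n).map (List.cons_injective), ?_⟩
    refine (Finset.univ.nodup).pairwise fun π _ π' _ hne => ?_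
    simp only [Function.onFun, Multiset.disjoint_left, Multiset.mem_map]
    rintro _ ⟨bs, _, rfl⟩ ⟨bs', _, h⟩
    exact hne (by simpa using (List.cons.inj h).1.symm)

/-- The map `MultispanTuple.blocks` is a bijection from the tuples of the document onto the pattern
sequences satisfying `p`, and the encoding depends only on the patterns. -/
theorem etSem_eq_filterMap_seqs {A Ω : Type*} {m : ℕ} (L : Language (RefSym A m))
    (hL : ∀ w ∈ L, IsMultirefWord w) (T : List (RefSym A m) → Option (List Ω)) (D : List A)
    (p : List (Pat m) → Prop) [DecidablePred p]
    (hp : ∀ bs, p bs ↔ ∃ w ∈ L, doc w = D ∧ patSeq (Pat.zero m) w = some bs) :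
    etSem (spannerOf L) T D =
      (seqs m (D.length + 1)).filterMap fun bs => if p bs then T (weave D bs) else none := by
  classical
  -- Both sides have no repetitions: the left one by injectivity, the right one as part of `seqs`.
  -- It is enough to compare their elements.
  have key : (Set.toFinite (spannerOf L D)).toFinset.val.map MultispanTuple.blocks =
      (seqs m (D.length + 1)).filter p := by
    refine (Multiset.Nodup.ext ?_ ((nodup_seqs m _).filter p)).2 fun bs => ?_
    · exact (Finset.nodup _).map blocks_injective
    simp only [Multiset.mem_map, Finset.mem_val, Set.Finite.mem_toFinset, Multiset.mem_filter,
      mem_seqs, hp]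
    constructor
    · rintro ⟨t, ⟨w, hw, rfl, ht⟩, rfl⟩
      exact ⟨t.length_blocks, w, hw, rfl, ht.patSeq_eq (hL w hw)⟩
    · rintro ⟨-, w, hw, rfl, h⟩
      obtain ⟨t, ht⟩ := exists_isTupleOf (n := (doc w).length) (hL w hw)
      refine ⟨t, ⟨w, hw, rfl, ht⟩, ?_⟩
      rw [ht.patSeq_eq (hL w hw)] at h
      exact Option.some.inj h
  have e : (fun t : MultispanTuple m D.length => T (t.encode D)) =
      (fun bs => T (weave D bs)) ∘ MultispanTuple.blocks := by
    funext t
    simp [encode_eq_weave]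
  rw [etSem, e, ← Multiset.filterMap_map, key, ← Multiset.filterMap_eq_filter,
    Multiset.filterMap_filterMap]
  congr 1
  funext bs
  by_cases h : p bs <;> simp [Option.guard, h]


/-! ### Assignments and runs of deterministic transducers -/

section Runs

variable {R Ω : Type*}

theorem Assignment.registers_hat {σ : Assignment R Ω} : ∀ {w u : List (R ⊕ Ω)},
    σ.hat w = some u → registers u = (registers w).flatMap fun X => (σ X).elim [] registers
  | [], u, h => by
    simp only [Assignment.hat, Option.some.injEq] at h
    simp [← h, registers]
  | .inl X :: w, u, h => by
    simp only [Assignment.hat, Option.bind_eq_some_iff, Option.map_eq_some_iff] at h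
    obtain ⟨v, hv, u', hu', rfl⟩ := h
    have ih := registers_hat hu'
    simp only [registers, List.filterMap_append, List.filterMap_cons, Sum.getLeft?_inl,
      List.flatMap_cons, hv, Option.elim_some] at ih ⊢
    rw [ih]
  | .inr o :: w, u, h => by
    simp only [Assignment.hat, Option.map_eq_some_iff] at h
    obtain ⟨u', hu', rfl⟩ := h
    have ih := registers_hat hu'
    simp only [registers, List.filterMap_cons, Sum.getLeft?_inr] at ih ⊢
    exact ih

/-- Every register in a composed string stems from an occurrence of some `X` in a string of `τ`.
Distinct `X` contribute disjoint registers by copylessness of `σ`, and no `X` occurs twice by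
copylessness of `τ`. -/
theorem Assignment.Copyless.comp {σ τ : Assignment R Ω} (hσ : σ.Copyless) (hτ : τ.Copyless) :
    (σ.comp τ).Copyless := by
  have h1 : ∀ X, ((σ X).elim [] registers).Nodup := by
    intro X
    cases h : σ X with
    | none => simp
    | some w => simpa using hσ.1 X w h
  have h2 : ∀ X Y, X ≠ Y → ((σ X).elim [] registers).Disjoint ((σ Y).elim [] registers) := by
    intro X Y hne
    cases h : σ X with
    | none => simp
    | some w =>
      cases h' : σ Y with
      | none => simp
      | some v => simpa using hσ.2 X Y w v hne h h'
  constructor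
  · intro Y u hu
    simp only [Assignment.comp, Option.bind_eq_some_iff] at hu
    obtain ⟨w, hw, hu⟩ := hu
    rw [registers_hat hu, List.nodup_flatMap]
    exact ⟨fun X _ => h1 X, (hτ.1 Y w hw).imp fun hne => h2 _ _ hne⟩
  · intro Y Z u u' hne hu hu'
    simp only [Assignment.comp, Option.bind_eq_some_iff] at hu hu'
    obtain ⟨w, hw, hu⟩ := hu
    obtain ⟨w', hw', hu'⟩ := hu'
    rw [registers_hat hu, registers_hat hu']
    intro X hX hX'
    rw [List.mem_flatMap] at hX hX'
    obtain ⟨Y', hY', hX⟩ := hX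
    obtain ⟨Z', hZ', hX'⟩ := hX'
    have : Y' ≠ Z' := by
      rintro rfl
      exact hτ.2 Y Z w w' hne hw hw' hY' hZ'
    exact h2 _ _ this hX hX'

theorem Valuation.hat_append (ν : Valuation R Ω) (u v : List (R ⊕ Ω)) :
    ν.hat (u ++ v) = (ν.hat u).bind fun x => (ν.hat v).map (x ++ ·) := by
  induction u with
  | nil => simp [Valuation.hat]
  | cons s u ih =>
    cases s with
    | inl X =>
      simp only [List.cons_append, Valuation.hat, ih]
      cases ν X <;> cases Valuation.hat ν u <;> cases Valuation.hat ν v <;> simp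
    | inr o =>
      simp only [List.cons_append, Valuation.hat, ih]
      cases Valuation.hat ν u <;> cases Valuation.hat ν v <;> simp

theorem Valuation.hat_hat (ν : Valuation R Ω) (σ : Assignment R Ω) (w : List (R ⊕ Ω)) :
    (σ.hat w).bind ν.hat = (ν.comp σ).hat w := by
  induction w with
  | nil => simp [Valuation.hat, Assignment.hat]
  | cons s w ih =>
    cases s with
    | inl X =>
      simp only [Assignment.hat, Valuation.hat, ← ih, Valuation.comp]
      cases σ X with
      | none => simp
      | some u => cases Assignment.hat σ w <;> simp [Valuation.hat_append]
    | inr o =>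
      simp only [Assignment.hat, Valuation.hat, ← ih]
      cases Assignment.hat σ w <;> simp [Valuation.hat]

theorem Valuation.comp_comp (ν : Valuation R Ω) (σ τ : Assignment R Ω) :
    (ν.comp σ).comp τ = ν.comp (σ.comp τ) := by
  funext X
  simp only [Valuation.comp, Assignment.comp]
  cases τ X with
  | none => rfl
  | some w => exact (Valuation.hat_hat ν σ w).symm

theorem Valuation.hat_toAssignment (ν : Valuation R Ω) (w : List (R ⊕ Ω)) :
    ν.toAssignment.hat w = (ν.hat w).map (List.map Sum.inr) := by
  induction w with
  | nil => simp [Valuation.hat, Assignment.hat]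
  | cons s w ih =>
    cases s with
    | inl X =>
      simp only [Assignment.hat, Valuation.hat, ih, Valuation.toAssignment]
      cases ν X <;> cases Valuation.hat ν w <;> simp
    | inr o =>
      simp only [Assignment.hat, Valuation.hat, ih]
      cases Valuation.hat ν w <;> simp

theorem Valuation.toAssignment_comp (ν : Valuation R Ω) (σ : Assignment R Ω) :
    ν.toAssignment.comp σ = (ν.comp σ).toAssignment := by
  funext X
  simp only [Assignment.comp, Valuation.comp, Valuation.toAssignment]
  cases σ X with
  | none => rfl
  | some w => exact Valuation.hat_toAssignment ν w

variable {Q B : Type*}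

/-- One step of a DSST that collects the assignments. -/
def DSST.stepA (T : DSST Q B R Ω) (c : Option (Assignment R Ω × Q)) (b : B) :
    Option (Assignment R Ω × Q) :=
  c.bind fun c => (T.step c.2 b).map fun τ => (c.1.comp τ.1, τ.2)

/-- The run of a DSST that collects the assignments. -/
def DSST.runA (T : DSST Q B R Ω) (c : Option (Assignment R Ω × Q)) (w : List B) :
    Option (Assignment R Ω × Q) := w.foldl T.stepA c

theorem DSST.runA_none (T : DSST Q B R Ω) (w : List B) : T.runA none w = none := by
  induction w with
  | nil => rfl
  | cons b w ih => simpa [DSST.runA, DSST.stepA] using ih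

/-- Transitions do not depend on the valuation, so the effect of a whole word is one composed
assignment. This makes it possible to read a block of brackets in a single transition. -/
theorem DSST.runFrom_comp (T : DSST Q B R Ω) (ν : Valuation R Ω) (w : List B) :
    ∀ (σ : Assignment R Ω) (q : Q), T.runFrom (q, ν.comp σ) w =
      (T.runA (some (σ, q)) w).map fun c => (c.2, ν.comp c.1) := by
  induction w with
  | nil => intro σ q; rfl
  | cons b w ih =>
    intro σ q
    simp only [DSST.runFrom, DSST.runA, List.foldl_cons, DSST.stepA, Option.bind_some]
    cases T.step q b with
    | none =>
      have := T.runA_none w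
      simp only [DSST.runA] at this
      simp [this]
    | some τ =>
      simp only [Option.bind_some, Option.map_some, Valuation.comp_comp]
      exact ih _ _

theorem DSST.runFrom_append (T : DSST Q B R Ω) (u v : List B) : ∀ c : Q × Valuation R Ω,
    T.runFrom c (u ++ v) = (T.runFrom c u).bind fun c' => T.runFrom c' v := by
  induction u with
  | nil => intro c; rfl
  | cons b u ih =>
    intro c
    simp only [List.cons_append, DSST.runFrom]
    cases T.step c.1 b with
    | none => rfl
    | some τ => exact ih _

/-- The machine stores only assignments; the initial valuations are computed as assignments whose
strings contain no registers. -/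
theorem DSST.runA_toAssignment (T : DSST Q B R Ω) (w : List B) : ∀ (q : Q) (ν : Valuation R Ω),
    T.runA (some (ν.toAssignment, q)) w =
      (T.runFrom (q, ν) w).map fun c => (c.2.toAssignment, c.1) := by
  induction w with
  | nil => intro q ν; rfl
  | cons b w ih =>
    intro q ν
    simp only [DSST.runFrom, DSST.runA, List.foldl_cons, DSST.stepA, Option.bind_some]
    cases T.step q b with
    | none =>
      have := T.runA_none w
      simp only [DSST.runA] at this
      simp [this]
    | some τ =>
      simp only [Option.bind_some, Option.map_some, Valuation.toAssignment_comp]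
      exact ih _ _

theorem DSST.copyless_of_runA (T : DSST Q B R Ω) (w : List B) :
    ∀ (c c' : Assignment R Ω × Q), c.1.Copyless → T.runA (some c) w = some c' →
      c'.1.Copyless := by
  induction w with
  | nil =>
    intro c c' hc h
    simp only [DSST.runA, List.foldl_nil, Option.some.injEq] at h
    rwa [← h]
  | cons b w ih =>
    intro c c' hc h
    simp only [DSST.runA, List.foldl_cons, DSST.stepA, Option.bind_some] at h
    cases hs : T.step c.2 b with
    | none =>
      have := T.runA_none w
      simp only [DSST.runA] at this
      simp [hs, this] at h
    | some τ =>
      rw [hs] at h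
      exact ih _ _ (hc.comp (T.step_copyless _ _ _ _ hs)) h

end Runs

/-! ### The product of a set automaton and a DSST -/

section Product

variable {R Ω : Type*} {h k m N : ℕ} {Sg : Type*} [Fintype Sg]

/-- The run of a DSST over a letter and the canonical word of a pattern. -/
def DSST.letterRun (T : DSST (Fin h) (RefSym (Fin k) m) R Ω) (q : Fin h) (a : Fin k) (π : Pat m) :
    Option (Assignment R Ω × Fin h) :=
  T.runA (T.step q (.letter a)) (π.word (Fin k))

theorem DSST.copyless_of_letterRun (T : DSST (Fin h) (RefSym (Fin k) m) R Ω) {q : Fin h}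
    {a : Fin k} {π : Pat m} {c : Assignment R Ω × Fin h} (hc : T.letterRun q a π = some c) :
    c.1.Copyless := by
  unfold DSST.letterRun at hc
  cases hs : T.step q (.letter a) with
  | none => simp [hs, T.runA_none] at hc
  | some τ =>
    rw [hs] at hc
    exact T.copyless_of_runA _ _ _ (T.step_copyless _ _ _ _ hs) hc

open Classical in
/-- The transitions of the product for a set state, a letter, a pattern and a state of the DSST. -/
noncomputable def prodTrans (T : DSST (Fin h) (RefSym (Fin k) m) R Ω)
    (nxt : Sg → Fin k → Pat m → Sg) (e : Fin N ≃ Sg × Pat m × Fin h)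
    (S : Sg) (a : Fin k) (π : Pat m) (q : Fin h) :
    Multiset (Fin N × Fin k × Assignment R Ω × Fin N) :=
  (T.letterRun q a π).elim 0 fun c =>
    ∑ b : Pat m, {(e.symm (S, b, q), a, c.1, e.symm (nxt S a π, π, c.2))}

open Classical in
/-- The product of a DSST and a deterministic automaton with states `Sg` that reads patterns and
letters alternately. A state also holds the last pattern, so that there is a different initial state
for every first pattern. -/
noncomputable def prodNSST (T : DSST (Fin h) (RefSym (Fin k) m) R Ω) (st : Pat m → Sg)
    (nxt : Sg → Fin k → Pat m → Sg) (fin : Sg → Prop) (e : Fin N ≃ Sg × Pat m × Fin h) :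
    NSST (Fin N) (Fin k) R Ω where
  init i := if (e i).1 = st (e i).2.1 then
      (T.runFrom (T.start, Valuation.empty R Ω) ((e i).2.1.word (Fin k))).bind fun c =>
        if c.1 = (e i).2.2 then some c.2 else none
    else none
  trans := ∑ S : Sg, ∑ a : Fin k, ∑ π : Pat m, ∑ q : Fin h, prodTrans T nxt e S a π q
  trans_copyless := by
    intro τ hτ
    simp only [Multiset.mem_sum, Finset.mem_univ, true_and] at hτ
    obtain ⟨S, a, π, q, hτ⟩ := hτ
    unfold prodTrans at hτ
    cases hc : T.letterRun q a π with
    | none => simp [hc] at hτ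
    | some c =>
      rw [hc, Option.elim_some, Multiset.mem_sum] at hτ
      obtain ⟨b, -, hτ⟩ := hτ
      rw [Multiset.mem_singleton] at hτ
      rw [hτ]
      exact T.copyless_of_letterRun hc
  final i := if fin (e i).1 then T.final (e i).2.2 else none
  final_nodup := by
    intro i w hw
    split_ifs at hw with hf
    exact T.final_nodup _ _ hw

/-- Acceptance by the set automaton. -/
def SetAccepts (nxt : Sg → Fin k → Pat m → Sg) (fin : Sg → Prop) :
    Sg → List (Fin k) → List (Pat m) → Prop
  | S, [], [] => fin S
  | S, a :: D, π :: bs => SetAccepts nxt fin (nxt S a π) D bs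
  | _, _, _ => False

/-- The part of the canonical word after the first pattern. -/
def weaveTail {A : Type*} : List A → List (Pat m) → List (RefSym A m)
  | [], _ => []
  | a :: D, bs => .letter a :: weave D bs

theorem weave_cons {A : Type*} (D : List A) (π : Pat m) (bs : List (Pat m)) :
    weave D (π :: bs) = π.word A ++ weaveTail D bs := by
  cases D <;> simp [weave, weaveTail]

theorem DSST.runFrom_letter (T : DSST (Fin h) (RefSym (Fin k) m) R Ω) (q : Fin h)
    (ν : Valuation R Ω) (a : Fin k) (π : Pat m) (w : List (RefSym (Fin k) m)) :
    T.runFrom (q, ν) (.letter a :: (π.word (Fin k) ++ w)) =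
      (T.letterRun q a π).bind fun c => T.runFrom (c.2, ν.comp c.1) w := by
  simp only [DSST.runFrom, DSST.letterRun]
  cases T.step q (.letter a) with
  | none => simp [T.runA_none]
  | some τ =>
    rw [Option.bind_some, T.runFrom_append, T.runFrom_comp]
    cases T.runA (some τ) (π.word (Fin k)) <;> simp

theorem bind_univ_val {ι α : Type*} [Fintype ι] (f : ι → Multiset α) :
    (Finset.univ : Finset ι).val.bind f = ∑ i, f i := rfl

variable (T : DSST (Fin h) (RefSym (Fin k) m) R Ω) (st : Pat m → Sg)
  (nxt : Sg → Fin k → Pat m → Sg) (fin : Sg → Prop) (e : Fin N ≃ Sg × Pat m × Fin h)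

-- For a given source state and letter there is at most one transition for each next pattern; the
-- only nondeterminism is the choice of this pattern.
open Classical in
theorem prodNSST_runsFrom_cons (c : Fin N × Valuation R Ω) (S : Sg) (b : Pat m) (q : Fin h)
    (hc : c.1 = e.symm (S, b, q)) (a : Fin k) (D : List (Fin k)) :
    (prodNSST T st nxt fin e).runsFrom c (a :: D) =
      ∑ π : Pat m, (T.letterRun q a π).elim 0 fun d =>
        (prodNSST T st nxt fin e).runsFrom
          (e.symm (nxt S a π, π, d.2), c.2.comp d.1) D := by
  set U := prodNSST T st nxt fin e with hU
  -- The passage from a bag of transitions to the bag of what their runs produce is additive, so it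
  -- can be evaluated on each summand of `trans` separately.
  let φ : Multiset (Fin N × Fin k × Assignment R Ω × Fin N) →+
      Multiset (Fin N × Valuation R Ω) :=
    { toFun := fun M => (M.filter fun τ => τ.1 = c.1 ∧ τ.2.1 = a).bind fun τ =>
        U.runsFrom (τ.2.2.2, Valuation.comp c.2 τ.2.2.1) D
      map_zero' := by simp
      map_add' := by intro M M'; simp }
  have hφ : ∀ S' a' π q', φ (prodTrans T nxt e S' a' π q') =
      if S' = S ∧ a' = a ∧ q' = q then (T.letterRun q a π).elim 0 fun d =>
        U.runsFrom (e.symm (nxt S a π, π, d.2), c.2.comp d.1) D else 0 := by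
    intro S' a' π q'
    have h1 : ∀ τ : Fin N × Fin k × Assignment R Ω × Fin N, φ {τ} =
        if τ.1 = c.1 ∧ τ.2.1 = a then
          U.runsFrom (τ.2.2.2, Valuation.comp c.2 τ.2.2.1) D else 0 := by
      intro τ
      change (Multiset.filter _ {τ}).bind _ = _
      rw [Multiset.filter_singleton]
      split_ifs <;> simp
    unfold prodTrans
    cases hr : T.letterRun q' a' π with
    | none =>
      rw [Option.elim_none, map_zero]
      split_ifs with hh
      · obtain ⟨-, rfl, rfl⟩ := hh
        rw [hr, Option.elim_none]
      · rfl
    | some d =>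
      rw [Option.elim_some, map_sum]
      simp only [h1, hc, e.symm.injective.eq_iff, Prod.mk.injEq]
      split_ifs with hh
      · obtain ⟨rfl, rfl, rfl⟩ := hh
        simp [hr]
      -- A transition has one copy for every last pattern `b'` in its source. If the set, the letter
      -- or the state of the DSST differs, none of these copies applies.
      · refine Finset.sum_eq_zero fun b' _ => if_neg ?_
        tauto
  have : U.runsFrom c (a :: D) = φ U.trans := by
    rw [NSST.runsFrom]
    change _ = (Multiset.filter _ _).bind _
    congr!
  rw [this, hU]
  simp only [prodNSST, map_sum, hφ]
  rw [Finset.sum_eq_single S, Finset.sum_eq_single a]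
  · refine Finset.sum_congr rfl fun π _ => ?_
    rw [Finset.sum_eq_single q]
    · rw [if_pos ⟨rfl, rfl, rfl⟩]
      rfl
    · intro q' _ hq'; simp [hq']
    · simp
  · intro a' _ ha'; simp [ha']
  · simp
  · intro S' _ hS'; simp [hS']
  · simp

-- By induction the runs are indexed by the sequences of the patterns that they choose. Each
-- sequence gives at most one run, because sets and states of the DSST evolve deterministically.
open Classical in
theorem prodNSST_runsFrom_filterMap (D : List (Fin k)) : ∀ (S : Sg) (b : Pat m) (q : Fin h)
    (ν : Valuation R Ω),
    ((prodNSST T st nxt fin e).runsFrom (e.symm (S, b, q), ν) D).filterMap (fun c =>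
      ((prodNSST T st nxt fin e).final c.1).bind (Valuation.hat c.2)) =
    (seqs m D.length).filterMap fun bs => if SetAccepts nxt fin S D bs then
      (T.runFrom (q, ν) (weaveTail D bs)).bind fun c => (T.final c.1).bind (Valuation.hat c.2)
      else none := by
  induction D with
  | nil =>
    intro S b q ν
    have e1 : (prodNSST T st nxt fin e).runsFrom (e.symm (S, b, q), ν) [] =
      {(e.symm (S, b, q), ν)} := rfl
    rw [e1, List.length_nil, seqs, ← Multiset.cons_zero, ← Multiset.cons_zero,
      Multiset.filterMap_cons, Multiset.filterMap_cons]
    congr 2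
    simp only [prodNSST, Equiv.apply_symm_apply, SetAccepts, weaveTail, DSST.runFrom,
      Option.bind_some]
    split_ifs <;> rfl
  | cons a D ih =>
    intro S b q ν
    rw [prodNSST_runsFrom_cons T st nxt fin e _ S b q rfl, ← bind_univ_val,
      Multiset.filterMap_bind, List.length_cons, seqs, Multiset.filterMap_bind]
    refine Multiset.bind_congr fun π _ => ?_
    rw [Multiset.filterMap_map]
    cases hr : T.letterRun q a π with
    | none =>
      rw [Option.elim_none, Multiset.filterMap_zero, eq_comm, Multiset.eq_zero_iff_forall_notMem]
      intro y hy
      rw [Multiset.mem_filterMap] at hy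
      obtain ⟨bs, -, hy⟩ := hy
      simp [Function.comp, weaveTail, weave_cons, T.runFrom_letter, hr] at hy
    | some d =>
      rw [Option.elim_some, ih]
      congr 1
      funext bs
      simp only [Function.comp, SetAccepts, weaveTail, weave_cons, T.runFrom_letter, hr,
        Option.bind_some]

-- The initial state chooses the first pattern and each transition the next one, which accounts for
-- `D.length + 1` patterns.
open Classical in
theorem prodNSST_sem (D : List (Fin k)) :
    (prodNSST T st nxt fin e).sem D =
    (seqs m (D.length + 1)).filterMap fun bs =>
      if ∃ π bs', bs = π :: bs' ∧ SetAccepts nxt fin (st π) D bs' then T.eval (weave D bs)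
      else none := by
  set U := prodNSST T st nxt fin e with hU
  set out : Fin N × Valuation R Ω → Option (List Ω) :=
    fun c => (U.final c.1).bind (Valuation.hat c.2) with hout
  have h1 : U.sem D = ∑ i : Fin N, (U.init i).elim 0 fun ν =>
      (U.runsFrom (i, ν) D).filterMap out := by
    rw [NSST.sem, NSST.initial, Multiset.bind_filterMap, Multiset.filterMap_bind, bind_univ_val]
    refine Finset.sum_congr rfl fun i _ => ?_
    cases U.init i <;> simp [hout]
  -- For a fixed first pattern only one triple is initial at most: the set is `st` of the pattern,
  -- and the state of the DSST is the one reached on its canonical word. The sums over these two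
  -- components collapse.
  have h2 : ∀ x : Sg × Pat m × Fin h, ((U.init (e.symm x)).elim 0 fun ν =>
      (U.runsFrom (e.symm x, ν) D).filterMap out) = if x.1 = st x.2.1 then
        (T.runFrom (T.start, Valuation.empty R Ω) (x.2.1.word (Fin k))).elim 0 fun c =>
          if c.1 = x.2.2 then (U.runsFrom (e.symm x, c.2) D).filterMap out else 0 else 0 := by
    intro x
    simp only [hU, prodNSST, Equiv.apply_symm_apply]
    split_ifs with hx
    · cases T.runFrom (T.start, Valuation.empty R Ω) (x.2.1.word (Fin k)) with
      | none => rfl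
      | some c =>
        simp only [Option.bind_some, Option.elim_some]
        split_ifs <;> rfl
    · rfl
  rw [h1, ← Equiv.sum_comp e.symm]
  simp only [h2]
  rw [Fintype.sum_prod_type_right, seqs, Multiset.filterMap_bind, bind_univ_val,
    Fintype.sum_prod_type]
  refine Finset.sum_congr rfl fun π _ => ?_
  rw [Multiset.filterMap_map]
  simp only [Finset.sum_ite_eq', Finset.mem_univ, if_true]
  have h3 : ∀ bs, T.eval (weave D (π :: bs)) =
      (T.runFrom (T.start, Valuation.empty R Ω) (π.word (Fin k))).bind fun c =>
        (T.runFrom c (weaveTail D bs)).bind fun c => (T.final c.1).bind (Valuation.hat c.2) := by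
    intro bs
    rw [DSST.eval, weave_cons, T.runFrom_append]
    cases T.runFrom (T.start, Valuation.empty R Ω) (π.word (Fin k)) <;> rfl
  simp only [Function.comp_def, h3]
  cases hr : T.runFrom (T.start, Valuation.empty R Ω) (π.word (Fin k)) with
  | none =>
    simp only [Option.elim_none, Finset.sum_const_zero, Option.bind_none, ite_self]
    rw [eq_comm, Multiset.eq_zero_iff_forall_notMem]
    intro y hy
    rw [Multiset.mem_filterMap] at hy
    obtain ⟨bs, -, hy⟩ := hy
    simp at hy
  | some c =>
    simp only [Option.elim_some, Finset.sum_ite_eq, Finset.mem_univ, if_true, Option.bind_some]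
    rw [hout, hU, prodNSST_runsFrom_filterMap]
    congr 1
    funext bs
    simp

end Product


/-- Sets of states are represented by numbers below `2 ^ n` whose binary digits are the
characteristic function; the hypotheses say that `st`, `nxt` and `fin` compute the subset
construction in this representation. -/
theorem prodNSST_sem_eq_etSem {R Ω : Type*} {h k m N n : ℕ}
    (T : DSST (Fin h) (RefSym (Fin k) m) R Ω) (e : Fin N ≃ Fin (2 ^ n) × Pat m × Fin h)
    {E : ℕ → ℕ → ℕ → Prop} {I F : ℕ → Prop} (st : Pat m → Fin (2 ^ n))
    (nxt : Fin (2 ^ n) → Fin k → Pat m → Fin (2 ^ n)) (fin : Fin (2 ^ n) → Prop)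
    (hL : ∀ w ∈ pathLang k m E I F, IsMultirefWord w)
    (hst : ∀ π, {p | (st π : ℕ).testBit p} = blockSet k E {p | I p} π)
    (hnxt : ∀ S a π, {p | (nxt S a π : ℕ).testBit p} =
      blockSet k E (letterSet E {p | (S : ℕ).testBit p} a) π)
    (hfin : ∀ S, fin S ↔ ∃ p, (S : ℕ).testBit p ∧ F p) (D : List (Fin k)) :
    (prodNSST T st nxt fin e).sem D = etSem (spannerOf (pathLang k m E I F)) T.eval D := by
  classical
  have hacc : ∀ (D : List (Fin k)) (S : Fin (2 ^ n)) (bs : List (Pat m)),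
      SetAccepts nxt fin S D bs ↔ AcceptsFrom E F {p | (S : ℕ).testBit p} D bs := by
    intro D
    induction D with
    | nil =>
      intro S bs
      cases bs with
      | nil => simp [SetAccepts, AcceptsFrom, hfin]
      | cons => rfl
    | cons a D ih =>
      intro S bs
      cases bs with
      | nil => rfl
      | cons π bs => simp only [SetAccepts, AcceptsFrom, ih, hnxt]
  rw [prodNSST_sem, etSem_eq_filterMap_seqs _ hL _ _
    (fun bs => ∃ π bs', bs = π :: bs' ∧ SetAccepts nxt fin (st π) D bs')]
  intro bs
  rw [← acceptsPat_iff]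
  cases bs with
  | nil => simp [AcceptsPat]
  | cons π bs => simp [AcceptsPat, hacc, hst]

/-! ### Reasoning about programs -/

section Programs

variable {R Ω : Type*}

/-- The program halts within `t` steps in a memory that satisfies `Q`. -/
def Halts (P : Prog) (s : Store R Ω) (t : ℕ) (Q : Store R Ω → Prop) : Prop :=
  ∃ s₂ t₂, Exec P s s₂ t₂ ∧ t₂ ≤ t ∧ Q s₂

theorem Halts.mono {P : Prog} {s : Store R Ω} {t t' : ℕ} {Q Q' : Store R Ω → Prop}
    (h : Halts P s t Q) (ht : t ≤ t') (hQ : ∀ s₂, Q s₂ → Q' s₂) : Halts P s t' Q' := by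
  obtain ⟨s₂, t₂, h1, h2, h3⟩ := h
  exact ⟨s₂, t₂, h1, h2.trans ht, hQ _ h3⟩

theorem Halts.seq {P P₂ : Prog} {s : Store R Ω} {t t₂ : ℕ} {Q Q₂ : Store R Ω → Prop}
    (h : Halts P s t Q) (h₂ : ∀ s₁, Q s₁ → Halts P₂ s₁ t₂ Q₂) : Halts (.seq P P₂) s (t + t₂) Q₂ := by
  obtain ⟨s₁, t₁, h1, h2, h3⟩ := h
  obtain ⟨s₂, t₂', h1', h2', h3'⟩ := h₂ s₁ h3
  exact ⟨s₂, _, .seq h1 h1', by omega, h3'⟩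

theorem Halts.seq_le {P P₂ : Prog} {s : Store R Ω} {t₃ : ℕ} {Q Q₂ : Store R Ω → Prop} (t t₂ : ℕ)
    (h : Halts P s t Q) (ht : t + t₂ ≤ t₃) (h₂ : ∀ s₁, Q s₁ → Halts P₂ s₁ t₂ Q₂) :
    Halts (.seq P P₂) s t₃ Q₂ := (h.seq h₂).mono ht fun _ h => h

/-- The number arrays with names in `K` and the assignment and string arrays with these names are
the same in both memories. -/
def Same (K : ℕ → Prop) (s s₂ : Store R Ω) : Prop :=
  ∀ a, K a → s₂.num a = s.num a ∧ s₂.asg a = s.asg a ∧ s₂.str a = s.str a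

theorem Same.refl (K : ℕ → Prop) (s : Store R Ω) : Same K s s := fun _ _ => ⟨rfl, rfl, rfl⟩

theorem Same.trans {K : ℕ → Prop} {s s₁ s₂ : Store R Ω} (h : Same K s s₁) (h₂ : Same K s₁ s₂) :
    Same K s s₂ := fun a ha =>
  ⟨(h₂ a ha).1.trans (h a ha).1, (h₂ a ha).2.1.trans (h a ha).2.1,
    (h₂ a ha).2.2.trans (h a ha).2.2⟩

theorem Same.mono {K K' : ℕ → Prop} {s s₂ : Store R Ω} (h : Same K s s₂) (hK : ∀ a, K' a → K a) :
    Same K' s s₂ := fun a ha => h a (hK a ha)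

theorem Store.num_setNum (s : Store R Ω) (a i v b j : ℕ) :
    (s.setNum a i v).num b j = if b = a ∧ j = i then v else s.num b j := by
  simp only [Store.setNum, Function.update_apply]
  split_ifs <;> simp_all

theorem Store.num_setNum_ne (s : Store R Ω) {a b : ℕ} (i v : ℕ) (h : b ≠ a) :
    (s.setNum a i v).num b = s.num b := by
  simp [Store.setNum, Function.update_of_ne h]

theorem Store.asg_setAsg (s : Store R Ω) (a i : ℕ) (v : Assignment R Ω) (b j : ℕ) :
    (s.setAsg a i v).asg b j = if b = a ∧ j = i then v else s.asg b j := by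
  simp only [Store.setAsg, Function.update_apply]
  split_ifs <;> simp_all

theorem Store.str_setStr (s : Store R Ω) (a i : ℕ) (v : List (R ⊕ Ω)) (b j : ℕ) :
    (s.setStr a i v).str b j = if b = a ∧ j = i then v else s.str b j := by
  simp only [Store.setStr, Function.update_apply]
  split_ifs <;> simp_all

@[simp] theorem Store.asg_setNum (s : Store R Ω) (a i v : ℕ) : (s.setNum a i v).asg = s.asg := rfl
@[simp] theorem Store.str_setNum (s : Store R Ω) (a i v : ℕ) : (s.setNum a i v).str = s.str := rfl
@[simp] theorem Store.num_setAsg (s : Store R Ω) (a i : ℕ) (v : Assignment R Ω) :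
    (s.setAsg a i v).num = s.num := rfl
@[simp] theorem Store.str_setAsg (s : Store R Ω) (a i : ℕ) (v : Assignment R Ω) :
    (s.setAsg a i v).str = s.str := rfl
@[simp] theorem Store.num_setStr (s : Store R Ω) (a i : ℕ) (v : List (R ⊕ Ω)) :
    (s.setStr a i v).num = s.num := rfl
@[simp] theorem Store.asg_setStr (s : Store R Ω) (a i : ℕ) (v : List (R ⊕ Ω)) :
    (s.setStr a i v).asg = s.asg := rfl

theorem Same.setNum {K : ℕ → Prop} {s s₂ : Store R Ω} (h : Same K s s₂) {a : ℕ} (ha : ¬ K a)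
    (i v : ℕ) : Same K s (s₂.setNum a i v) := by
  intro b hb
  have : b ≠ a := fun e => ha (e ▸ hb)
  rw [Store.num_setNum_ne _ _ _ this]
  exact h b hb

theorem Same.setAsg {K : ℕ → Prop} {s s₂ : Store R Ω} (h : Same K s s₂) {a : ℕ} (ha : ¬ K a)
    (i : ℕ) (v : Assignment R Ω) : Same K s (s₂.setAsg a i v) := by
  intro b hb
  have : b ≠ a := fun e => ha (e ▸ hb)
  refine ⟨(h b hb).1, ?_, (h b hb).2.2⟩
  rw [← (h b hb).2.1]
  simp [Store.setAsg, Function.update_of_ne this]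

theorem Same.setStr {K : ℕ → Prop} {s s₂ : Store R Ω} (h : Same K s s₂) {a : ℕ} (ha : ¬ K a)
    (i : ℕ) (v : List (R ⊕ Ω)) : Same K s (s₂.setStr a i v) := by
  intro b hb
  have : b ≠ a := fun e => ha (e ▸ hb)
  refine ⟨(h b hb).1, (h b hb).2.1, ?_⟩
  rw [← (h b hb).2.2]
  simp [Store.setStr, Function.update_of_ne this]

/-! #### Programs without loops -/

/-- The effect of a program without loops. -/
def Prog.run : Prog → Store R Ω → Store R Ω
  | .skip, s => s
  | .setNum a i e, s => s.setNum a (i.eval s) (e.eval s)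
  | .setAsg a i e, s => s.setAsg a (i.eval s) (e.eval s)
  | .setStr a i b j, s => s.setStr a (i.eval s) (s.str b (j.eval s))
  | .seq P P₂, s => P₂.run (P.run s)
  | .ite e P P₂, s => if e.eval s = 0 then P₂.run s else P.run s
  | .loop _ _, s => s

/-- The program has no loops. -/
def Prog.straight : Prog → Bool
  | .seq P P₂ => P.straight && P₂.straight
  | .ite _ P P₂ => P.straight && P₂.straight
  | .loop _ _ => false
  | _ => true

/-- A bound for the running time of a program without loops. -/
def Prog.bound : Prog → ℕ
  | .skip => 1
  | .setNum _ i e => i.cost + e.cost + 1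
  | .setAsg _ i e => i.cost + e.cost + 1
  | .setStr _ i _ j => i.cost + j.cost + 1
  | .seq P P₂ => P.bound + P₂.bound
  | .ite e P P₂ => e.cost + 1 + (P.bound + P₂.bound)
  | .loop _ _ => 0

theorem Halts.straight {P : Prog} (hP : P.straight = true) : ∀ {s : Store R Ω},
    Halts P s P.bound (fun s₂ => s₂ = P.run s) := by
  induction P with
  | skip => exact ⟨_, _, .skip _, le_rfl, rfl⟩
  | setNum a i e => exact ⟨_, _, .setNum _ _ _ _, le_rfl, rfl⟩
  | setAsg a i e => exact ⟨_, _, .setAsg _ _ _ _, le_rfl, rfl⟩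
  | setStr a i b j => exact ⟨_, _, .setStr _ _ _ _ _, le_rfl, rfl⟩
  | seq P P₂ ih ih₂ =>
    intro s
    simp only [Prog.straight, Bool.and_eq_true] at hP
    refine (ih hP.1).seq fun s₁ h => ?_
    subst h
    exact ih₂ hP.2
  | ite e P P₂ ih ih₂ =>
    intro s
    simp only [Prog.straight, Bool.and_eq_true] at hP
    by_cases he : e.eval s = 0
    · obtain ⟨s₂, t₂, h1, h2, h3⟩ := ih₂ (s := s) hP.2
      exact ⟨s₂, _, .iteFalse he h1, by simp only [Prog.bound]; omega, by simp [Prog.run, he, h3]⟩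
    · obtain ⟨s₂, t₂, h1, h2, h3⟩ := ih (s := s) hP.1
      exact ⟨s₂, _, .iteTrue he h1, by simp only [Prog.bound]; omega, by simp [Prog.run, he, h3]⟩
  | loop => simp [Prog.straight] at hP

theorem Halts.of_run {P : Prog} {s : Store R Ω} {t : ℕ} {Q : Store R Ω → Prop}
    (hP : P.straight = true) (ht : P.bound ≤ t) (hQ : Q (P.run s)) : Halts P s t Q :=
  (Halts.straight hP).mono ht fun _ h => h ▸ hQ

/-- The arrays into which a program without loops writes. -/
def Prog.writes : Prog → List ℕ
  | .setNum a _ _ => [a]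
  | .setAsg a _ _ => [a]
  | .setStr a _ _ _ => [a]
  | .seq P P₂ => P.writes ++ P₂.writes
  | .ite _ P P₂ => P.writes ++ P₂.writes
  | _ => []

theorem Same.run {K : ℕ → Prop} {P : Prog} : ∀ {s : Store R Ω}, (∀ a ∈ P.writes, ¬ K a) →
    Same K s (P.run s) := by
  induction P with
  | skip => exact fun _ => Same.refl _ _
  | setNum a i e => exact fun h => (Same.refl _ _).setNum (h a (by simp [Prog.writes])) _ _
  | setAsg a i e => exact fun h => (Same.refl _ _).setAsg (h a (by simp [Prog.writes])) _ _
  | setStr a i b j => exact fun h => (Same.refl _ _).setStr (h a (by simp [Prog.writes])) _ _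
  | seq P P₂ ih ih₂ =>
    intro s h
    exact (ih fun a ha => h a (by simp [Prog.writes, ha])).trans
      (ih₂ fun a ha => h a (by simp [Prog.writes, ha]))
  | ite e P P₂ ih ih₂ =>
    intro s h
    simp only [Prog.run]
    split_ifs
    · exact ih₂ fun a ha => h a (by simp [Prog.writes, ha])
    · exact ih fun a ha => h a (by simp [Prog.writes, ha])
  | loop => exact fun _ => Same.refl _ _

theorem Halts.run_seq {P P₂ : Prog} {s : Store R Ω} {t : ℕ} {Q : Store R Ω → Prop} (t₂ : ℕ)
    (hP : P.straight = true) (ht : P.bound + t₂ ≤ t) (h : Halts P₂ (P.run s) t₂ Q) :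
    Halts (.seq P P₂) s t Q :=
  Halts.seq_le _ _ (Halts.straight hP) ht fun _ h' => h' ▸ h

theorem Halts.ite {e : NExpr} {P P₂ : Prog} {s : Store R Ω} {t : ℕ} {Q : Store R Ω → Prop}
    (h : e.eval s ≠ 0 → Halts P s t Q) (h₂ : e.eval s = 0 → Halts P₂ s t Q) :
    Halts (.ite e P P₂) s (e.cost + 1 + t) Q := by
  by_cases he : e.eval s = 0
  · obtain ⟨s₂, t₂, h1, h2, h3⟩ := h₂ he
    exact ⟨s₂, _, .iteFalse he h1, by omega, h3⟩
  · obtain ⟨s₂, t₂, h1, h2, h3⟩ := h he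
    exact ⟨s₂, _, .iteTrue he h1, by omega, h3⟩

/-! #### Counting loops -/

/-- The variable with name `v`: cell `0` of the number array `v`. -/
abbrev NExpr.var (v : ℕ) : NExpr := .get v (.lit 0)

/-- Write into the variable with name `v`. -/
abbrev Prog.setVar (v : ℕ) (e : NExpr) : Prog := .setNum v (.lit 0) e

/-- `for v = 0, …, e - 1 do P`. -/
def Prog.for (v : ℕ) (e : NExpr) (P : Prog) : Prog :=
  .seq (.setVar v (.lit 0))
    (.loop (.sub e (.var v)) (.seq P (.setVar v (.add (.var v) (.lit 1)))))

/-- The cost of the body is written as a constant `c` times a size `x`, so that nested loops yield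
one numeral times a product of sizes. The `N + 1` pays for the initialization and the final test,
also when `N = 0`; this needs `1 ≤ x`. -/
theorem Halts.for {v : ℕ} {e : NExpr} {P : Prog} {s : Store R Ω} {I : ℕ → Store R Ω → Prop}
    (N c x : ℕ) (hx : 1 ≤ x) (h0 : I 0 (s.setNum v 0 0))
    (hN : ∀ j s₁, I j s₁ → e.eval s₁ = N)
    (hs : ∀ j s₁, j < N → I j s₁ → s₁.num v 0 = j → Halts P s₁ (c * x)
      fun s₂ => s₂.num v 0 = j ∧ I (j + 1) (s₂.setNum v 0 (j + 1))) :
    Halts (.for v e P) s ((c + e.cost + 20) * ((N + 1) * x)) (fun s₂ => I N s₂) := by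
  -- Induction on the number `d` of the rounds that remain.
  have key : ∀ d j s₁, j + d = N → I j s₁ → s₁.num v 0 = j →
      Halts (.loop (.sub e (.var v)) (.seq P (.setVar v (.add (.var v) (.lit 1))))) s₁
        (d * (c * x + e.cost + 15) + (e.cost + 5)) (fun s₂ => I N s₂) := by
    intro d
    induction d with
    | zero =>
      intro j s₁ hj hI hv
      refine ⟨s₁, _, .loopDone ?_, ?_, ?_⟩
      · simp only [NExpr.eval, hv, hN j s₁ hI]; omega
      · simp only [NExpr.cost]; omega
      · have : j = N := by omega
        exact this ▸ hI
    | succ d ih =>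
      intro j s₁ hj hI hv
      obtain ⟨s₂, t₂, h1, h2, h3, h4⟩ := hs j s₁ (by omega) hI hv
      obtain ⟨s₃, t₃, h5, h6, h7⟩ := ih (j + 1) (s₂.setNum v 0 (j + 1)) (by omega) h4
        (by simp [Store.num_setNum])
      refine ⟨s₃, _, .loopStep (t₂ := t₃) ?_ (.seq h1 (.setNum _ _ _ _)) ?_, ?_, h7⟩
      · simp only [NExpr.eval, hv, hN j s₁ hI]; omega
      · simpa only [NExpr.eval, h3] using h5
      · simp only [NExpr.cost] at *
        have : (d + 1) * (c * x + e.cost + 15) = d * (c * x + e.cost + 15) +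
          (c * x + e.cost + 15) := by ring
        omega
  obtain ⟨s₂, t₂, h1, h2, h3⟩ := key N 0 _ (by omega) h0 (by simp [Store.num_setNum])
  refine ⟨s₂, _, .seq (.setNum _ _ _ _) h1, ?_, h3⟩
  simp only [NExpr.cost]
  have h4 : N * (c * x + e.cost + 15) + (e.cost + 5) + 3 ≤
      (N + 1) * ((c + e.cost + 20) * x) := by
    have : c * x + e.cost + 20 ≤ (c + e.cost + 20) * x := by nlinarith
    calc _ ≤ (N + 1) * (c * x + e.cost + 20) := by ring_nf; nlinarith
      _ ≤ _ := Nat.mul_le_mul_left _ this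
  calc _ ≤ _ := by omega
    _ ≤ _ := h4
    _ = _ := by ring

/-- A loop whose invariant consists of a frame condition and a property that does not depend on
the variable of the loop. -/
theorem Halts.forK {K : ℕ → Prop} {v : ℕ} {e : NExpr} {P : Prog} {s : Store R Ω}
    (J : ℕ → Store R Ω → Prop) (N c x : ℕ) (hx : 1 ≤ x) (hv : ¬ K v)
    (hJv : ∀ j s₁ i y, J j s₁ → J j (s₁.setNum v i y)) (h0 : J 0 s)
    (hN : ∀ s₁, Same K s s₁ → e.eval s₁ = N)
    (hs : ∀ j s₁, j < N → Same K s s₁ → J j s₁ → s₁.num v 0 = j → Halts P s₁ (c * x)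
      fun s₂ => s₂.num v 0 = j ∧ Same K s₁ s₂ ∧ J (j + 1) s₂) :
    Halts (.for v e P) s ((c + e.cost + 20) * ((N + 1) * x))
      (fun s₂ => Same K s s₂ ∧ J N s₂) := by
  refine Halts.for (I := fun j s₁ => Same K s s₁ ∧ J j s₁) N c x hx
    ⟨(Same.refl K s).setNum hv _ _, hJv _ _ _ _ h0⟩ (fun j s₁ h => hN s₁ h.1) ?_
  intro j s₁ hj hI hv'
  refine (hs j s₁ hj hI.1 hI.2 hv').mono le_rfl fun s₂ h => ?_
  exact ⟨h.1, (hI.1.trans h.2.1).setNum hv _ _, hJv _ _ _ _ h.2.2⟩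

end Programs

/-! ### Sets and patterns as numbers -/

/-- Since digit `i` is clear, the addition produces no carry. Thus a set gains an element, or a
pattern a flag, by an operation that the machine has. -/
theorem testBit_add_two_pow {i : ℕ} : ∀ {b : ℕ}, b.testBit i = false → ∀ j : ℕ,
    (b + 2 ^ i).testBit j = (decide (j = i) || b.testBit j) := by
  induction i with
  | zero =>
    intro b hb j
    have hb' : b % 2 = 0 := by
      rw [Nat.testBit_zero] at hb
      have := of_decide_eq_false hb
      omega
    cases j with
    | zero => simp [Nat.testBit_zero]; omega
    | succ j =>
      rw [Nat.testBit_add_one, Nat.testBit_add_one]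
      have : (b + 1) / 2 = b / 2 := by omega
      simp [this]
  | succ i ih =>
    intro b hb j
    cases j with
    | zero =>
      simp only [Nat.testBit_zero, pow_succ]
      have : (b + 2 ^ i * 2) % 2 = b % 2 := by omega
      simp [this]
    | succ j =>
      rw [Nat.testBit_add_one] at hb
      rw [Nat.testBit_add_one, Nat.testBit_add_one]
      have : (b + 2 ^ (i + 1)) / 2 = b / 2 + 2 ^ i := by rw [pow_succ]; omega
      rw [this, ih hb]
      simp

/-- With digit `i` set, `b` is the sum of `2 ^ i` and a number with this digit clear, and the
subtraction undoes an addition without carry. -/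
theorem testBit_sub_two_pow {i b : ℕ} (hb : b.testBit i = true) (j : ℕ) :
    (b - 2 ^ i).testBit j = (!decide (j = i) && b.testBit j) := by
  obtain ⟨c, hc, hc'⟩ : ∃ c, b = c + 2 ^ i ∧ c.testBit i = false := by
    refine ⟨b ^^^ 2 ^ i, Nat.eq_of_testBit_eq fun j => ?_, ?_⟩
    · rw [testBit_add_two_pow (by simp [hb])]
      by_cases hj : j = i
      · simp [hj, hb]
      · simp [hj, Nat.testBit_two_pow_of_ne (Ne.symm hj)]
    · simp [hb]
  subst hc
  rw [Nat.add_sub_cancel, testBit_add_two_pow hc']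
  by_cases hj : j = i
  · simp [hj, hc']
  · simp [hj]

open Classical in
/-- The number whose binary digits are given by a set. -/
noncomputable def setNumber (n : ℕ) (X : Set ℕ) : ℕ :=
  ∑ p ∈ Finset.range n, if p ∈ X then 2 ^ p else 0

theorem testBit_setNumber (X : Set ℕ) : ∀ (n i : ℕ),
    (setNumber n X).testBit i = true ↔ i < n ∧ i ∈ X := by
  classical
  intro n
  induction n with
  | zero => intro i; simp [setNumber]
  | succ n ih =>
    intro i
    have hn : (setNumber n X).testBit n = false := by
      rw [← Bool.not_eq_true, ih]; simp
    rw [setNumber, Finset.sum_range_succ, ← setNumber]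
    split_ifs with hX
    · rw [testBit_add_two_pow hn, Bool.or_eq_true, decide_eq_true_iff, ih]
      constructor
      · rintro (rfl | h)
        · exact ⟨by omega, hX⟩
        · exact ⟨by omega, h.2⟩
      · rintro ⟨h1, h2⟩
        by_cases h : i = n
        · exact .inl h
        · exact .inr ⟨by omega, h2⟩
    · rw [add_zero, ih]
      constructor
      · exact fun h => ⟨by omega, h.2⟩
      · rintro ⟨h1, h2⟩
        have : i ≠ n := by rintro rfl; exact hX h2
        exact ⟨by omega, h2⟩

theorem setNumber_lt (n : ℕ) (X : Set ℕ) : setNumber n X < 2 ^ n :=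
  Nat.lt_pow_two_of_testBit _ fun i hi => by
    rw [← Bool.not_eq_true, testBit_setNumber]
    omega

/-- The pattern with a given number. -/
def patOf (m b : ℕ) : Pat m := fun x c => b.testBit (3 * x + c)

theorem patOf_injOn {m b b' : ℕ} (hb : b < 2 ^ (3 * m)) (hb' : b' < 2 ^ (3 * m))
    (h : patOf m b = patOf m b') : b = b' := by
  refine Nat.eq_of_testBit_eq fun i => ?_
  by_cases hi : i < 3 * m
  · have := congrFun (congrFun h ⟨i / 3, by omega⟩) ⟨i % 3, by omega⟩
    simp only [patOf] at this
    rwa [Nat.div_add_mod] at this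
  · have h2 : 2 ^ (3 * m) ≤ 2 ^ i := Nat.pow_le_pow_right (by omega) (by omega)
    rw [Nat.testBit_lt_two_pow (by omega), Nat.testBit_lt_two_pow (by omega)]

theorem patOf_zero (m : ℕ) : patOf m 0 = Pat.zero m := by
  funext x c
  simp [patOf, Pat.zero]

/-- The numbering of the patterns. -/
noncomputable def patEquiv (m : ℕ) : Fin (2 ^ (3 * m)) ≃ Pat m :=
  Equiv.ofBijective (fun b => patOf m b) <| by
    rw [Fintype.bijective_iff_injective_and_card]
    refine ⟨fun b b' h => Fin.ext (patOf_injOn b.2 b'.2 h), ?_⟩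
    simp [pow_mul]

theorem patEquiv_apply (m : ℕ) (b : Fin (2 ^ (3 * m))) : patEquiv m b = patOf m b := rfl

/-- The number of the next pattern plus one, or `0` if there is none. -/
def nextPat (k m j b : ℕ) : ℕ :=
  if j - k < m then
    if b.testBit (3 * (j - k) + 2) then 0 else b + 2 ^ (3 * (j - k) + 2) + 1
  else if j - k - m < m then
    if b.testBit (3 * (j - k - m) + 2) then
      if b.testBit (3 * (j - k - m) + 1) then b - 2 ^ (3 * (j - k - m) + 2) + 1
      else b - 2 ^ (3 * (j - k - m) + 2) + 2 ^ (3 * (j - k - m) + 1) + 1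
    else if b.testBit (3 * (j - k - m)) || b.testBit (3 * (j - k - m) + 1) then 0
    else b + 2 ^ (3 * (j - k - m)) + 1
  else b + 1

/-- The step from pattern `π` to `π'` by the symbol with number `j`. -/
def PatLink (k m j : ℕ) (π π' : Pat m) : Prop :=
  (symAt k m j = none ∧ π' = π) ∨ ∃ s, symAt k m j = some s ∧ π.step s = some π'

theorem patOf_update {m b b' : ℕ} (x : Fin m) (v : Fin 3 → Bool)
    (h1 : ∀ i, (¬ ∃ c : Fin 3, i = 3 * (x : ℕ) + c) → b'.testBit i = b.testBit i)
    (h2 : ∀ c : Fin 3, b'.testBit (3 * x + c) = v c) :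
    patOf m b' = Function.update (patOf m b) x v := by
  funext y c
  by_cases hy : y = x
  · subst hy; simp [patOf, h2]
  · rw [Function.update_of_ne hy]
    refine h1 _ ?_
    rintro ⟨c', hc'⟩
    apply hy
    ext
    omega

/-- In each branch the digits tested guarantee that the powers of two are added to clear digits and
subtracted from set ones, so the arithmetic changes exactly the intended flags. A number of no
symbol acts as an empty label and leaves the pattern alone. -/
theorem nextPat_spec {k m j b : ℕ} (hj : k ≤ j) (hb : b < 2 ^ (3 * m)) :
    (nextPat k m j b = 0 ∧ ∀ π', ¬ PatLink k m j (patOf m b) π') ∨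
    ∃ b', nextPat k m j b = b' + 1 ∧ b' < 2 ^ (3 * m) ∧
      ∀ π', PatLink k m j (patOf m b) π' ↔ π' = patOf m b' := by
  have hhigh : ∀ i, 3 * m ≤ i → b.testBit i = false := fun i hi =>
    Nat.testBit_lt_two_pow (hb.trans_le (Nat.pow_le_pow_right (by omega) hi))
  -- A number that differs from `b` only in the three digits of one variable stays below `2 ^ (3 *
  -- m)`, because all higher digits remain clear.
  have upd : ∀ (x : Fin m) (v : Fin 3 → Bool) (b' : ℕ),
      (∀ i, (¬ ∃ c : Fin 3, i = 3 * (x : ℕ) + c) → b'.testBit i = b.testBit i) →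
      (∀ c : Fin 3, b'.testBit (3 * x + c) = v c) →
      b' < 2 ^ (3 * m) ∧ patOf m b' = Function.update (patOf m b) x v := by
    intro x v b' h1 h2
    refine ⟨Nat.lt_pow_two_of_testBit _ fun i hi => ?_, patOf_update x v h1 h2⟩
    rw [h1 i ?_, hhigh i hi]
    rintro ⟨c, hc⟩
    omega
  have hk : ¬ j < k := by omega
  have ne3 : ∀ {x : Fin m} {i : ℕ}, (¬ ∃ c : Fin 3, i = 3 * (x : ℕ) + c) →
      i ≠ 3 * x ∧ i ≠ 3 * x + 1 ∧ i ≠ 3 * x + 2 := by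
    intro x i hi
    exact ⟨fun h => hi ⟨0, by simp [h]⟩, fun h => hi ⟨1, by simp [h]⟩, fun h => hi ⟨2, by simp [h]⟩⟩
  by_cases h1 : j - k < m
  · have hs : symAt k m j = some (.opn ⟨j - k, h1⟩) := by simp [symAt, hk, h1]
    simp only [PatLink, hs, reduceCtorEq, false_and, Option.some.injEq, exists_eq_left', false_or,
      nextPat, h1, if_true, Pat.step]
    set x : Fin m := ⟨j - k, h1⟩ with hx
    have hxv : (x : ℕ) = j - k := rfl
    rw [← hxv]
    have e2 : patOf m b x 2 = b.testBit (3 * x + 2) := rfl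
    rw [e2]
    by_cases h2 : b.testBit (3 * x + 2) = true
    · left; simp [h2]
    · right
      have h2' : b.testBit (3 * x + 2) = false := by simpa using h2
      have := upd x ![patOf m b x 0, patOf m b x 1, true] (b + 2 ^ (3 * (x : ℕ) + 2))
        (fun i hi => by simp [testBit_add_two_pow h2', (ne3 hi).2.2])
        (fun c => by fin_cases c <;> simp [testBit_add_two_pow h2', patOf])
      refine ⟨_, by rw [if_neg h2], this.1, fun π' => ?_⟩
      rw [if_neg h2, Option.some.injEq, this.2, eq_comm]
  · by_cases h1' : j - k - m < m
    · have hs : symAt k m j = some (.cls ⟨j - k - m, h1'⟩) := by simp [symAt, hk, h1, h1']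
      simp only [PatLink, hs, reduceCtorEq, false_and, Option.some.injEq, exists_eq_left', false_or,
        nextPat, h1, h1', if_true, if_false, Pat.step]
      set x : Fin m := ⟨j - k - m, h1'⟩ with hx
      have hxv : (x : ℕ) = j - k - m := rfl
      rw [← hxv]
      have e0 : patOf m b x 0 = b.testBit (3 * x) := rfl
      have e1 : patOf m b x 1 = b.testBit (3 * x + 1) := rfl
      have e2 : patOf m b x 2 = b.testBit (3 * x + 2) := rfl
      rw [e2]
      by_cases h2 : b.testBit (3 * x + 2) = true
      · right
        simp only [h2, if_true, Option.some.injEq]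
        by_cases h3 : b.testBit (3 * x + 1) = true
        · have := upd x ![patOf m b x 0, true, false] (b - 2 ^ (3 * (x : ℕ) + 2))
            (fun i hi => by simp [testBit_sub_two_pow h2, (ne3 hi).2.2])
            (fun c => by fin_cases c <;> simp [testBit_sub_two_pow h2, patOf, h3])
          refine ⟨_, by rw [if_pos h3], this.1, fun π' => ?_⟩
          rw [this.2, eq_comm]
        · have h3' : (b - 2 ^ (3 * (x : ℕ) + 2)).testBit (3 * x + 1) = false := by
            rw [testBit_sub_two_pow h2]; simp [h3]
          have := upd x ![patOf m b x 0, true, false]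
            (b - 2 ^ (3 * (x : ℕ) + 2) + 2 ^ (3 * (x : ℕ) + 1))
            (fun i hi => by
              simp [testBit_add_two_pow h3', testBit_sub_two_pow h2, (ne3 hi).2.2, (ne3 hi).2.1])
            (fun c => by
              fin_cases c <;> simp [testBit_add_two_pow h3', testBit_sub_two_pow h2, patOf])
          refine ⟨_, by rw [if_neg h3], this.1, fun π' => ?_⟩
          rw [this.2, eq_comm]
      · simp only [h2, e0, e1]
        by_cases h3 : (b.testBit (3 * x) || b.testBit (3 * x + 1)) = true
        · left; simp [h3]
        · right
          have h4 : b.testBit (3 * x) = false ∧ b.testBit (3 * x + 1) = false := by simpa using h3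
          have := upd x ![true, false, false] (b + 2 ^ (3 * (x : ℕ)))
            (fun i hi => by simp [testBit_add_two_pow h4.1, (ne3 hi).1])
            (fun c => by fin_cases c <;> simp [testBit_add_two_pow h4.1, h4.2, h2])
          refine ⟨_, by rw [if_neg (by simp), if_neg h3], this.1, fun π' => ?_⟩
          rw [if_neg (by simp), if_neg h3, Option.some.injEq, this.2, eq_comm]
    · have hs : symAt k m j = none := by simp [symAt, hk, h1, h1']
      right
      refine ⟨b, by simp [nextPat, h1, h1'], hb, fun π' => ?_⟩
      simp [PatLink, hs]

/-! ### Reachability -/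

/-- What is reached from `S` in at most `i` steps. -/
def level {α : Type*} (r : α → α → Prop) (S : Set α) : ℕ → Set α
  | 0 => S
  | i + 1 => level r S i ∪ {v' | ∃ v ∈ level r S i, r v v'}

theorem level_mono {α : Type*} (r : α → α → Prop) (S : Set α) : Monotone (level r S) :=
  monotone_nat_of_le_succ fun _ => Set.subset_union_left

/-- The levels form an increasing chain inside `V`. As long as it is strictly increasing, every step
adds an element, so it becomes stationary after at most `V.card` steps. -/
theorem level_of_reach {α : Type*} {r : α → α → Prop} {S : Set α} (V : Finset α) (hS : S ⊆ V)
    (hr : ∀ v v', v ∈ V → r v v' → v' ∈ V) {v v' : α} (hv : v ∈ S)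
    (h : Relation.ReflTransGen r v v') : v' ∈ level r S V.card := by
  classical
  have hV : ∀ i, level r S i ⊆ V := by
    intro i
    induction i with
    | zero => exact hS
    | succ i ih =>
      rintro x (hx | ⟨y, hy, hx⟩)
      · exact ih hx
      · exact hr y x (ih hy) hx
  have hfin : ∀ i, (level r S i).Finite := fun i => V.finite_toSet.subset (hV i)
  -- Either the chain has already stopped, or level `i` has at least `i` elements; for `i = V.card +
  -- 1` only the first is possible.
  have key : ∀ i, (∃ j < i, level r S (j + 1) = level r S j) ∨ i ≤ (level r S i).ncard := by
    intro i
    induction i with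
    | zero => right; simp
    | succ i ih =>
      by_cases he : level r S (i + 1) = level r S i
      · exact .inl ⟨i, by omega, he⟩
      · rcases ih with ⟨j, hj, h⟩ | h
        · exact .inl ⟨j, by omega, h⟩
        · right
          have : (level r S i).ncard < (level r S (i + 1)).ncard :=
            Set.ncard_lt_ncard ((level_mono r S (Nat.le_succ i)).ssubset_of_ne (Ne.symm he))
              (hfin _)
          omega
  obtain ⟨j, hj, hst⟩ := (key (V.card + 1)).resolve_right (by
    have : (level r S (V.card + 1)).ncard ≤ (V : Set α).ncard :=
      Set.ncard_le_ncard (hV _) V.finite_toSet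
    rw [Set.ncard_coe_finset] at this
    omega)
  refine level_mono r S (by omega : j ≤ V.card) ?_
  induction h with
  | refl => exact level_mono r S (Nat.zero_le j) hv
  | @tail b c _ hbc ih => rw [← hst]; exact .inr ⟨b, ih, hbc⟩

/-! ### Automata given by lists of edges -/

/-- The relation of the edges of a list. -/
def edgeRel (ne : ℕ) (es el et : ℕ → ℕ) (p j q : ℕ) : Prop :=
  ∃ e < ne, es e = p ∧ el e = j ∧ et e = q

/-- One step inside of a block, with the number of the pattern. -/
def numLink (k m ne : ℕ) (es el et : ℕ → ℕ) (v w : ℕ × ℕ) : Prop :=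
  ∃ e < ne, es e = v.1 ∧ et e = w.1 ∧ k ≤ el e ∧ nextPat k m (el e) v.2 = w.2 + 1

/-- Pattern numbers below `2 ^ (3 * m)` correspond to patterns without loss, so reachability can be
decided in a finite graph on pairs of numbers. -/
theorem mem_blockSet_iff {k m ne : ℕ} {es el et : ℕ → ℕ} {S : Set ℕ} {q b : ℕ}
    (hb : b < 2 ^ (3 * m)) : q ∈ blockSet k (edgeRel ne es el et) S (patOf m b) ↔
      ∃ v ∈ {v : ℕ × ℕ | v.1 ∈ S ∧ v.2 = 0},
        Relation.ReflTransGen (numLink k m ne es el et) v (q, b) := by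
  have hlink : ∀ (v : ℕ × ℕ) (u : ℕ × Pat m), v.2 < 2 ^ (3 * m) →
      (Link k (edgeRel ne es el et) (v.1, patOf m v.2) u ↔ ∃ v' : ℕ × ℕ,
        v'.2 < 2 ^ (3 * m) ∧ (v'.1, patOf m v'.2) = u ∧ numLink k m ne es el et v v') := by
    rintro ⟨p, c⟩ ⟨p', π'⟩ hc
    simp only at hc
    constructor
    · rintro ⟨j, ⟨e, he, h1, h2, h3⟩, hl⟩
      -- A letter has no step inside of a block, so only labels that are not letters can occur.
      have hkj : k ≤ j := by
        by_contra hlt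
        have hs : symAt k m j = some (.letter ⟨j, by omega⟩) := symAt_eq_letter.2 rfl
        simp [hs, Pat.step] at hl
      rcases nextPat_spec hkj hc with ⟨_, h⟩ | ⟨b', h, hb', h'⟩
      · exact absurd hl (h π')
      · refine ⟨(p', b'), hb', ?_, e, he, h1, h3, h2 ▸ hkj, h2 ▸ h⟩
        rw [(h' π').1 hl]
    · rintro ⟨⟨q', b'⟩, hb', h, e, he, h1, h2, hk, hn⟩
      simp only [Prod.mk.injEq] at h
      obtain ⟨rfl, rfl⟩ := h
      refine ⟨el e, ⟨e, he, h1, rfl, h2⟩, ?_⟩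
      rcases nextPat_spec hk hc with ⟨h0, _⟩ | ⟨b₂, h, hb₂, h'⟩
      · simp [hn] at h0
      · refine (h' _).2 ?_
        have : b' = b₂ := by simp only at hn; omega
        rw [this]
  constructor
  · rintro ⟨p, hp, h⟩
    refine ⟨(p, 0), ⟨hp, rfl⟩, ?_⟩
    have : ∀ u : ℕ × Pat m, Relation.ReflTransGen (Link k (edgeRel ne es el et)) (p, Pat.zero m) u →
        ∃ v : ℕ × ℕ, v.2 < 2 ^ (3 * m) ∧ (v.1, patOf m v.2) = u ∧
          Relation.ReflTransGen (numLink k m ne es el et) (p, 0) v := by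
      intro u hu
      induction hu with
      | refl => exact ⟨(p, 0), by simp, by simp [patOf_zero], .refl⟩
      | tail _ hl ih =>
        obtain ⟨v, hv, rfl, hr⟩ := ih
        obtain ⟨v', hv', e, hl'⟩ := (hlink v _ hv).1 hl
        exact ⟨v', hv', e, hr.tail hl'⟩
    obtain ⟨⟨q', b'⟩, hb', e, hr⟩ := this _ h
    simp only [Prod.mk.injEq] at e
    obtain ⟨rfl, e⟩ := e
    obtain rfl := patOf_injOn hb' hb e
    exact hr
  · rintro ⟨⟨p, c⟩, ⟨hp, rfl⟩, h⟩
    refine ⟨p, hp, ?_⟩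
    have : ∀ v : ℕ × ℕ, Relation.ReflTransGen (numLink k m ne es el et) (p, 0) v →
        v.2 < 2 ^ (3 * m) ∧ Relation.ReflTransGen (Link k (edgeRel ne es el et)) (p, Pat.zero m)
          (v.1, patOf m v.2) := by
      intro v hv
      induction hv with
      | refl => exact ⟨by simp, by rw [patOf_zero]⟩
      | @tail v v' _ hl ih =>
        have hl₀ := hl
        obtain ⟨e, he, h1, h2, hk, hn⟩ := hl
        have hb' : v'.2 < 2 ^ (3 * m) := by
          rcases nextPat_spec hk ih.1 with ⟨h0, _⟩ | ⟨b₂, h, hb₂, h'⟩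
          · omega
          · have : v'.2 = b₂ := by omega
            rwa [this]
        exact ⟨hb', ih.2.tail ((hlink v _ ih.1).2 ⟨v', hb', rfl, hl₀⟩)⟩
    exact (this _ h).2

/-! ### Tables -/

section Tables

variable {R Ω : Type*}

/-- Fill the array `a` with the multiples of the value of `c`. -/
def mulTable (a : ℕ) (e c : NExpr) : Prog :=
  .seq (.setNum a (.lit 0) (.lit 0))
    (.for 31 e (.setNum a (.add (.var 31) (.lit 1)) (.add (.get a (.var 31)) c)))

/-- The tables of multiples replace multiplication wherever an address is a product plus an offset.
The bound and the summand are evaluated again in each round, hence they have to keep their values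
while the table and its counter change. -/
theorem halts_mulTable {a : ℕ} {e c : NExpr} {s : Store R Ω} (ha : a ≠ 31) (N d : ℕ)
    (hN : ∀ s₁, Same (fun b => b ≠ a ∧ b ≠ 31) s s₁ → e.eval s₁ = N)
    (hc : ∀ s₁, Same (fun b => b ≠ a ∧ b ≠ 31) s s₁ → c.eval s₁ = d) :
    Halts (mulTable a e c) s ((c.cost + e.cost + 60) * (N + 1)) fun s₂ =>
      Same (fun b => b ≠ a ∧ b ≠ 31) s s₂ ∧ ∀ i ≤ N, s₂.num a i = i * d := by
  have h0 : Same (fun b => b ≠ a ∧ b ≠ 31) s (s.setNum a 0 0) :=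
    (Same.refl _ s).setNum (by simp) _ _
  refine Halts.run_seq ((c.cost + 12 + e.cost + 20) * ((N + 1) * 1)) rfl ?_ ?_
  · simp only [Prog.bound, NExpr.cost]
    nlinarith
  · refine (Halts.forK (K := fun b => b ≠ a ∧ b ≠ 31)
      (fun j s₁ => ∀ i ≤ j, s₁.num a i = i * d) N (c.cost + 12) 1 le_rfl (by simp) ?_ ?_ ?_ ?_).mono
      le_rfl fun s₂ h => ⟨h0.trans h.1, h.2⟩
    · intro j s₁ i y h i' hi'
      rw [Store.num_setNum_ne _ _ _ ha]
      exact h i' hi'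
    · simp [Prog.run, NExpr.eval, Store.num_setNum]
    · exact fun s₁ h => hN s₁ (h0.trans h)
    · intro j s₁ hj hs hJ hv
      refine Halts.of_run rfl (by simp [Prog.bound, NExpr.cost]; omega) ?_
      refine ⟨by simp [Prog.run, NExpr.eval, Store.num_setNum, hv, ha.symm],
        (Same.refl _ _).setNum (by simp) _ _, fun i hi => ?_⟩
      simp only [Prog.run, NExpr.eval, Store.num_setNum, hv, hc s₁ (h0.trans hs), true_and]
      split_ifs with h
      · rw [hJ j le_rfl, h]; ring
      · exact hJ i (by omega)

/-- Fill the array `24` with the powers of `2`. -/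
def powTable (e : NExpr) : Prog :=
  .seq (.setNum 24 (.lit 0) (.lit 1))
    (.for 31 e (.setNum 24 (.add (.var 31) (.lit 1))
      (.add (.get 24 (.var 31)) (.get 24 (.var 31)))))

theorem halts_powTable {e : NExpr} {s : Store R Ω} (N : ℕ)
    (hN : ∀ s₁, Same (fun b => b ≠ 24 ∧ b ≠ 31) s s₁ → e.eval s₁ = N) :
    Halts (powTable e) s ((e.cost + 60) * (N + 1)) fun s₂ =>
      Same (fun b => b ≠ 24 ∧ b ≠ 31) s s₂ ∧ ∀ i ≤ N, s₂.num 24 i = 2 ^ i := by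
  have h0 : Same (fun b => b ≠ 24 ∧ b ≠ 31) s (s.setNum 24 0 1) :=
    (Same.refl _ s).setNum (by simp) _ _
  refine Halts.run_seq ((20 + e.cost + 20) * ((N + 1) * 1)) rfl ?_ ?_
  · simp only [Prog.bound, NExpr.cost]
    nlinarith
  · refine (Halts.forK (K := fun b => b ≠ 24 ∧ b ≠ 31)
      (fun j s₁ => ∀ i ≤ j, s₁.num 24 i = 2 ^ i) N 20 1 le_rfl (by simp) ?_ ?_ ?_ ?_).mono
      le_rfl fun s₂ h => ⟨h0.trans h.1, h.2⟩
    · intro j s₁ i y h i' hi'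
      rw [Store.num_setNum_ne _ _ _ (by decide)]
      exact h i' hi'
    · simp [Prog.run, NExpr.eval, Store.num_setNum]
    · exact fun s₁ h => hN s₁ (h0.trans h)
    · intro j s₁ hj hs hJ hv
      refine Halts.of_run rfl (by simp [Prog.bound, NExpr.cost]) ?_
      refine ⟨by simp [Prog.run, NExpr.eval, Store.num_setNum, hv],
        (Same.refl _ _).setNum (by simp) _ _, fun i hi => ?_⟩
      simp only [Prog.run, NExpr.eval, Store.num_setNum, hv, true_and]
      split_ifs with h
      · rw [hJ j le_rfl, h]; ring
      · exact hJ i (by omega)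

/-- Fill the arrays `25` and `26` with quotients and remainders of the division by `2`. -/
def halfTable (e : NExpr) : Prog :=
  .for 31 e
    (.seq (.seq (.setNum 25 (.add (.var 31) (.var 31)) (.var 31))
      (.setNum 25 (.add (.add (.var 31) (.var 31)) (.lit 1)) (.var 31)))
      (.seq (.setNum 26 (.add (.var 31) (.var 31)) (.lit 0))
        (.setNum 26 (.add (.add (.var 31) (.var 31)) (.lit 1)) (.lit 1))))

theorem halts_halfTable {e : NExpr} {s : Store R Ω} (N : ℕ)
    (hN : ∀ s₁, Same (fun b => b ≠ 25 ∧ b ≠ 26 ∧ b ≠ 31) s s₁ → e.eval s₁ = N) :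
    Halts (halfTable e) s ((e.cost + 80) * (N + 1)) fun s₂ =>
      Same (fun b => b ≠ 25 ∧ b ≠ 26 ∧ b ≠ 31) s s₂ ∧
        ∀ i < N, s₂.num 25 i = i / 2 ∧ s₂.num 26 i = i % 2 := by
  refine (Halts.forK (K := fun b => b ≠ 25 ∧ b ≠ 26 ∧ b ≠ 31)
      -- Round `j` fills the cells `2 * j` and `2 * j + 1`; running `N` rounds fills more than the
      -- required range.
      (fun j s₁ => ∀ i < 2 * j, s₁.num 25 i = i / 2 ∧ s₁.num 26 i = i % 2) N 60 1 le_rfl (by simp)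
      ?_ ?_ hN ?_).mono (by ring_nf; omega) fun s₂ h => ⟨h.1, fun i hi => h.2 i (by omega)⟩
  · intro j s₁ i y h i' hi'
    rw [Store.num_setNum_ne _ _ _ (by decide), Store.num_setNum_ne _ _ _ (by decide)]
    exact h i' hi'
  · simp
  · intro j s₁ hj hs hJ hv
    refine Halts.of_run rfl (by simp [Prog.bound, NExpr.cost]) ?_
    refine ⟨by simp [Prog.run, NExpr.eval, Store.num_setNum, hv], ?_, fun i hi => ?_⟩
    · exact ((((Same.refl _ _).setNum (by simp) _ _).setNum (by simp) _ _).setNum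
        (by simp) _ _).setNum (by simp) _ _
    · simp [Prog.run, NExpr.eval, Store.num_setNum, hv]
      by_cases h1 : i = j + j + 1
      · simp [h1]; omega
      · by_cases h2 : i = j + j
        · simp [h2]; omega
        · simpa [h1, h2] using hJ i (by omega)

/-- Write the binary digits of the value of `e` into the array `d`. -/
def unpack (d : ℕ) (e w : NExpr) : Prog :=
  .seq (.setVar 80 e)
    (.for 81 w (.seq (.setNum d (.var 81) (.get 26 (.var 80))) (.setVar 80 (.get 25 (.var 80)))))

/-- Halving is a look-up in a table, so the value and its successive quotients, kept in the variable
`80`, must lie in the range of the table. -/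
theorem halts_unpack {d : ℕ} {e w : NExpr} {s : Store R Ω} (hd : d < 80) (W v N : ℕ)
    (hW : ∀ i < 2 ^ W, s.num 25 i = i / 2 ∧ s.num 26 i = i % 2) (hd' : d ≠ 25 ∧ d ≠ 26)
    (hv : e.eval s = v) (hvW : v < 2 ^ W)
    (hN : ∀ s₁, Same (fun b => b < 80 ∧ b ≠ d) s s₁ → w.eval s₁ = N) :
    Halts (unpack d e w) s ((e.cost + w.cost + 60) * (N + 1)) fun s₂ =>
      Same (fun b => b < 80 ∧ b ≠ d) s s₂ ∧ ∀ i < N, s₂.num d i = (v.testBit i).toNat := by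
  have h0 : Same (fun b => b < 80 ∧ b ≠ d) s (s.setNum 80 0 v) :=
    (Same.refl _ s).setNum (by simp) _ _
  refine Halts.run_seq ((20 + w.cost + 20) * ((N + 1) * 1)) rfl ?_ ?_
  · simp only [Prog.bound, NExpr.cost]
    nlinarith
  · have e0 : (Prog.setVar 80 e).run s = s.setNum 80 0 v := by simp [Prog.run, NExpr.eval, hv]
    rw [e0]
    refine (Halts.forK (K := fun b => b < 80 ∧ b ≠ d)
      (fun j s₁ => s₁.num 80 0 = v / 2 ^ j ∧ ∀ i < j, s₁.num d i = (v.testBit i).toNat) N 20 1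
      le_rfl (by simp) ?_ ?_ ?_ ?_).mono le_rfl fun s₂ h => ⟨h0.trans h.1, h.2.2⟩
    · intro j s₁ i y h
      rw [Store.num_setNum_ne _ _ _ (by decide), Store.num_setNum_ne _ _ _ (by omega)]
      exact h
    · simp [Store.num_setNum]
    · exact fun s₁ h => hN s₁ (h0.trans h)
    · intro j s₁ hj hs hJ hv'
      have hs' := h0.trans hs
      have hlt : v / 2 ^ j < 2 ^ W := (Nat.div_le_self _ _).trans_lt hvW
      have e1 : s₁.num 25 (v / 2 ^ j) = v / 2 ^ (j + 1) := by
        rw [(hs' 25 ⟨by omega, hd'.1.symm⟩).1, (hW _ hlt).1, Nat.div_div_eq_div_mul, pow_succ]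
      have e2 : s₁.num 26 (v / 2 ^ j) = (v.testBit j).toNat := by
        rw [(hs' 26 ⟨by omega, hd'.2.symm⟩).1, (hW _ hlt).2, Nat.toNat_testBit]
      have n1 : d ≠ 80 := by omega
      have n2 : d ≠ 81 := by omega
      refine Halts.of_run rfl (by simp [Prog.bound, NExpr.cost]) ?_
      refine ⟨by simp [Prog.run, NExpr.eval, Store.num_setNum, hv', n2.symm],
        ((Same.refl _ _).setNum (by simp) _ _).setNum (by simp) _ _, ?_, fun i hi => ?_⟩
      · simp [Prog.run, NExpr.eval, Store.num_setNum, n1.symm, hd'.1.symm, hJ.1, e1]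
      · simp only [Prog.run, NExpr.eval, Store.num_setNum, n1, hJ.1, hv', true_and, false_and,
          if_false]
        split_ifs with h
        · rw [h, e2]
        · exact hJ.2 i (by omega)

end Tables

/-! ### The memory during the construction -/

section Construction

variable {R Ω : Type*} {h k m : ℕ}

/-- The memory holds a DSST and an automaton given by a list of edges. -/
structure Loaded (T : DSST (Fin h) (RefSym (Fin k) m) R Ω) (n ne : ℕ) (es el et I F : ℕ → ℕ)
    (s : Store R Ω) : Prop where
  k_eq : s.num 0 0 = k
  m_eq : s.num 0 1 = m
  h_eq : s.num 0 2 = h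
  start_eq : s.num 0 3 = T.start
  step_eq : s.num 1 = T.store.num 1
  asg_eq : s.asg 1 = T.store.asg 1
  final_eq : s.num 2 = T.store.num 2
  str_eq : s.str 2 = T.store.str 2
  init_eq : s.num 4 = I
  acc_eq : s.num 5 = F
  ne_eq : s.num 19 0 = ne
  n_eq : s.num 20 0 = n
  es_eq : s.num 21 = es
  el_eq : s.num 22 = el
  et_eq : s.num 23 = et

/-- The memory moreover holds all tables. -/
structure Env (T : DSST (Fin h) (RefSym (Fin k) m) R Ω) (n ne : ℕ) (es el et I F : ℕ → ℕ)
    (s : Store R Ω) : Prop extends Loaded T n ne es el et I F s where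
  pow_eq : ∀ i ≤ n + 3 * m, s.num 24 i = 2 ^ i
  half_eq : ∀ i < 2 ^ (n + 3 * m), s.num 25 i = i / 2 ∧ s.num 26 i = i % 2
  off_eq : ∀ p ≤ n, s.num 27 p = p * 2 ^ (3 * m)
  row_eq : ∀ q ≤ h, s.num 28 q = q * (k + 2 * m)
  set_eq : ∀ S ≤ 2 ^ n, s.num 29 S = S * (2 ^ (3 * m) * h)
  pat_eq : ∀ b ≤ 2 ^ (3 * m), s.num 30 b = b * h

variable {T : DSST (Fin h) (RefSym (Fin k) m) R Ω} {n ne : ℕ} {es el et I F : ℕ → ℕ}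
  {s s₁ : Store R Ω}

theorem Loaded.of_same (hs : Loaded T n ne es el et I F s) {K : ℕ → Prop} (hK : Same K s s₁)
    (h : ∀ a, a ≤ 5 ∨ (19 ≤ a ∧ a ≤ 23) → K a) : Loaded T n ne es el et I F s₁ := by
  have e := fun a ha => (hK a (h a ha)).1
  have e' := fun a ha => (hK a (h a ha)).2.1
  have e'' := fun a ha => (hK a (h a ha)).2.2
  constructor
  · rw [e 0 (by omega)]; exact hs.k_eq
  · rw [e 0 (by omega)]; exact hs.m_eq
  · rw [e 0 (by omega)]; exact hs.h_eq
  · rw [e 0 (by omega)]; exact hs.start_eq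
  · rw [e 1 (by omega)]; exact hs.step_eq
  · rw [e' 1 (by omega)]; exact hs.asg_eq
  · rw [e 2 (by omega)]; exact hs.final_eq
  · rw [e'' 2 (by omega)]; exact hs.str_eq
  · rw [e 4 (by omega)]; exact hs.init_eq
  · rw [e 5 (by omega)]; exact hs.acc_eq
  · rw [e 19 (by omega)]; exact hs.ne_eq
  · rw [e 20 (by omega)]; exact hs.n_eq
  · rw [e 21 (by omega)]; exact hs.es_eq
  · rw [e 22 (by omega)]; exact hs.el_eq
  · rw [e 23 (by omega)]; exact hs.et_eq

theorem Env.of_same (hs : Env T n ne es el et I F s) {K : ℕ → Prop} (hK : Same K s s₁)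
    (h : ∀ a, a ≤ 5 ∨ (19 ≤ a ∧ a ≤ 30) → K a) : Env T n ne es el et I F s₁ := by
  have e := fun a ha => (hK a (h a ha)).1
  refine ⟨hs.toLoaded.of_same hK fun a ha => h a (by omega), ?_, ?_, ?_, ?_, ?_, ?_⟩
  · rw [e 24 (by omega)]; exact hs.pow_eq
  · rw [e 25 (by omega), e 26 (by omega)]; exact hs.half_eq
  · rw [e 27 (by omega)]; exact hs.off_eq
  · rw [e 28 (by omega)]; exact hs.row_eq
  · rw [e 29 (by omega)]; exact hs.set_eq
  · rw [e 30 (by omega)]; exact hs.pat_eq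

/-- The expression for the number of patterns. -/
abbrev numPat : NExpr :=
  .get 24 (.add (.add (.get 0 (.lit 1)) (.get 0 (.lit 1))) (.get 0 (.lit 1)))

/-- The expression for the number of binary digits of a pattern. -/
abbrev numBits : NExpr := .add (.add (.get 0 (.lit 1)) (.get 0 (.lit 1))) (.get 0 (.lit 1))

/-- The expression for the number of sets of states. -/
abbrev numSets : NExpr := .get 24 (.var 20)

theorem Env.eval_numPat (hs : Env T n ne es el et I F s) : numPat.eval s = 2 ^ (3 * m) := by
  simp only [NExpr.eval, hs.m_eq]
  rw [hs.pow_eq _ (by omega)]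
  congr 1
  omega

theorem Env.eval_numBits (hs : Env T n ne es el et I F s) : numBits.eval s = 3 * m := by
  simp only [NExpr.eval, hs.m_eq]
  omega

theorem Env.eval_numSets (hs : Env T n ne es el et I F s) : numSets.eval s = 2 ^ n := by
  simp only [NExpr.eval, hs.n_eq]
  exact hs.pow_eq _ (by omega)

theorem two_pow_le_pow_add (n w : ℕ) : 2 ^ w ≤ 2 ^ (n + w) :=
  Nat.pow_le_pow_right (by omega) (by omega)

/-- Unpack the pattern in the variable `v` into the array `d`. -/
theorem Env.halts_unpack_pat (hs : Env T n ne es el et I F s) {d v b : ℕ}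
    (hd : 31 ≤ d ∧ d < 80) (hv : s.num v 0 = b) (hb : b < 2 ^ (3 * m)) :
    Halts (unpack d (.var v) numBits) s (80 * (3 * m + 1)) fun s₂ =>
      Same (fun a => a < 80 ∧ a ≠ d) s s₂ ∧ ∀ i < 3 * m, s₂.num d i = (b.testBit i).toNat :=
  (halts_unpack (e := .var v) hd.2 (n + 3 * m) b (3 * m) hs.half_eq (by omega) hv
    (hb.trans_le (two_pow_le_pow_add _ _))
    (fun _ h => (hs.of_same h (by intro a ha; omega)).eval_numBits)).mono
    (Nat.mul_le_mul_right _ (by simp [NExpr.cost])) fun _ h => h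

/-- Compute the number of the set of the states that are reached with the pattern in `42`. -/
def pack : Prog :=
  .seq (.setVar 51 (.lit 0))
    (.for 52 (.var 20)
      (.ite (.get 60 (.add (.get 27 (.var 52)) (.var 42)))
        (.setVar 51 (.add (.var 51) (.get 24 (.var 52)))) .skip))

theorem Env.halts_pack (hs : Env T n ne es el et I F s) {b : ℕ} (hb : s.num 42 0 = b) :
    Halts pack s (60 * (n + 1)) fun s₂ => Same (fun a => a ≠ 51 ∧ a ≠ 52) s s₂ ∧
      s₂.num 51 0 = setNumber n {p | s.num 60 (p * 2 ^ (3 * m) + b) ≠ 0} := by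
  classical
  have h0 : Same (fun a => a ≠ 51 ∧ a ≠ 52) s (s.setNum 51 0 0) :=
    (Same.refl _ s).setNum (by simp) _ _
  refine Halts.run_seq ((25 + 2 + 20) * ((n + 1) * 1)) rfl ?_ ?_
  · simp only [Prog.bound, NExpr.cost]
    omega
  refine (Halts.forK (K := fun a => a ≠ 51 ∧ a ≠ 52) (fun j s₁ => s₁.num 51 0 =
    setNumber j {p | s.num 60 (p * 2 ^ (3 * m) + b) ≠ 0}) n 25 1 le_rfl (by simp) ?_ ?_ ?_ ?_).mono
      le_rfl fun s₂ h => ⟨h0.trans h.1, h.2⟩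
  · intro j s₁ i y h
    rw [Store.num_setNum_ne _ _ _ (by decide)]
    exact h
  · simp [Prog.run, NExpr.eval, Store.num_setNum, setNumber]
  · exact fun s₁ h => (hs.of_same (h0.trans h) (by intro a ha; omega)).n_eq
  · intro j s₁ hj hss hJ hv
    have hs' := h0.trans hss
    have env := hs.of_same hs' (by intro a ha; omega)
    have e1 : s₁.num 60 = s.num 60 := (hs' 60 (by omega)).1
    have e2 : s₁.num 42 0 = b := by rw [(hs' 42 (by omega)).1, hb]
    refine Halts.of_run rfl (by simp [Prog.bound, NExpr.cost]) ?_
    have e3 : setNumber (j + 1) {p | s.num 60 (p * 2 ^ (3 * m) + b) ≠ 0} =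
        setNumber j {p | s.num 60 (p * 2 ^ (3 * m) + b) ≠ 0} +
          if s.num 60 (j * 2 ^ (3 * m) + b) ≠ 0 then 2 ^ j else 0 := by
      simp [setNumber, Finset.sum_range_succ]
    simp only [Prog.run, NExpr.eval, hv, e1, e2, env.off_eq j hj.le, env.pow_eq j (by omega), hJ]
    split_ifs with hc
    · refine ⟨hv, Same.refl _ _, ?_⟩
      rw [hJ, e3]
      simp [hc]
    · refine ⟨by simp [Store.num_setNum, hv], (Same.refl _ _).setNum (by simp) _ _, ?_⟩
      rw [e3]
      simp [hc, Store.num_setNum]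

/-! #### Runs of the DSST -/

/-- The variable `70` holds the configuration of a run. -/
def HoldsRun (s : Store R Ω) : Option (Assignment R Ω × Fin h) → Prop
  | none => s.num 70 0 = 0
  | some c => s.num 70 0 = c.2 + 1 ∧ s.asg 70 0 = c.1

/-- Read the symbol whose number is the value of `j`. -/
def readSym (j : NExpr) : Prog :=
  .ite (.var 70)
    (.seq (.setVar 72 (.add (.get 28 (.sub (.var 70) (.lit 1))) j))
      (.seq (.setAsg 70 (.lit 0) (.comp (.get 70 (.lit 0)) (.get 1 (.var 72))))
        (.setVar 70 (.get 1 (.var 72)))))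
    .skip

theorem symAt_lt {j : ℕ} {b : RefSym (Fin k) m} (hj : symAt k m j = some b) : j < k + 2 * m := by
  unfold symAt at hj
  split_ifs at hj <;> omega

theorem DSST.entry_eq (T : DSST (Fin h) (RefSym (Fin k) m) R Ω) (q : Fin h) {j : ℕ}
    {b : RefSym (Fin k) m} (hj : symAt k m j = some b) :
    T.entry (q * (k + 2 * m) + j) = T.step q b := by
  have hlt := symAt_lt hj
  have e1 : (q * (k + 2 * m) + j) / (k + 2 * m) = q := by
    rw [mul_comm, Nat.mul_add_div (by omega), Nat.div_eq_of_lt hlt, add_zero]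
  have e2 : (q * (k + 2 * m) + j) % (k + 2 * m) = j := by
    rw [mul_comm, Nat.mul_add_mod, Nat.mod_eq_of_lt hlt]
  simp [DSST.entry, entryAt, e1, e2, hj]

/-- The table stores `0` for a missing transition and `p + 1` otherwise, which is the convention of
the variable `70`. A run that fails thus leaves `0` there and stays dead; its assignment no longer
matters. -/
theorem Env.halts_readSym (hs : Env T n ne es el et I F s) {c : Option (Assignment R Ω × Fin h)}
    (hc : HoldsRun s c) {e : NExpr} {j : ℕ} {b : RefSym (Fin k) m} (he : e.eval s = j)
    (hj : symAt k m j = some b) :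
    Halts (readSym e) s (e.cost + 40) fun s₂ => Same (fun a => a ≠ 70 ∧ a ≠ 72) s s₂ ∧
      HoldsRun s₂ (T.stepA c b) := by
  refine Halts.of_run rfl (by simp only [readSym, Prog.bound, NExpr.cost, AExpr.cost]; omega) ?_
  cases c with
  | none =>
    have h0 : s.num 70 0 = 0 := hc
    refine ⟨by simp [readSym, Prog.run, NExpr.eval, h0, Same.refl], ?_⟩
    simp [readSym, Prog.run, NExpr.eval, h0, DSST.stepA, HoldsRun]
  | some c =>
    obtain ⟨h1, h2⟩ := hc
    have e1 : s.num 28 c.2 = c.2 * (k + 2 * m) := hs.row_eq _ c.2.2.le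
    simp only [readSym, Prog.run, NExpr.eval, AExpr.eval, h1, Nat.add_sub_cancel, e1, he]
    rw [if_neg (by omega)]
    refine ⟨(((Same.refl _ _).setNum (by simp) _ _).setAsg (by simp) _ _).setNum (by simp) _ _, ?_⟩
    have e2 := T.entry_eq c.2 hj
    simp only [DSST.stepA, Option.bind_some]
    cases ht : T.step c.2 b with
    | none =>
      simp [HoldsRun, Store.num_setNum, hs.step_eq, DSST.store, e2, ht]
    | some τ =>
      simp [HoldsRun, Store.num_setNum, Store.asg_setAsg, hs.step_eq, hs.asg_eq, DSST.store, e2, ht,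
        h2]

/-- If the cell `i` of the array `50` is not zero, then do `P`. -/
abbrev ifDigit (i : NExpr) (P : Prog) : Prog := .ite (.get 50 i) P .skip

/-- The expression for three times the variable `71`. -/
abbrev tripleVar : NExpr := .add (.add (.var 71) (.var 71)) (.var 71)

/-- Read the opening bracket of the variable in `71`. -/
abbrev readOpn : Prog := readSym (.add (.get 0 (.lit 0)) (.var 71))

/-- Read the closing bracket of the variable in `71`. -/
abbrev readCls : Prog := readSym (.add (.add (.get 0 (.lit 0)) (.get 0 (.lit 1))) (.var 71))

/-- Read the canonical word of the pattern whose digits are in the array `50`. -/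
def readPat : Prog :=
  .for 71 (.get 0 (.lit 1))
    (.seq (ifDigit tripleVar readCls)
      (.seq (ifDigit (.add tripleVar (.lit 1)) (.seq readOpn readCls))
        (ifDigit (.add tripleVar (.lit 2)) readOpn)))

theorem Halts.ifDigit {e : NExpr} {P : Prog} {t : ℕ} {β : Bool} {Q : Store R Ω → Prop}
    (hβ : s.num 50 (e.eval s) = β.toNat) (h1 : β = true → Halts P s t Q) (h2 : β = false → Q s)
    (ht : 1 ≤ t) : Halts (ifDigit e P) s (e.cost + 2 + t) Q := by
  refine (Halts.ite (t := t) ?_ ?_).mono (by simp only [NExpr.cost]; omega) fun _ h => h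
  · intro h
    refine h1 ?_
    cases β
    · simp [NExpr.eval, hβ] at h
    · rfl
  · intro h
    refine Halts.of_run rfl ht (h2 ?_)
    cases β
    · rfl
    · simp [NExpr.eval, hβ] at h

/-- The canonical word is the concatenation of the words of the variables in their order. The loop
invariant is the run over the first `j` of them, and each round reads the at most four brackets
prescribed by three digits. -/
theorem Env.halts_readPat (hs : Env T n ne es el et I F s) {c : Option (Assignment R Ω × Fin h)}
    (hc : HoldsRun s c) {b : ℕ} (hb : ∀ i < 3 * m, s.num 50 i = (b.testBit i).toNat) :
    Halts readPat s (400 * (m + 1)) fun s₂ => Same (fun a => a ≠ 70 ∧ a ≠ 71 ∧ a ≠ 72) s s₂ ∧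
      HoldsRun s₂ (T.runA c ((patOf m b).word (Fin k))) := by
  set K : ℕ → Prop := fun a => a ≠ 70 ∧ a ≠ 71 ∧ a ≠ 72 with hK
  set wv : Fin m → List (RefSym (Fin k) m) := (patOf m b).wordVar (Fin k) with hwv
  refine (Halts.forK (K := K) (fun j s₁ => HoldsRun s₁
    (T.runA c (((List.finRange m).take j).flatMap wv))) m 350 1 le_rfl (by simp [hK]) ?_ ?_ ?_
    ?_).mono (by simp only [NExpr.cost]; omega) fun s₂ h => ⟨h.1, ?_⟩
  · intro j s₁ i y h
    unfold HoldsRun at *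
    rw [Store.num_setNum_ne _ _ _ (by decide)]
    exact h
  · simpa [DSST.runA] using hc
  · exact fun s₁ h => (hs.of_same h (by intro a ha; omega)).m_eq
  · intro j s₁ hj hss hJ hv
    set x : Fin m := ⟨j, hj⟩ with hx
    have hword : T.runA c (((List.finRange m).take (j + 1)).flatMap wv) =
        T.runA (T.runA c (((List.finRange m).take j).flatMap wv)) (wv x) := by
      rw [List.take_succ_eq_append_getElem (by simpa using hj), List.flatMap_append, DSST.runA,
        List.foldl_append]
      simp [DSST.runA, hx]
    rw [hword]
    set c₁ := T.runA c (((List.finRange m).take j).flatMap wv) with hc₁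
    have so : symAt k m (k + j) = some (.opn x) := by simp [symAt, hj, hx]
    have sc : symAt k m (k + m + j) = some (.cls x) := by
      have h1 : ¬ k + m + j < k := by omega
      have h2 : ¬ k + m + j - k < m := by omega
      have h3 : k + m + j - k - m = j := by omega
      simp [symAt, hj, hx, h1, h2, h3]
    set K₁ : ℕ → Prop := fun a => a ≠ 70 ∧ a ≠ 72 with hK₁
    have hfacts : ∀ s₂, Same K₁ s₁ s₂ → Env T n ne es el et I F s₂ ∧ s₂.num 71 0 = j ∧
        ∀ i < 3 * m, s₂.num 50 i = (b.testBit i).toNat := by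
      intro s₂ h
      refine ⟨(hs.of_same hss (by intro a ha; omega)).of_same h (by intro a ha; omega), ?_, ?_⟩
      · rw [(h 71 (by simp [hK₁])).1, hv]
      · rw [(h 50 (by simp [hK₁])).1, (hss 50 (by simp [hK])).1]; exact hb
    have hopn : ∀ s₂ c₂, Same K₁ s₁ s₂ → HoldsRun s₂ c₂ → Halts readOpn s₂ 45 fun s₃ =>
        Same K₁ s₁ s₃ ∧ HoldsRun s₃ (T.stepA c₂ (.opn x)) := by
      intro s₂ c₂ h hc₂
      obtain ⟨env, h71, -⟩ := hfacts s₂ h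
      exact (env.halts_readSym hc₂ (by simp [NExpr.eval, env.k_eq, h71]) so).mono
        (by simp [NExpr.cost]) fun s₃ h3 => ⟨h.trans h3.1, h3.2⟩
    have hcls : ∀ s₂ c₂, Same K₁ s₁ s₂ → HoldsRun s₂ c₂ → Halts readCls s₂ 50 fun s₃ =>
        Same K₁ s₁ s₃ ∧ HoldsRun s₃ (T.stepA c₂ (.cls x)) := by
      intro s₂ c₂ h hc₂
      obtain ⟨env, h71, -⟩ := hfacts s₂ h
      exact (env.halts_readSym hc₂ (by simp [NExpr.eval, env.k_eq, env.m_eq, h71]) sc).mono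
        (by simp [NExpr.cost]) fun s₃ h3 => ⟨h.trans h3.1, h3.2⟩
    have d0 : wv x = (if b.testBit (3 * j) then [.cls x] else []) ++
        ((if b.testBit (3 * j + 1) then [.opn x, .cls x] else []) ++
        (if b.testBit (3 * j + 2) then [.opn x] else [])) := by
      simp [hwv, Pat.wordVar, patOf, hx]
    rw [d0, DSST.runA, List.foldl_append, List.foldl_append]
    set c₂ := List.foldl T.stepA c₁ (if b.testBit (3 * j) then [.cls x] else []) with hc₂
    set c₃ := List.foldl T.stepA c₂ (if b.testBit (3 * j + 1) then [.opn x, .cls x] else [])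
      with hc₃
    refine Halts.seq_le (Q := fun s₂ => Same K₁ s₁ s₂ ∧ HoldsRun s₂ c₂) 70 200 ?_ (by omega)
      fun s₂ h₂ => ?_
    · refine (Halts.ifDigit (t := 50) (β := b.testBit (3 * j)) ?_ ?_ ?_ (by omega)).mono
        (by simp [NExpr.cost]) fun _ h => h
      · simp only [NExpr.eval, hv]
        rw [(hfacts s₁ (Same.refl _ _)).2.2 _ (by omega), show j + j + j = 3 * j by omega]
      · intro hβ
        have := hcls s₁ c₁ (Same.refl _ _) hJ
        simpa [hc₂, hβ] using this
      · intro hβ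
        exact ⟨Same.refl _ _, by simpa [hc₂, hβ] using hJ⟩
    refine Halts.seq_le (Q := fun s₃ => Same K₁ s₁ s₃ ∧ HoldsRun s₃ c₃) 120 80 ?_ (by omega)
      fun s₃ h₃ => ?_
    · obtain ⟨env, h71, h50⟩ := hfacts s₂ h₂.1
      refine (Halts.ifDigit (t := 95) (β := b.testBit (3 * j + 1)) ?_ ?_ ?_ (by omega)).mono
        (by simp [NExpr.cost]) fun _ h => h
      · simp only [NExpr.eval, h71]
        rw [h50 _ (by omega), show j + j + j = 3 * j by omega]
      · intro hβ
        refine Halts.seq_le 45 50 (hopn s₂ c₂ h₂.1 h₂.2) (by omega) fun s₃ h₃ => ?_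
        have := hcls s₃ _ h₃.1 h₃.2
        simpa [hc₃, hβ] using this
      · intro hβ
        exact ⟨h₂.1, by simpa [hc₃, hβ] using h₂.2⟩
    · obtain ⟨env, h71, h50⟩ := hfacts s₃ h₃.1
      refine (Halts.ifDigit (t := 45) (β := b.testBit (3 * j + 2)) (Q := fun s₄ => Same K₁ s₁ s₄ ∧
        HoldsRun s₄ (List.foldl T.stepA c₃ (if b.testBit (3 * j + 2) then [.opn x] else [])))
        ?_ ?_ ?_ (by omega)).mono
        (by simp [NExpr.cost]) fun s₄ h => ⟨?_, h.1.mono (by intro a ha; omega), h.2⟩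
      · simp only [NExpr.eval, h71]
        rw [h50 _ (by omega), show j + j + j = 3 * j by omega]
      · intro hβ
        have := hopn s₃ c₃ h₃.1 h₃.2
        simpa [hβ] using this
      · intro hβ
        exact ⟨h₃.1, by simpa [hβ] using h₃.2⟩
      · rw [(h.1 71 (by simp [hK₁])).1, hv]
  · have := h.2
    rwa [List.take_of_length_le (by simp)] at this

end Construction

/-! ### One round of the search for the reachable pairs of a state and a pattern. -/

section Closure

variable {R Ω : Type*} {h k m : ℕ} {T : DSST (Fin h) (RefSym (Fin k) m) R Ω} {n ne : ℕ}
  {es el et I F : ℕ → ℕ} {s s₁ : Store R Ω}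

/-- Compute into the variable `65` the number of the next pattern plus one, for the pattern in `62`
with digits in the array `64` and the edge in `63`. -/
def computeNext : Prog :=
  .seq (.setVar 66 (.sub (.get 22 (.var 63)) (.get 0 (.lit 0))))
    (.ite (.sub (.get 0 (.lit 1)) (.var 66))
      (.seq (.setVar 67 (.add (.add (.var 66) (.var 66)) (.var 66)))
        (.ite (.get 64 (.add (.var 67) (.lit 2))) (.setVar 65 (.lit 0))
          (.setVar 65 (.add (.add (.var 62) (.get 24 (.add (.var 67) (.lit 2)))) (.lit 1)))))
      (.seq (.setVar 66 (.sub (.var 66) (.get 0 (.lit 1))))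
        (.ite (.sub (.get 0 (.lit 1)) (.var 66))
          (.seq (.setVar 67 (.add (.add (.var 66) (.var 66)) (.var 66)))
            (.ite (.get 64 (.add (.var 67) (.lit 2)))
              (.ite (.get 64 (.add (.var 67) (.lit 1)))
                (.setVar 65 (.add (.sub (.var 62) (.get 24 (.add (.var 67) (.lit 2)))) (.lit 1)))
                (.setVar 65 (.add (.add (.sub (.var 62) (.get 24 (.add (.var 67) (.lit 2))))
                  (.get 24 (.add (.var 67) (.lit 1)))) (.lit 1))))
              (.ite (.add (.get 64 (.var 67)) (.get 64 (.add (.var 67) (.lit 1))))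
                (.setVar 65 (.lit 0))
                (.setVar 65 (.add (.add (.var 62) (.get 24 (.var 67))) (.lit 1))))))
          (.setVar 65 (.add (.var 62) (.lit 1))))))

theorem toNat_eq_zero_iff (β : Bool) : β.toNat = 0 ↔ β = false := by cases β <;> simp

/-- The branches are those of `nextPat`; comparisons with `m` become tests of a truncated
difference, which is nonzero exactly if the inequality is strict. -/
theorem Env.halts_computeNext (hs : Env T n ne es el et I F s) {b e : ℕ} (hb : s.num 62 0 = b)
    (he : s.num 63 0 = e) (hd : ∀ i < 3 * m, s.num 64 i = (b.testBit i).toNat) :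
    Halts computeNext s 300 fun s₂ => Same (fun a => a ≠ 65 ∧ a ≠ 66 ∧ a ≠ 67) s s₂ ∧
      s₂.num 65 0 = nextPat k m (el e) b := by
  refine Halts.of_run rfl (by simp [computeNext, Prog.bound, NExpr.cost])
    ⟨Same.run (by simp [computeNext, Prog.writes]), ?_⟩
  simp only [computeNext, Prog.run, NExpr.eval, Store.num_setNum, he, hb, hs.el_eq, hs.k_eq,
    hs.m_eq, nextPat]
  norm_num
  by_cases h1 : el e - k < m
  · have e1 : ¬ m - (el e - k) = 0 := by omega
    have e3 : el e - k + (el e - k) + (el e - k) = 3 * (el e - k) := by omega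
    simp only [h1, e1, if_true, if_false, e3, hd (3 * (el e - k) + 2) (by omega),
      hs.pow_eq (3 * (el e - k) + 2) (by omega), toNat_eq_zero_iff]
    cases b.testBit (3 * (el e - k) + 2) <;> simp [Store.num_setNum]
  · have e1 : m - (el e - k) = 0 := by omega
    by_cases h2 : el e - k - m < m
    · have e2 : ¬ m - (el e - k - m) = 0 := by omega
      have e3 : el e - k - m + (el e - k - m) + (el e - k - m) = 3 * (el e - k - m) := by omega
      simp only [h1, h2, e1, e2, if_true, if_false, e3, hd (3 * (el e - k - m) + 2) (by omega),
        hs.pow_eq (3 * (el e - k - m) + 2) (by omega), hd (3 * (el e - k - m) + 1) (by omega),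
        hs.pow_eq (3 * (el e - k - m) + 1) (by omega), hd (3 * (el e - k - m)) (by omega),
        hs.pow_eq (3 * (el e - k - m)) (by omega), toNat_eq_zero_iff]
      cases b.testBit (3 * (el e - k - m) + 2) <;> cases b.testBit (3 * (el e - k - m) + 1) <;>
        cases b.testBit (3 * (el e - k - m)) <;> simp [Store.num_setNum]
    · have e2 : m - (el e - k - m) = 0 := by omega
      simp [h1, h2, e1, e2, Store.num_setNum]

/-- The pairs of states and patterns that are marked in an array. -/
def marked (n P : ℕ) (f : ℕ → ℕ) : Set (ℕ × ℕ) := {v | v.1 < n ∧ v.2 < P ∧ f (v.1 * P + v.2) ≠ 0}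

theorem mul_add_inj {P p q b c : ℕ} (hb : b < P) (hc : c < P) (h : p * P + b = q * P + c) :
    p = q ∧ b = c := by
  have h1 := congrArg (· / P) h
  have h2 := congrArg (· % P) h
  simp only [mul_comm _ P, Nat.mul_add_div (by omega : 0 < P), Nat.mul_add_mod,
    Nat.div_eq_of_lt hb, Nat.div_eq_of_lt hc, Nat.mod_eq_of_lt hb, Nat.mod_eq_of_lt hc] at h1 h2
  exact ⟨by omega, h2⟩

/-- The step of the edge `e`. -/
def edgeLink (k m : ℕ) (es el et : ℕ → ℕ) (e : ℕ) (v w : ℕ × ℕ) : Prop :=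
  es e = v.1 ∧ et e = w.1 ∧ k ≤ el e ∧ nextPat k m (el e) v.2 = w.2 + 1

/-- Follow the edge in `63` from the pattern in `62`. -/
def followEdge : Prog :=
  -- The truncated difference is nonzero exactly if the label is at least `k`, that is, not a
  -- letter.
  .ite (.sub (.add (.get 22 (.var 63)) (.lit 1)) (.get 0 (.lit 0)))
    (.ite (.get 60 (.add (.get 27 (.get 21 (.var 63))) (.var 62)))
      (.seq computeNext
        (.ite (.var 65)
          (.setNum 60 (.add (.get 27 (.get 23 (.var 63))) (.sub (.var 65) (.lit 1))) (.lit 1))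
          .skip))
      .skip)
    .skip

/-- The three claims about the marks serve different ends: marks are never lost, a new mark is
justified by a link from a marked pair (soundness), and the successor of a marked pair along this
edge is marked (completeness). -/
theorem Env.halts_followEdge (hs : Env T n ne es el et I F s) {b e : ℕ} (hb : s.num 62 0 = b)
    (he : s.num 63 0 = e) (hd : ∀ i < 3 * m, s.num 64 i = (b.testBit i).toNat)
    (hb' : b < 2 ^ (3 * m)) (hes : es e < n) (het : et e < n) :
    Halts followEdge s 400 fun s₂ =>
      Same (fun a => a ≠ 60 ∧ a ≠ 65 ∧ a ≠ 66 ∧ a ≠ 67) s s₂ ∧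
      marked n (2 ^ (3 * m)) (s.num 60) ⊆ marked n (2 ^ (3 * m)) (s₂.num 60) ∧
      (∀ v' ∈ marked n (2 ^ (3 * m)) (s₂.num 60), v' ∈ marked n (2 ^ (3 * m)) (s.num 60) ∨
        ∃ v ∈ marked n (2 ^ (3 * m)) (s.num 60), edgeLink k m es el et e v v') ∧
      ((es e, b) ∈ marked n (2 ^ (3 * m)) (s.num 60) → ∀ v', edgeLink k m es el et e (es e, b) v' →
        v' ∈ marked n (2 ^ (3 * m)) (s₂.num 60)) := by
  refine (Halts.ite (t := 380) ?_ ?_).mono (by simp [NExpr.cost]) fun _ h => h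
  swap
  · intro h1
    simp only [NExpr.eval, he, hs.el_eq, hs.k_eq] at h1
    refine Halts.of_run rfl (by simp [Prog.bound]) ⟨Same.refl _ _, subset_rfl,
      fun v' hv' => .inl hv', fun _ v' hv' => ?_⟩
    have := hv'.2.2.1
    omega
  intro h1
  simp only [NExpr.eval, he, hs.el_eq, hs.k_eq] at h1
  refine (Halts.ite (t := 360) ?_ ?_).mono (by simp [NExpr.cost]) fun _ h => h
  swap
  · intro h2
    simp only [NExpr.eval, he, hb, hs.es_eq, hs.off_eq _ hes.le] at h2
    refine Halts.of_run rfl (by simp [Prog.bound]) ⟨Same.refl _ _, subset_rfl,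
      fun v' hv' => .inl hv', fun hm => absurd h2 hm.2.2⟩
  intro h2
  simp only [NExpr.eval, he, hb, hs.es_eq, hs.off_eq _ hes.le] at h2
  have hm : (es e, b) ∈ marked n (2 ^ (3 * m)) (s.num 60) := ⟨hes, hb', h2⟩
  refine Halts.seq_le 300 60 (hs.halts_computeNext hb he hd) (by omega) fun s₁ ⟨hs₁, h65⟩ => ?_
  have e60 : s₁.num 60 = s.num 60 := (hs₁ 60 (by simp)).1
  have e63 : s₁.num 63 0 = e := by rw [(hs₁ 63 (by simp)).1, he]
  have env := hs.of_same hs₁ (by intro a ha; omega)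
  refine Halts.of_run rfl (by simp [Prog.bound, NExpr.cost]) ?_
  simp only [Prog.run, NExpr.eval, h65, e63, env.et_eq, env.off_eq _ het.le]
  split_ifs with h3
  · rw [e60]
    refine ⟨hs₁.mono (by intro a ha; omega), subset_rfl, fun v' hv' => .inl hv',
      fun _ v' hv' => ?_⟩
    have := hv'.2.2.2
    simp only at this
    omega
  · obtain ⟨b', hb₁, hb₂⟩ : ∃ b', nextPat k m (el e) b = b' + 1 ∧ b' < 2 ^ (3 * m) := by
      rcases nextPat_spec (by omega : k ≤ el e) hb' with ⟨h0, _⟩ | ⟨b', h4, h5, _⟩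
      · exact absurd h0 h3
      · exact ⟨b', h4, h5⟩
    have e4 : nextPat k m (el e) b - 1 = b' := by omega
    rw [e4]
    have hval : ∀ i, (s₁.setNum 60 (et e * 2 ^ (3 * m) + b') 1).num 60 i =
        if i = et e * 2 ^ (3 * m) + b' then 1 else s.num 60 i := by
      intro i
      rw [Store.num_setNum, e60]
      simp
    refine ⟨(hs₁.mono (by intro a ha; omega)).setNum (by simp) _ _, ?_, ?_, ?_⟩
    · rintro v ⟨hv1, hv2, hv3⟩
      refine ⟨hv1, hv2, ?_⟩
      rw [hval]
      split_ifs <;> simp [hv3]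
    · rintro v' ⟨hv1, hv2, hv3⟩
      rw [hval] at hv3
      split_ifs at hv3 with h5
      · obtain ⟨h6, h7⟩ := mul_add_inj hv2 hb₂ h5
        exact .inr ⟨(es e, b), hm, rfl, h6.symm, by omega, by simp only [h7, hb₁]⟩
      · exact .inl ⟨hv1, hv2, hv3⟩
    · rintro - v' ⟨-, h6, -, h7⟩
      have : v'.2 = b' := by simp only at h7; omega
      refine ⟨by omega, by omega, ?_⟩
      rw [hval, ← h6, this]
      simp

/-- Follow all edges once from all marked pairs. -/
def closureRound : Prog :=
  .for 62 numPat (.seq (unpack 64 (.var 62) numBits) (.for 63 (.var 19) followEdge))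

/-- The array is updated in place, so a mark set in a round may be used in the same round, and the
result is not exactly one level of the search. It is enclosed instead: it lies in every closed set
that contains the old marks, and it contains everything reached from them in at most one step. -/
theorem Env.halts_closureRound (hs : Env T n ne es el et I F s)
    (hE : ∀ e < ne, es e < n ∧ et e < n) :
    Halts closureRound s (1418 * (2 ^ (3 * m) * (m + ne + 1))) fun s₂ =>
      Same (fun a => a < 60 ∨ a = 61) s s₂ ∧
      (∀ C : Set (ℕ × ℕ), (∀ v v', v ∈ C → numLink k m ne es el et v v' → v' ∈ C) →
        marked n (2 ^ (3 * m)) (s.num 60) ⊆ C → marked n (2 ^ (3 * m)) (s₂.num 60) ⊆ C) ∧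
      level (numLink k m ne es el et) (marked n (2 ^ (3 * m)) (s.num 60)) 1 ⊆
        marked n (2 ^ (3 * m)) (s₂.num 60) := by
  set P := 2 ^ (3 * m) with hP
  have hPpos : 1 ≤ P := Nat.one_le_two_pow
  set A := marked n P (s.num 60) with hA
  set r := numLink k m ne es el et with hr
  -- The invariant also passes to the inner loop over the edges; the marks present at the start of
  -- the round are fixed as `A`.
  let inv : Store R Ω → Prop := fun s₁ => A ⊆ marked n P (s₁.num 60) ∧
    ∀ C : Set (ℕ × ℕ), (∀ v v', v ∈ C → r v v' → v' ∈ C) → A ⊆ C → marked n P (s₁.num 60) ⊆ C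
  have inv_congr : ∀ s₁ s₂ : Store R Ω, s₂.num 60 = s₁.num 60 → inv s₁ → inv s₂ := by
    intro s₁ s₂ e hi
    simpa only [inv, e] using hi
  set K : ℕ → Prop := fun a => a < 60 ∨ a = 61 with hK
  refine (Halts.forK (K := K) (fun b s₁ => inv s₁ ∧ ∀ b' < b, ∀ p, (p, b') ∈ A → ∀ v',
    r (p, b') v' → v' ∈ marked n P (s₁.num 60)) P 680 (m + ne + 1) (by omega) (by simp [hK]) ?_ ?_ ?_
    ?_).mono ?_ fun s₂ h => ⟨h.1, h.2.1.2, ?_⟩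
  · intro j s₁ i y h
    rw [Store.num_setNum_ne _ _ _ (by decide)]
    exact ⟨inv_congr _ _ (Store.num_setNum_ne _ _ _ (by decide)) h.1, h.2⟩
  · exact ⟨⟨subset_rfl, fun C _ h => h⟩, by simp⟩
  · exact fun s₁ h => (hs.of_same h (by intro a ha; omega)).eval_numPat
  · intro b s₁ hb hss hJ hv
    have env := hs.of_same hss (by intro a ha; omega)
    refine Halts.seq_le (80 * (3 * m + 1)) ((400 + 2 + 20) * ((ne + 1) * 1))
      (env.halts_unpack_pat (by omega) hv hb) ?_ fun s₂ ⟨hs₂, h64⟩ => ?_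
    · ring_nf; omega
    have e60 : s₂.num 60 = s₁.num 60 := (hs₂ 60 (by simp)).1
    have e62 : s₂.num 62 0 = b := by rw [(hs₂ 62 (by simp)).1, hv]
    have env₂ := env.of_same hs₂ (by intro a ha; omega)
    have hJ₂ := inv_congr _ _ e60 hJ.1
    refine (Halts.forK (K := fun a => a < 60 ∨ a = 61 ∨ a = 62 ∨ a = 64) (fun e s₃ => inv s₃ ∧
      marked n P (s₂.num 60) ⊆ marked n P (s₃.num 60) ∧
      ∀ e' < e, (es e', b) ∈ A → ∀ v', edgeLink k m es el et e' (es e', b) v' →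
        v' ∈ marked n P (s₃.num 60)) ne 400 1 le_rfl (by omega) ?_ ?_ ?_ ?_).mono le_rfl
      fun s₃ h => ⟨?_, ?_, ?_, ?_⟩
    · intro j s₁ i y h
      rw [Store.num_setNum_ne _ _ _ (by decide)]
      exact ⟨inv_congr _ _ (Store.num_setNum_ne _ _ _ (by decide)) h.1, h.2⟩
    · exact ⟨hJ₂, subset_rfl, by simp⟩
    · exact fun s₃ h => (env₂.of_same h (by intro a ha; omega)).ne_eq
    · intro e s₃ he hs₃ hJ₃ hv₃
      have env₃ := env₂.of_same hs₃ (by intro a ha; omega)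
      refine (env₃.halts_followEdge (b := b) (e := e) ?_ hv₃ ?_ hb (hE e he).1 (hE e he).2).mono
        (by omega) fun s₄ ⟨h1, h2, h3, h4⟩ => ⟨?_, ?_, ⟨?_, ?_⟩, ?_, ?_⟩
      · rw [(hs₃ 62 (by simp)).1, e62]
      · rw [(hs₃ 64 (by simp)).1]; exact h64
      · rw [(h1 63 (by simp)).1, hv₃]
      · exact h1.mono (by intro a ha; omega)
      · exact hJ₃.1.1.trans h2
      · intro C hC hAC v' hv'
        rcases h3 v' hv' with h5 | ⟨v, hv, hl⟩
        · exact hJ₃.1.2 C hC hAC h5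
        · exact hC v v' (hJ₃.1.2 C hC hAC hv) ⟨e, he, hl⟩
      · exact hJ₃.2.1.trans h2
      · intro e' he' hmem v' hl
        by_cases hee : e' = e
        · subst hee
          exact h4 (hJ₃.1.1 hmem) v' hl
        · exact h2 (hJ₃.2.2 e' (by omega) hmem v' hl)
    · rw [(h.1 62 (by simp)).1, e62]
    · exact (hs₂.mono (by intro a ha; omega)).trans (h.1.mono (by intro a ha; omega))
    · exact h.2.1
    · intro b' hb' p hp v' hl
      by_cases hbb : b' = b
      · subst hbb
        obtain ⟨e, he, h1, h2⟩ := hl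
        simp only at h1
        subst h1
        exact h.2.2.2 e he hp v' ⟨rfl, h2⟩
      · refine h.2.2.1 ?_
        rw [e60]
        exact hJ.2 b' (by omega) p hp v' hl
  · have e1 : ET.numPat.cost = 9 := rfl
    rw [e1]
    -- Since `P + 1 ≤ 2 * P`, the constant `680 + 9 + 20`, where `9` is the cost of `numPat`, is
    -- doubled to `1418`.
    calc (680 + 9 + 20) * ((P + 1) * (m + ne + 1)) ≤ (680 + 9 + 20) * ((2 * P) * (m + ne + 1)) :=
        Nat.mul_le_mul_left _ (Nat.mul_le_mul_right _ (by omega))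
      _ = _ := by ring
  · rintro v (hv | ⟨⟨p, b⟩, hpb, hl⟩)
    · exact h.2.1.1 hv
    · exact h.2.2 b hpb.2.1 p hpb v hl

end Closure

/-! ### The complete search, and the steps of the set automaton. -/

section ClosureProgram

variable {R Ω : Type*} {h k m : ℕ} {T : DSST (Fin h) (RefSym (Fin k) m) R Ω} {n ne : ℕ}
  {es el et I F : ℕ → ℕ} {s s₁ : Store R Ω}

theorem level_subset_level {α : Type*} (r : α → α → Prop) {S S' : Set α} {i : ℕ}
    (hS : level r S i ⊆ S') : level r S (i + 1) ⊆ level r S' 1 := by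
  rintro v (hv | ⟨u, hu, hl⟩)
  · exact .inl (hS hv)
  · exact .inr ⟨u, hS hu, hl⟩

/-- Mark in the array `60` all pairs that are reached from the states marked in the array `40`. -/
def closureProg : Prog :=
  .seq (.for 61 (.get 27 (.var 20)) (.setNum 60 (.var 61) (.lit 0)))
    (.seq (.for 61 (.var 20) (.ite (.get 40 (.var 61))
        (.setNum 60 (.get 27 (.var 61)) (.lit 1)) .skip))
      (.for 61 (.get 27 (.var 20)) closureRound))

theorem Env.halts_closureProg (hs : Env T n ne es el et I F s)
    (hE : ∀ e < ne, es e < n ∧ et e < n) :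
    Halts closureProg s (2000 * ((n + 1) * (2 ^ (3 * m) * (2 ^ (3 * m) * (m + ne + 1))))) fun s₂ =>
      Same (fun a => a < 60) s s₂ ∧ ∀ q < n, ∀ b < 2 ^ (3 * m),
        (s₂.num 60 (q * 2 ^ (3 * m) + b) ≠ 0 ↔
          q ∈ blockSet k (edgeRel ne es el et) {p | p < n ∧ s.num 40 p ≠ 0} (patOf m b)) := by
  set P := 2 ^ (3 * m) with hP
  have hPpos : 1 ≤ P := Nat.one_le_two_pow
  set r := numLink k m ne es el et with hr
  set S₀ : Set (ℕ × ℕ) := {v | v.1 ∈ {p | p < n ∧ s.num 40 p ≠ 0} ∧ v.2 = 0} with hS₀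
  have hbound : ∀ s₁, Same (fun a => a < 60) s s₁ → NExpr.eval s₁ (.get 27 (.var 20)) = n * P := by
    intro s₁ h
    have env := hs.of_same h (by intro a ha; omega)
    simp only [NExpr.eval, env.n_eq]
    exact env.off_eq n le_rfl
  set X := (n + 1) * (P * (P * (m + ne + 1))) with hX
  have hX1 : n * P + 1 ≤ X := by
    have : 1 ≤ P * (m + ne + 1) := Nat.one_le_iff_ne_zero.2 (by positivity)
    calc n * P + 1 ≤ (n + 1) * P * 1 := by nlinarith
      _ ≤ (n + 1) * P * (P * (m + ne + 1)) := Nat.mul_le_mul_left _ this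
      _ = X := by rw [hX]; ring
  have hX2 : (n * P + 1) * (P * (m + ne + 1)) ≤ X := by
    calc (n * P + 1) * (P * (m + ne + 1)) ≤ ((n + 1) * P) * (P * (m + ne + 1)) :=
          Nat.mul_le_mul_right _ (by nlinarith)
      _ = X := by rw [hX]; ring
  refine Halts.seq_le ((6 + 3 + 20) * ((n * P + 1) * 1)) (1800 * X)
    (Halts.forK (K := fun a => a < 60) (fun j s₁ => ∀ i < j, s₁.num 60 i = 0) (n * P) 6 1 le_rfl
      (by omega) ?_ (by simp) hbound ?_) (by omega) ?_
  · intro j s₁ i y h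
    rw [Store.num_setNum_ne _ _ _ (by decide)]
    exact h
  · intro j s₁ hj hss hJ hv
    refine Halts.of_run rfl (by simp [Prog.bound, NExpr.cost])
      ⟨by simp [Prog.run, NExpr.eval, Store.num_setNum, hv], Same.run (by simp [Prog.writes]),
        fun i hi => ?_⟩
    simp only [Prog.run, NExpr.eval, Store.num_setNum, hv, true_and]
    split_ifs with h1
    · rfl
    · exact hJ i (by omega)
  rintro s₁ ⟨hs₁, hz⟩
  refine Halts.seq_le ((20 + 2 + 20) * ((n + 1) * 1)) (1700 * X)
    (Halts.forK (K := fun a => a < 60) (fun j s₂ => ∀ p < n, ∀ b < P,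
      (s₂.num 60 (p * P + b) ≠ 0 ↔ p < j ∧ s.num 40 p ≠ 0 ∧ b = 0)) n 20 1 le_rfl
      (by omega) ?_ ?_ ?_ ?_) ?_ ?_
  · intro j s₁ i y h
    rw [Store.num_setNum_ne _ _ _ (by decide)]
    exact h
  · intro p hp b hb
    have : p * P + b < n * P := by nlinarith
    simp [hz _ this]
  · intro s₂ h
    exact (hs.of_same (hs₁.trans h) (by intro a ha; omega)).n_eq
  · intro j s₂ hj hss hJ hv
    have env := hs.of_same (hs₁.trans hss) (by intro a ha; omega)
    have e40 : s₂.num 40 = s.num 40 := ((hs₁.trans hss) 40 (by omega)).1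
    refine Halts.of_run rfl (by simp [Prog.bound, NExpr.cost])
      ⟨?_, Same.run (by simp [Prog.writes]), fun p hp b hb => ?_⟩
    · simp only [Prog.run, NExpr.eval, hv]
      split_ifs <;> simp [Store.num_setNum, hv]
    · simp only [Prog.run, NExpr.eval, hv, e40, env.off_eq j hj.le]
      split_ifs with h1
      · rw [hJ p hp b hb]
        constructor
        · exact fun h => ⟨by omega, h.2⟩
        · rintro ⟨h2, h3, h4⟩
          refine ⟨?_, h3, h4⟩
          by_contra h5
          have : p = j := by omega
          exact h3 (this ▸ h1)
      · rw [Store.num_setNum]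
        split_ifs with h2
        · have h3 : p * P + b = j * P + 0 := h2.2
          obtain ⟨h4, h5⟩ := mul_add_inj hb (by omega) h3
          simp [h4, h5, h1]
        · rw [hJ p hp b hb]
          constructor
          · exact fun h => ⟨by omega, h.2⟩
          · rintro ⟨h3, h4, h5⟩
            refine ⟨?_, h4, h5⟩
            by_contra h6
            have : p = j := by omega
            exact h2 ⟨rfl, by rw [this, h5, add_zero]⟩
  · have : n + 1 ≤ n * P + 1 := by nlinarith
    omega
  rintro s₂ ⟨hs₂, hm₂⟩
  have hs₂' := hs₁.trans hs₂
  have hmarked : marked n P (s₂.num 60) = S₀ := by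
    ext ⟨p, b⟩
    constructor
    · rintro ⟨h1, h2, h3⟩
      obtain ⟨h4, h5, h6⟩ := (hm₂ p h1 b h2).1 h3
      exact ⟨⟨h1, h5⟩, h6⟩
    · rintro ⟨⟨h1, h2⟩, h3⟩
      simp only at h3
      subst h3
      exact ⟨h1, by omega, (hm₂ p h1 0 (by omega)).2 ⟨h1, h2, rfl⟩⟩
  -- After `j` rounds the marks lie between level `j` of the search and the set `C` of all reachable
  -- pairs.
  set C : Set (ℕ × ℕ) := {v | ∃ u ∈ S₀, Relation.ReflTransGen r u v} with hC
  refine (Halts.forK (K := fun a => a < 60) (fun j s₃ => level r S₀ j ⊆ marked n P (s₃.num 60) ∧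
    marked n P (s₃.num 60) ⊆ C) (n * P) 1418 (P * (m + ne + 1))
    (Nat.one_le_iff_ne_zero.2 (by positivity)) (by omega) ?_ ?_ ?_ ?_).mono ?_ ?_
  · intro j s₁ i y h
    rw [Store.num_setNum_ne _ _ _ (by decide)]
    exact h
  · rw [hmarked]
    exact ⟨subset_rfl, fun v hv => ⟨v, hv, .refl⟩⟩
  · exact fun s₃ h => hbound s₃ (hs₂'.trans h)
  · intro j s₃ hj hss hJ hv
    have env := hs.of_same (hs₂'.trans hss) (by intro a ha; omega)
    refine (env.halts_closureRound hE).mono le_rfl fun s₄ ⟨h1, h2, h3⟩ => ⟨?_, ?_, ?_, ?_⟩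
    · rw [(h1 61 (by omega)).1, hv]
    · exact h1.mono (by intro a ha; omega)
    · exact (level_subset_level r hJ.1).trans h3
    · refine h2 C ?_ hJ.2
      rintro v v' ⟨u, hu, hv⟩ hl
      exact ⟨u, hu, hv.tail hl⟩
  · have e1 : NExpr.cost (.get 27 (.var 20)) = 3 := rfl
    rw [e1]
    calc _ ≤ (1418 + 3 + 20) * X := Nat.mul_le_mul_left _ hX2
      _ ≤ _ := Nat.mul_le_mul_right _ (by omega)
  · rintro s₃ ⟨h1, h2, h3⟩
    refine ⟨hs₂'.trans h1, fun q hq b hb => ?_⟩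
    rw [mem_blockSet_iff hb]
    constructor
    · intro h4
      exact h3 (show (q, b) ∈ marked n P (s₃.num 60) from ⟨hq, hb, h4⟩)
    · rintro ⟨u, hu, h4⟩
      have hV : (Finset.range n ×ˢ Finset.range P).card = n * P := by simp
      -- Links never leave the rectangle of states below `n` and pattern numbers below `P`, whose
      -- size is the number of rounds.
      have h5 : (q, b) ∈ level r S₀ (n * P) := by
        rw [← hV]
        refine level_of_reach _ ?_ ?_ hu h4
        · rintro ⟨p, c⟩ ⟨⟨hp, -⟩, hc⟩
          simp only at hp hc
          simp only [Finset.coe_product, Finset.coe_range, Set.mem_prod, Set.mem_Iio]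
          omega
        · rintro ⟨p, c⟩ ⟨p', c'⟩ hv ⟨e, he, h6, h7, h8, h9⟩
          simp only [Finset.mem_product, Finset.mem_range] at hv h6 h7 h9 ⊢
          refine ⟨h7 ▸ (hE e he).2, ?_⟩
          rcases nextPat_spec h8 hv.2 with ⟨h0, _⟩ | ⟨b₂, h10, hb₂, _⟩
          · omega
          · have : c' = b₂ := by omega
            rw [this]; exact hb₂
      exact (h2 h5).2.2

/-- Mark in the array `40` the states that are reached by the letter in `39` from the states
marked in the array `36`. -/
def letterProg : Prog :=
  .seq (.for 41 (.var 20) (.setNum 40 (.var 41) (.lit 0)))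
    (.for 41 (.var 19)
      -- The sum of the two truncated differences vanishes exactly if the label of the edge is the
      -- letter.
      (.ite (.add (.sub (.get 22 (.var 41)) (.var 39)) (.sub (.var 39) (.get 22 (.var 41)))) .skip
        (.ite (.get 36 (.get 21 (.var 41))) (.setNum 40 (.get 23 (.var 41)) (.lit 1)) .skip)))

theorem Env.halts_letterProg (hs : Env T n ne es el et I F s)
    (hE : ∀ e < ne, es e < n ∧ et e < n) {S a : ℕ} (ha : s.num 39 0 = a)
    (hS : ∀ p < n, s.num 36 p = (S.testBit p).toNat) :
    Halts letterProg s (100 * (n + ne + 1)) fun s₂ =>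
      Same (fun a => a ≠ 40 ∧ a ≠ 41) s s₂ ∧ {p | p < n ∧ s₂.num 40 p ≠ 0} =
        letterSet (edgeRel ne es el et) {p | S.testBit p} a := by
  refine Halts.seq_le ((6 + 2 + 20) * ((n + 1) * 1)) ((50 + 2 + 20) * ((ne + 1) * 1))
    (Halts.forK (K := fun a => a ≠ 40 ∧ a ≠ 41) (fun j s₁ => ∀ i < j, s₁.num 40 i = 0) n 6 1 le_rfl
      (by omega) ?_ (by simp) ?_ ?_) (by omega) ?_
  · intro j s₁ i y h
    rw [Store.num_setNum_ne _ _ _ (by decide)]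
    exact h
  · exact fun s₂ h => (hs.of_same h (by intro a ha; omega)).n_eq
  · intro j s₁ hj hss hJ hv
    refine Halts.of_run rfl (by simp [Prog.bound, NExpr.cost])
      ⟨by simp [Prog.run, NExpr.eval, Store.num_setNum, hv], Same.run (by simp [Prog.writes]),
        fun i hi => ?_⟩
    simp only [Prog.run, NExpr.eval, Store.num_setNum, hv, true_and]
    split_ifs with h1
    · rfl
    · exact hJ i (by omega)
  rintro s₁ ⟨hs₁, hz⟩
  refine (Halts.forK (K := fun a => a ≠ 40 ∧ a ≠ 41) (fun j s₂ => ∀ p < n,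
      (s₂.num 40 p ≠ 0 ↔ ∃ e < j, el e = a ∧ S.testBit (es e) = true ∧ et e = p)) ne 50 1 le_rfl
      (by omega) ?_ ?_ ?_ ?_).mono le_rfl ?_
  · intro j s₁ i y h
    rw [Store.num_setNum_ne _ _ _ (by decide)]
    exact h
  · intro p hp
    simp [hz p hp]
  · exact fun s₂ h => (hs.of_same (hs₁.trans h) (by intro a ha; omega)).ne_eq
  · intro j s₂ hj hss hJ hv
    have hs₂ := hs₁.trans hss
    have env := hs.of_same hs₂ (by intro a ha; omega)
    have e36 : s₂.num 36 = s.num 36 := (hs₂ 36 (by omega)).1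
    have e39 : s₂.num 39 0 = a := by rw [(hs₂ 39 (by omega)).1, ha]
    have hsucc : ∀ p, (∃ e < j + 1, el e = a ∧ S.testBit (es e) = true ∧ et e = p) ↔
        (∃ e < j, el e = a ∧ S.testBit (es e) = true ∧ et e = p) ∨
        (el j = a ∧ S.testBit (es j) = true ∧ et j = p) := by
      intro p
      constructor
      · rintro ⟨e, he, h1⟩
        by_cases h2 : e = j
        · exact .inr (h2 ▸ h1)
        · exact .inl ⟨e, by omega, h1⟩
      · rintro (⟨e, he, h1⟩ | h1)
        · exact ⟨e, by omega, h1⟩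
        · exact ⟨j, by omega, h1⟩
    refine Halts.of_run rfl (by simp [Prog.bound, NExpr.cost])
      ⟨?_, Same.run (by simp [Prog.writes]), fun p hp => ?_⟩
    · rw [(Same.run (K := fun a => a = 41) (by simp [Prog.writes]) 41 rfl).1, hv]
    · rw [hsucc]
      simp only [Prog.run, NExpr.eval, hv, env.el_eq, env.es_eq, env.et_eq, e36, e39,
        hS _ (hE j hj).1, toNat_eq_zero_iff]
      split_ifs with h1 h2
      · rw [hJ p hp, or_iff_left]
        simp [h2]
      · rw [Store.num_setNum]
        split_ifs with h3
        · simp only [ne_eq, one_ne_zero, not_false_eq_true, true_iff]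
          exact .inr ⟨by omega, by simpa using h2, h3.2.symm⟩
        · rw [hJ p hp, or_iff_left]
          rintro ⟨-, -, h4⟩
          exact h3 ⟨rfl, h4.symm⟩
      · rw [hJ p hp, or_iff_left]
        rintro ⟨h4, -⟩
        omega
  · rintro s₂ ⟨h1, h2⟩
    refine ⟨hs₁.trans h1, Set.ext fun p => ⟨?_, ?_⟩⟩
    · rintro ⟨hp, h3⟩
      obtain ⟨e, he, h4, h5, h6⟩ := (h2 p hp).1 h3
      exact ⟨es e, h5, e, he, rfl, h4, h6⟩
    · rintro ⟨p', hp', e, he, rfl, h4, rfl⟩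
      exact ⟨(hE e he).2, (h2 _ (hE e he).2).2 ⟨e, he, h4, hp', rfl⟩⟩

/-- The number of the set of the states that are reached from `S` with the pattern number `b`. -/
noncomputable def blockNumber (k m n ne : ℕ) (es el et : ℕ → ℕ) (S : Set ℕ) (b : ℕ) : ℕ :=
  setNumber n (blockSet k (edgeRel ne es el et) S (patOf m b))

/-- Prepare the pattern in `42`: its digits and the set of the states reached with it. -/
def preparePat : Prog := .seq (unpack 50 (.var 42) numBits) pack

theorem Env.halts_preparePat (hs : Env T n ne es el et I F s) {b : ℕ} (hb : s.num 42 0 = b)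
    (hb' : b < 2 ^ (3 * m)) {S : Set ℕ}
    (hr : ∀ q < n, ∀ b < 2 ^ (3 * m), (s.num 60 (q * 2 ^ (3 * m) + b) ≠ 0 ↔
      q ∈ blockSet k (edgeRel ne es el et) S (patOf m b))) :
    Halts preparePat s (240 * (m + n + 1)) fun s₂ =>
      Same (fun a => a < 80 ∧ a ≠ 50 ∧ a ≠ 51 ∧ a ≠ 52) s s₂ ∧
      (∀ i < 3 * m, s₂.num 50 i = (b.testBit i).toNat) ∧
      s₂.num 51 0 = blockNumber k m n ne es el et S b := by
  classical
  refine Halts.seq_le (80 * (3 * m + 1)) (60 * (n + 1)) (hs.halts_unpack_pat (by omega) hb hb')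
    (by omega) ?_
  rintro s₁ ⟨h1, h2⟩
  have env := hs.of_same h1 (by intro a ha; omega)
  refine (env.halts_pack (b := b) (by rw [(h1 42 (by omega)).1, hb])).mono le_rfl ?_
  rintro s₂ ⟨h3, h4⟩
  refine ⟨(h1.mono (by intro a ha; omega)).trans (h3.mono (by intro a ha; omega)), ?_, ?_⟩
  · rw [(h3 50 (by omega)).1]; exact h2
  · rw [h4, blockNumber, setNumber, setNumber]
    refine Finset.sum_congr rfl fun p hp => ?_
    rw [Finset.mem_range] at hp
    have : p ∈ {p | s₁.num 60 (p * 2 ^ (3 * m) + b) ≠ 0} ↔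
        p ∈ blockSet k (edgeRel ne es el et) S (patOf m b) := by
      rw [← hr p hp b hb', Set.mem_ofPred_eq, (h1 60 (by omega)).1]
    simp only [this]

end ClosureProgram

/-! ### Writing the transitions of the product. -/

section Transitions

variable {R Ω : Type*} {h k m : ℕ} {T : DSST (Fin h) (RefSym (Fin k) m) R Ω} {n ne : ℕ}
  {es el et I F : ℕ → ℕ} {s s₁ : Store R Ω}

theorem mul_succ_le_two_mul {N : ℕ} (hN : 1 ≤ N) (c x : ℕ) :
    c * ((N + 1) * x) ≤ 2 * c * (N * x) := by
  calc c * ((N + 1) * x) ≤ c * ((2 * N) * x) := by gcongr; omega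
    _ = _ := by ring

/-- The transitions that have been written so far. -/
def Store.emitted (s : Store R Ω) : Multiset (ℕ × ℕ × Assignment R Ω × ℕ) :=
  (Multiset.range (s.num 10 1)).map fun j => (s.num 13 j, s.num 14 j, s.asg 13 j, s.num 15 j)

/-- The array `a` does not hold transitions. -/
def NoOutput (a : ℕ) : Prop := a ≠ 10 ∧ a ≠ 13 ∧ a ≠ 14 ∧ a ≠ 15

theorem Store.emitted_of_same {K : ℕ → Prop} (hs : Same K s s₁) (hK : ∀ a, ¬ NoOutput a → K a) :
    s₁.emitted = s.emitted := by
  have e := fun a ha => (hs a (hK a ha)).1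
  have e' := fun a ha => (hs a (hK a ha)).2.1
  unfold emitted
  rw [e 10 (by simp [NoOutput]), e 13 (by simp [NoOutput]), e 14 (by simp [NoOutput]),
    e 15 (by simp [NoOutput]), e' 13 (by simp [NoOutput])]

/-- A loop that writes transitions. -/
theorem Halts.forEmit {K : ℕ → Prop} {v : ℕ} {e : NExpr} {P : Prog}
    (f : ℕ → Multiset (ℕ × ℕ × Assignment R Ω × ℕ)) (N c x : ℕ) (hN1 : 1 ≤ N) (hx : 1 ≤ x)
    (hv : ¬ K v) (hv' : NoOutput v)
    (hN : ∀ s₁, Same K s s₁ → e.eval s₁ = N)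
    (hs : ∀ j s₁, j < N → Same K s s₁ → s₁.num v 0 = j → Halts P s₁ (c * x)
      fun s₂ => s₂.num v 0 = j ∧ Same K s₁ s₂ ∧ s₂.emitted = s₁.emitted + f j) :
    Halts (.for v e P) s (2 * (c + e.cost + 20) * (N * x))
      (fun s₂ => Same K s s₂ ∧ s₂.emitted = s.emitted + ∑ j ∈ Finset.range N, f j) := by
  refine (Halts.forK (K := K) (fun j s₁ => s₁.emitted = s.emitted + ∑ j ∈ Finset.range j, f j)
    N c x hx hv ?_ (by simp) hN ?_).mono (mul_succ_le_two_mul hN1 _ _) fun _ h => h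
  · intro j s₁ i y hJ
    rw [← hJ]
    refine Store.emitted_of_same (K := fun a => a ≠ v)
      ((Same.refl _ _).setNum (by simp) _ _) ?_
    rintro a ha rfl
    exact ha hv'
  · intro j s₁ hj hss hJ hj'
    refine (hs j s₁ hj hss hj').mono le_rfl fun s₂ h2 => ⟨h2.1, h2.2.1, ?_⟩
    rw [h2.2.2, hJ, Finset.sum_range_succ, add_assoc]

/-- Write a transition. -/
def emit (src tgt : NExpr) : Prog :=
  .seq (.setVar 55 tgt) (.seq (.setNum 13 (.get 10 (.lit 1)) src)
    (.seq (.setNum 14 (.get 10 (.lit 1)) (.var 39)) (.seq (.setNum 15 (.get 10 (.lit 1)) (.var 55))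
      (.seq (.setAsg 13 (.get 10 (.lit 1)) (.get 70 (.lit 0)))
        (.setNum 10 (.lit 1) (.add (.get 10 (.lit 1)) (.lit 1)))))))

/-- The target is evaluated first and kept in the variable `55`; the source is evaluated after that,
so it must not depend on this variable. -/
theorem emitted_emit (src tgt : NExpr) (hsrc : ∀ i y, src.eval (s.setNum 55 i y) = src.eval s) :
    ((emit src tgt).run s).emitted =
      s.emitted + {(src.eval s, s.num 39 0, s.asg 70 0, tgt.eval s)} := by
  unfold Store.emitted emit
  simp only [Prog.run, NExpr.eval, AExpr.eval, Store.num_setNum, Store.asg_setAsg, Store.asg_setNum,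
    Store.num_setAsg, hsrc]
  norm_num
  rw [add_comm, Multiset.singleton_add]
  congr 1
  refine Multiset.map_congr rfl fun j hj => ?_
  rw [Multiset.mem_range] at hj
  simp [hj.ne]

/-- The expression for the number of a state. -/
def stateExpr (S b q : NExpr) : NExpr := .add (.add (.get 29 S) (.get 30 b)) q

/-- The number of a state. -/
abbrev stateNum (m h S b q : ℕ) : ℕ := S * (2 ^ (3 * m) * h) + b * h + q

theorem Env.eval_stateExpr (hs : Env T n ne es el et I F s) {S b q : NExpr}
    (hS : S.eval s ≤ 2 ^ n) (hb : b.eval s ≤ 2 ^ (3 * m)) :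
    (stateExpr S b q).eval s = stateNum m h (S.eval s) (b.eval s) (q.eval s) := by
  simp only [stateExpr, NExpr.eval, hs.set_eq _ hS, hs.pat_eq _ hb]

/-- The transitions for a set of states, a letter, a pattern, a state of the DSST, and a
subsequent set of states. -/
noncomputable def numTrans (T : DSST (Fin h) (RefSym (Fin k) m) R Ω) (S a b q S₂ : ℕ) :
    Multiset (ℕ × ℕ × Assignment R Ω × ℕ) :=
  (T.runA (T.entry (q * (k + 2 * m) + a)) ((patOf m b).word (Fin k))).elim 0 fun c =>
    ∑ b' ∈ Finset.range (2 ^ (3 * m)),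
      {(stateNum m h S b' q, a, c.1, stateNum m h S₂ b c.2)}

/-- Write the transitions for the set in `35`, the letter in `39`, the pattern in `42`, the state in
`53` and the subsequent set in `51`. -/
def emitState : Prog :=
  .seq (.setVar 72 (.add (.get 28 (.var 53)) (.var 39)))
    (.seq (.setVar 70 (.get 1 (.var 72))) (.seq (.setAsg 70 (.lit 0) (.get 1 (.var 72)))
      (.seq readPat (.ite (.var 70) (.for 54 numPat
        (emit (stateExpr (.var 35) (.var 54) (.var 53))
          (stateExpr (.var 51) (.var 42) (.sub (.var 70) (.lit 1))))) .skip))))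

/-- The DSST is run once on the pattern, at a cost linear in `m`; the loop over the last patterns
only copies the result into `P` transitions. -/
theorem Env.halts_emitState (hs : Env T n ne es el et I F s) {S a b q S₂ : ℕ}
    (h35 : s.num 35 0 = S) (hS : S < 2 ^ n) (h39 : s.num 39 0 = a) (h42 : s.num 42 0 = b)
    (hb : b < 2 ^ (3 * m)) (h51 : s.num 51 0 = S₂) (hS₂ : S₂ < 2 ^ n) (h53 : s.num 53 0 = q)
    (hq : q < h) (h50 : ∀ i < 3 * m, s.num 50 i = (b.testBit i).toNat) :
    Halts emitState s (700 * (2 ^ (3 * m) * (m + ne + 1))) fun s₂ =>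
      Same (fun a => NoOutput a ∧ a ≠ 54 ∧ a ≠ 55 ∧ a ≠ 70 ∧ a ≠ 71 ∧ a ≠ 72) s s₂ ∧
      s₂.emitted = s.emitted + numTrans T S a b q S₂ := by
  set P := 2 ^ (3 * m) with hP
  have hPpos : 1 ≤ P := Nat.one_le_two_pow
  set K : ℕ → Prop := fun a => NoOutput a ∧ a ≠ 54 ∧ a ≠ 55 ∧ a ≠ 70 ∧ a ≠ 71 ∧ a ≠ 72 with hK
  have hKe : ∀ a, a ≤ 5 ∨ (19 ≤ a ∧ a ≤ 30) → K a := by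
    intro a ha
    simp only [hK, NoOutput]
    omega
  have hX1 : 400 * (m + 1) + 200 * P + 100 ≤ 700 * (P * (m + ne + 1)) := by
    have e1 : m + 1 ≤ P * (m + ne + 1) := by nlinarith
    have e2 : P ≤ P * (m + ne + 1) := by nlinarith
    omega
  refine Halts.seq_le (P := .setVar 72 _) (t := 10) (t₂ := 400 * (m + 1) + 200 * P + 80)
    (Q := fun s₁ => Same (fun a => a ≠ 72) s s₁ ∧ s₁.num 72 0 = q * (k + 2 * m) + a) ?_
    (by omega) ?_
  · refine Halts.of_run rfl (by simp [Prog.bound, NExpr.cost]) ⟨Same.run (by simp [Prog.writes]), ?_⟩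
    simp [Prog.run, NExpr.eval, Store.num_setNum, h53, h39, hs.row_eq q hq.le]
  rintro s₁ ⟨hs₁, h72⟩
  have env₁ := hs.of_same hs₁ (by intro a ha; omega)
  -- The letter is read by a direct look-up and not by `readSym`, so that the run starts with the
  -- assignment of this transition instead of composing it with an earlier one.
  set c₀ := T.entry (q * (k + 2 * m) + a) with hc₀
  set c := T.runA c₀ ((patOf m b).word (Fin k)) with hc
  refine Halts.run_seq (400 * (m + 1) + 200 * P + 70) rfl
    (by simp only [Prog.bound, NExpr.cost]; omega) ?_
  refine Halts.run_seq (400 * (m + 1) + 200 * P + 60) rfl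
    (by simp only [Prog.bound, NExpr.cost, AExpr.cost]; omega) ?_
  set s₂ := (Prog.setAsg 70 (.lit 0) (.get 1 (.var 72))).run
    ((Prog.setVar 70 (.get 1 (.var 72))).run s₁) with hs₂
  have hsame₂ : Same (fun a => a ≠ 70 ∧ a ≠ 72) s s₂ :=
    (hs₁.mono (by intro a ha; omega)).trans ((Same.run (by simp [Prog.writes])).trans
      (Same.run (by simp [Prog.writes])))
  have env₂ := hs.of_same hsame₂ (by intro a ha; omega)
  have hrun : HoldsRun s₂ c₀ := by
    have e1 : s₂.num 70 0 = ((T.entry (q * (k + 2 * m) + a)).map fun e => (e.2 : ℕ) + 1).getD 0 := by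
      simp [hs₂, Prog.run, NExpr.eval, Store.num_setNum, h72, env₁.step_eq, DSST.store]
    have e2 : s₂.asg 70 0 = ((T.entry (q * (k + 2 * m) + a)).map Prod.fst).getD
        (Valuation.empty R Ω).toAssignment := by
      simp [hs₂, Prog.run, NExpr.eval, AExpr.eval, Store.num_setNum, Store.asg_setAsg, h72,
        env₁.asg_eq, DSST.store]
    rw [← hc₀] at e1 e2
    cases hd : c₀ with
    | none =>
      rw [hd] at e1
      exact e1
    | some d =>
      rw [hd] at e1 e2
      exact ⟨e1, e2⟩
  refine Halts.seq_le (400 * (m + 1)) (200 * P + 60) (env₂.halts_readPat hrun (b := b) ?_)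
    (by omega) ?_
  · rw [(hsame₂ 50 (by omega)).1]; exact h50
  rintro s₃ ⟨hs₃, hrun₃⟩
  rw [← hc] at hrun₃
  have hsame₃ : Same (fun a => a ≠ 70 ∧ a ≠ 71 ∧ a ≠ 72) s s₃ :=
    (hsame₂.mono (by intro a ha; omega)).trans hs₃
  have hsame₃' : Same K s s₃ := hsame₃.mono (by intro a ha; simp only [hK] at ha; omega)
  have hem₃ : s₃.emitted = s.emitted := Store.emitted_of_same hsame₃
    (by intro a ha; simp only [NoOutput] at ha; omega)
  have env₃ := hs.of_same hsame₃' hKe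
  refine (Halts.ite (t := 200 * P + 40) ?_ ?_).mono (by simp only [NExpr.cost]; omega) fun _ h => h
  · intro h70
    cases hcc : c with
    | none =>
      rw [hcc] at hrun₃
      exact absurd hrun₃ h70
    | some d =>
      rw [hcc] at hrun₃
      obtain ⟨h70', hasg⟩ := hrun₃
      refine (Halts.forEmit (K := fun a => NoOutput a ∧ a ≠ 54 ∧ a ≠ 55)
        (fun b' => {(stateNum m h S b' q, a, d.1, stateNum m h S₂ b d.2)}) P 60 1 hPpos le_rfl
        (by simp) (by simp [NoOutput]) ?_ ?_).mono (by simp only [NExpr.cost]; omega) ?_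
      · intro s₄ h4
        exact (env₃.of_same h4 (by intro a ha; simp only [NoOutput]; omega)).eval_numPat
      · intro j s₄ hj h4 hv
        have env₄ := env₃.of_same h4 (by intro a ha; simp only [NoOutput]; omega)
        have e := fun a ha hb hc => ((hsame₃ a ha).1.symm.trans (h4 a ⟨hb, hc⟩).1.symm).symm
        have e35 : s₄.num 35 0 = S := by rw [e 35 (by simp) (by simp [NoOutput]) (by simp), h35]
        have e39 : s₄.num 39 0 = a := by rw [e 39 (by simp) (by simp [NoOutput]) (by simp), h39]
        have e42 : s₄.num 42 0 = b := by rw [e 42 (by simp) (by simp [NoOutput]) (by simp), h42]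
        have e51 : s₄.num 51 0 = S₂ := by rw [e 51 (by simp) (by simp [NoOutput]) (by simp), h51]
        have e53 : s₄.num 53 0 = q := by rw [e 53 (by simp) (by simp [NoOutput]) (by simp), h53]
        have e70 : s₄.num 70 0 = d.2 + 1 := by
          rw [(h4 70 ⟨by simp [NoOutput], by simp⟩).1, h70']
        have a70 : s₄.asg 70 0 = d.1 := by
          rw [(h4 70 ⟨by simp [NoOutput], by simp⟩).2.1, hasg]
        refine Halts.of_run rfl (by simp [emit, stateExpr, Prog.bound, NExpr.cost, AExpr.cost])
          ⟨?_, Same.run (by simp [emit, Prog.writes, NoOutput]), ?_⟩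
        · rw [(Same.run (K := fun a => a = 54) (by simp [emit, Prog.writes]) 54 rfl).1, hv]
        · rw [emitted_emit _ _ (by
            intro i y
            simp [stateExpr, NExpr.eval, Store.num_setNum])]
          rw [env₄.eval_stateExpr (by simp only [NExpr.eval, e35]; omega)
            (by simp only [NExpr.eval, hv]; omega),
            env₄.eval_stateExpr (by simp only [NExpr.eval, e51]; omega)
            (by simp only [NExpr.eval, e42]; omega)]
          simp only [NExpr.eval, e35, e39, e42, e51, e53, e70, a70, hv, Nat.add_sub_cancel]
      · rintro s₄ ⟨h4, h5⟩
        refine ⟨hsame₃'.trans (h4.mono (by intro a ha; simp only [hK] at ha; tauto)), ?_⟩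
        rw [h5, hem₃, numTrans, ← hc₀, ← hc, hcc, Option.elim_some]
  · intro h70
    refine Halts.of_run rfl (by simp [Prog.bound]) ⟨hsame₃', ?_⟩
    have hcc : c = none := by
      cases hcc : c with
      | none => rfl
      | some d =>
        rw [hcc] at hrun₃
        have : s₃.num 70 0 = 0 := h70
        rw [hrun₃.1] at this
        omega
    change s₃.emitted = _
    rw [hem₃, numTrans, ← hc₀, ← hc, hcc, Option.elim_none, add_zero]

/-- Write all transitions. -/
def emitAll : Prog :=
  .for 35 numSets (.seq (unpack 36 (.var 35) (.var 20)) (.for 39 (.get 0 (.lit 0))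
    (.seq letterProg (.seq closureProg (.for 42 numPat (.seq preparePat
      (.for 53 (.get 0 (.lit 2)) emitState)))))))

/-- The set of states that is reached from the set number `S` with the letter `a` and the pattern
`b`. -/
noncomputable def nextNumber (k m n ne : ℕ) (es el et : ℕ → ℕ) (S a b : ℕ) : ℕ :=
  blockNumber k m n ne es el et (letterSet (edgeRel ne es el et) {p | S.testBit p} a) b

/-- The search is made once for each set and letter, outside of the loop over the patterns. Its cost
does not exceed that of the inner loops and is absorbed by their bound. -/
theorem Env.halts_emitAll (hs : Env T n ne es el et I F s) (hE : ∀ e < ne, es e < n ∧ et e < n)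
    (hk : 1 ≤ k) :
    Halts emitAll s
      (23300 * (2 ^ n * (k * (2 ^ (3 * m) * ((n + 1) * (h * (2 ^ (3 * m) * (m + ne + 1)))))))) fun s₂ =>
      Same (fun a => NoOutput a ∧ a < 35) s s₂ ∧ s₂.emitted = s.emitted +
        ∑ S ∈ Finset.range (2 ^ n), ∑ a ∈ Finset.range k, ∑ b ∈ Finset.range (2 ^ (3 * m)),
          ∑ q ∈ Finset.range h, numTrans T S a b q (nextNumber k m n ne es el et S a b) := by
  set P := 2 ^ (3 * m) with hP
  set W := 2 ^ n with hW
  have hPpos : 1 ≤ P := Nat.one_le_two_pow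
  have hWpos : 1 ≤ W := Nat.one_le_two_pow
  have hhpos : 1 ≤ h := by have := T.start.2; omega
  set Y := m + ne + 1 with hY
  set V := h * (P * Y) with hV
  set Z := P * ((n + 1) * V) with hZ
  have hYV : Y ≤ V := by
    calc Y = 1 * (1 * Y) := by ring
      _ ≤ _ := by rw [hV]; gcongr
  have hVpos : 1 ≤ V := by omega
  have hnV : n + Y ≤ (n + 1) * V := by nlinarith
  have hVZ : (n + 1) * V ≤ Z := by rw [hZ]; nlinarith
  have hZpos : 1 ≤ Z := by omega
  -- The bound of the search is the bound `Z` of the inner loops without the factor `h`.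
  have hcl : (n + 1) * (P * (P * Y)) ≤ Z := by
    calc (n + 1) * (P * (P * Y)) = P * ((n + 1) * (1 * (P * Y))) := by ring
      _ ≤ Z := by rw [hZ, hV]; gcongr
  have hkZ : Z ≤ k * Z := by nlinarith
  have henv : ∀ {K : ℕ → Prop} {s₁ : Store R Ω}, Same K s s₁ → (∀ a, NoOutput a ∧ a < 35 → K a) →
      Env T n ne es el et I F s₁ := by
    intro K s₁ h1 h2
    exact hs.of_same h1 fun a ha => h2 a (by simp only [NoOutput]; omega)
  -- Each of the four loops turns its constant `c` into `2 * (c + e.cost + 20)`, and what precedes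
  -- the next inner loop is added: from the inside, `700` gives `1500`, with `240` it is `1740`,
  -- which gives `3600`, with `2000` and `100` it is `5700`, which gives `11500`, with `80` at most
  -- `11600`, which gives `23300`.
  refine (Halts.forEmit (K := fun a => NoOutput a ∧ a < 35) (fun S => ∑ a ∈ Finset.range k,
    ∑ b ∈ Finset.range P, ∑ q ∈ Finset.range h,
      numTrans T S a b q (nextNumber k m n ne es el et S a b)) W 11600 (k * Z) hWpos (by omega)
      (by simp) (by simp [NoOutput]) ?_ ?_).mono ?_ fun _ h => h
  · exact fun s₁ h1 => (henv h1 fun _ h => h).eval_numSets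
  swap
  · refine Nat.mul_le_mul_right _ ?_
    simp [NExpr.cost]
  intro S s₁ hS hs₁ h35
  have env₁ := henv hs₁ fun _ h => h
  refine Halts.seq_le (80 * (n + 1)) (11500 * (k * Z)) ((halts_unpack (e := .var 35) (w := .var 20)
    (by omega) (n + 3 * m) S n env₁.half_eq (by omega) h35
    (hS.trans_le (Nat.pow_le_pow_right (by omega) (by omega)))
    (fun s₂ h2 => (env₁.of_same h2 (by intro a ha; omega)).n_eq)).mono
    (Nat.mul_le_mul_right _ (by simp [NExpr.cost])) fun _ h => h) ?_ ?_
  · have : n + 1 ≤ n + Y := by omega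
    omega
  rintro s₂ ⟨hs₂, h36⟩
  have hs₂' : Same (fun a => NoOutput a ∧ a < 35) s s₂ :=
    hs₁.trans (hs₂.mono (by intro a ha; omega))
  have hem₂ : s₂.emitted = s₁.emitted := Store.emitted_of_same hs₂
    (by intro a ha; simp only [NoOutput] at ha; omega)
  have h35₂ : s₂.num 35 0 = S := by rw [(hs₂ 35 (by omega)).1, h35]
  refine (Halts.forEmit (K := fun a => NoOutput a ∧ a < 37) (fun a =>
    ∑ b ∈ Finset.range P, ∑ q ∈ Finset.range h,
      numTrans T S a b q (nextNumber k m n ne es el et S a b)) k 5700 Z hk hZpos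
      (by simp) (by simp [NoOutput]) ?_ ?_).mono ?_ ?_
  · exact fun s₃ h3 =>
      (henv (hs₂'.trans (h3.mono
      (by intro a ha; simp only [NoOutput] at ha ⊢; omega))) fun _ h => h).k_eq
  rotate_left
  · refine Nat.mul_le_mul_right _ ?_
    simp [NExpr.cost]
  · rintro s₃ ⟨h3, h4⟩
    refine ⟨?_, (hs₂.mono (by intro a ha; omega)).trans (h3.mono
      (by intro a ha; simp only [NoOutput] at ha ⊢; omega)), ?_⟩
    · rw [(h3 35 (by simp [NoOutput])).1, h35₂]
    · rw [h4, hem₂]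
  intro a s₃ ha hs₃ h39
  have hs₃' : Same (fun a => NoOutput a ∧ a < 35) s s₃ :=
    hs₂'.trans (hs₃.mono
      (by intro a ha; simp only [NoOutput] at ha ⊢; omega))
  have env₃ := henv hs₃' fun _ h => h
  have h35₃ : s₃.num 35 0 = S := by rw [(hs₃ 35 (by simp [NoOutput])).1, h35₂]
  refine Halts.seq_le (100 * (n + ne + 1)) (5600 * Z) (env₃.halts_letterProg hE (S := S) h39 ?_)
    (by omega) ?_
  · rw [(hs₃ 36 (by simp [NoOutput])).1]; exact h36
  rintro s₄ ⟨hs₄, h40⟩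
  have env₄ := env₃.of_same hs₄ (by intro a ha; omega)
  refine Halts.seq_le (2000 * ((n + 1) * (P * (P * Y)))) (3600 * Z) (env₄.halts_closureProg hE)
    (by omega) ?_
  rintro s₅ ⟨hs₅, h60⟩
  rw [h40] at h60
  have env₅ := env₄.of_same hs₅ (by intro a ha; omega)
  have hs₅' : Same (fun a => a < 40) s₃ s₅ :=
    (hs₄.mono (by intro a ha; omega)).trans (hs₅.mono (by intro a ha; omega))
  have hem₅ : s₅.emitted = s₃.emitted := Store.emitted_of_same hs₅'
    (by intro a ha; simp only [NoOutput] at ha; omega)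
  refine (Halts.forEmit (K := fun a => NoOutput a ∧ (a < 40 ∨ a = 60)) (fun b =>
    ∑ q ∈ Finset.range h,
      numTrans T S a b q (nextNumber k m n ne es el et S a b)) P 1740 ((n + 1) * V) hPpos (by omega)
      (by simp) (by simp [NoOutput]) ?_ ?_).mono ?_ ?_
  · exact fun s₆ h6 =>
      (env₅.of_same h6 (by intro a ha; simp only [NoOutput]; omega)).eval_numPat
  rotate_left
  · refine Nat.mul_le_mul_right _ ?_
    simp [NExpr.cost]
  · rintro s₆ ⟨h6, h7⟩
    refine ⟨?_, (hs₅'.mono (by intro a ha; omega)).trans (h6.mono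
      (by intro a ha; simp only [NoOutput] at ha ⊢; omega)), ?_⟩
    · rw [(h6 39 (by simp [NoOutput])).1, (hs₅' 39 (by omega)).1, h39]
    · rw [h7, hem₅]
  intro b s₆ hb hs₆ h42
  have env₆ := env₅.of_same hs₆ (by intro a ha; simp only [NoOutput]; omega)
  refine Halts.seq_le (240 * (m + n + 1)) (1500 * V) (env₆.halts_preparePat h42 hb
    (S := letterSet (edgeRel ne es el et) {p | S.testBit p} a) ?_) ?_ ?_
  · rw [(hs₆ 60 (by simp [NoOutput])).1]; exact h60
  · have : m + n + 1 ≤ n + Y := by omega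
    have : V ≤ (n + 1) * V := by nlinarith
    omega
  rintro s₇ ⟨hs₇, h50, h51⟩
  have env₇ := env₆.of_same hs₇ (by intro a ha; omega)
  have hem₇ : s₇.emitted = s₆.emitted := Store.emitted_of_same hs₇
    (by intro a ha; simp only [NoOutput] at ha; omega)
  have h42₇ : s₇.num 42 0 = b := by rw [(hs₇ 42 (by omega)).1, h42]
  have h39₇ : s₇.num 39 0 = a := by
    rw [(hs₇ 39 (by omega)).1, (hs₆ 39 (by simp [NoOutput])).1, (hs₅' 39 (by omega)).1, h39]
  have h35₇ : s₇.num 35 0 = S := by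
    rw [(hs₇ 35 (by omega)).1, (hs₆ 35 (by simp [NoOutput])).1, (hs₅' 35 (by omega)).1, h35₃]
  refine (Halts.forEmit
    (K := fun a => NoOutput a ∧ a ≠ 53 ∧ a ≠ 54 ∧ a ≠ 55 ∧ a ≠ 70 ∧ a ≠ 71 ∧ a ≠ 72)
    (fun q => numTrans T S a b q (nextNumber k m n ne es el et S a b)) h 700 (P * Y) hhpos
      (Nat.one_le_iff_ne_zero.2 (by positivity)) (by simp) (by simp [NoOutput]) ?_ ?_).mono ?_ ?_
  · exact fun s₈ h8 => (env₇.of_same h8 (by intro a ha; simp only [NoOutput]; omega)).h_eq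
  rotate_left
  · refine Nat.mul_le_mul_right _ ?_
    simp [NExpr.cost]
  · rintro s₈ ⟨h8, h9⟩
    refine ⟨?_, (hs₇.mono (by intro a ha; omega)).trans (h8.mono
      (by intro a ha; simp only [NoOutput] at ha ⊢; omega)), ?_⟩
    · rw [(h8 42 (by simp [NoOutput])).1, h42₇]
    · rw [h9, hem₇]
  intro q s₈ hq hs₈ h53
  have env₈ := env₇.of_same hs₈ (by intro a ha; simp only [NoOutput]; omega)
  refine (env₈.halts_emitState (S := S) (a := a) (b := b) (q := q)
    (S₂ := nextNumber k m n ne es el et S a b) ?_ hS ?_ ?_ hb ?_ (setNumber_lt _ _) h53 hq ?_).mono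
    le_rfl ?_
  · rw [(hs₈ 35 (by simp [NoOutput])).1, h35₇]
  · rw [(hs₈ 39 (by simp [NoOutput])).1, h39₇]
  · rw [(hs₈ 42 (by simp [NoOutput])).1, h42₇]
  · rw [(hs₈ 51 (by simp [NoOutput])).1, h51]; rfl
  · rw [(hs₈ 50 (by simp [NoOutput])).1]; exact h50
  · rintro s₉ ⟨h9, h10⟩
    refine ⟨?_, h9.mono (by intro a ha; tauto), h10⟩
    rw [(h9 53 (by simp [NoOutput])).1, h53]

end Transitions

section Construction

variable {R Ω : Type*} {h k m : ℕ} {T : DSST (Fin h) (RefSym (Fin k) m) R Ω} {n ne : ℕ}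
  {es el et I F : ℕ → ℕ} {s s₁ : Store R Ω}

/-! #### Initial states -/

/-- The run of the DSST on the first pattern. -/
noncomputable def initRun (T : DSST (Fin h) (RefSym (Fin k) m) R Ω) (b : ℕ) :
    Option (Assignment R Ω × Fin h) :=
  T.runA (some ((Valuation.empty R Ω).toAssignment, T.start)) ((patOf m b).word (Fin k))

/-- The initial states for the patterns less than `j` are written. The function `st` maps a pattern
to the number of the set of the states reached with it. -/
def InitWritten (T : DSST (Fin h) (RefSym (Fin k) m) R Ω) (st : ℕ → ℕ) (j : ℕ) (s : Store R Ω) :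
    Prop :=
  ∀ i, (s.num 11 i = 0 ∧ ∀ b < j, ∀ c, initRun T b = some c → stateNum m h (st b) b c.2 ≠ i) ∨
    (s.num 11 i ≠ 0 ∧ ∃ b < j, ∃ c, initRun T b = some c ∧ stateNum m h (st b) b c.2 = i ∧
      s.asg 11 i = c.1)

theorem InitWritten.of_same {st : ℕ → ℕ} {j : ℕ} (hs : InitWritten T st j s) {K : ℕ → Prop}
    (h : Same K s s₁) (hK : K 11) : InitWritten T st j s₁ := by
  unfold InitWritten at *
  rw [(h 11 hK).1, (h 11 hK).2.1]
  exact hs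

/-- Write the initial state for the pattern in `42`. -/
def writeInitState : Prog :=
  .seq preparePat (.seq (.setVar 70 (.add (.get 0 (.lit 3)) (.lit 1)))
    (.seq (.setAsg 70 (.lit 0) .empty) (.seq readPat
      (.ite (.var 70) (.seq
        (.setVar 55 (stateExpr (.var 51) (.var 42) (.sub (.var 70) (.lit 1))))
        (.seq (.setNum 11 (.var 55) (.lit 1)) (.setAsg 11 (.var 55) (.get 70 (.lit 0))))) .skip))))

/-- Write all initial states. -/
def writeInit : Prog :=
  .seq (.for 41 (.var 20) (.setNum 40 (.var 41) (.get 4 (.var 41))))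
    (.seq closureProg (.for 42 numPat writeInitState))

/-- The number of the set of the states that are reached with the first pattern `b`. -/
noncomputable def startNumber (k m n ne : ℕ) (es el et I : ℕ → ℕ) (b : ℕ) : ℕ :=
  blockNumber k m n ne es el et {p | p < n ∧ I p ≠ 0} b

/-- `InitWritten` records only that each written cell comes from some pattern. That this pattern is
unique is used later and follows from `stateNum_inj`, since the number of a state contains the
pattern. -/
theorem Env.halts_writeInitState (hs : Env T n ne es el et I F s) {b : ℕ} (h42 : s.num 42 0 = b)
    (hb : b < 2 ^ (3 * m))
    (h60 : ∀ q < n, ∀ b < 2 ^ (3 * m), (s.num 60 (q * 2 ^ (3 * m) + b) ≠ 0 ↔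
      q ∈ blockSet k (edgeRel ne es el et) {p | p < n ∧ I p ≠ 0} (patOf m b)))
    (hI : InitWritten T (startNumber k m n ne es el et I) b s) :
    Halts writeInitState s (800 * (m + n + 1)) fun s₂ =>
      Same (fun a => a ≠ 11 ∧ (a < 43 ∨ a = 60)) s s₂ ∧
      InitWritten T (startNumber k m n ne es el et I) (b + 1) s₂ := by
  set st := startNumber k m n ne es el et I with hst
  refine Halts.seq_le (240 * (m + n + 1)) (400 * (m + 1) + 100) (hs.halts_preparePat h42 hb h60)
    (by omega) ?_
  rintro s₁ ⟨hs₁, h50, h51⟩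
  change s₁.num 51 0 = st b at h51
  have env₁ := hs.of_same hs₁ (by intro a ha; omega)
  refine Halts.run_seq (400 * (m + 1) + 90) rfl
    (by simp only [Prog.bound, NExpr.cost]; omega) ?_
  refine Halts.run_seq (400 * (m + 1) + 80) rfl
    (by simp only [Prog.bound, NExpr.cost, AExpr.cost]; omega) ?_
  set s₂ := (Prog.setAsg 70 (.lit 0) .empty).run
    ((Prog.setVar 70 (.add (.get 0 (.lit 3)) (.lit 1))).run s₁) with hs₂
  have hsame₂ : Same (fun a => a ≠ 70) s₁ s₂ :=
    (Same.run (by simp [Prog.writes])).trans (Same.run (by simp [Prog.writes]))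
  have env₂ := env₁.of_same hsame₂ (by intro a ha; omega)
  have hrun : HoldsRun s₂ (some ((Valuation.empty R Ω).toAssignment, T.start)) := by
    constructor
    · simp [hs₂, Prog.run, NExpr.eval, Store.num_setNum, env₁.start_eq]
    · simp [hs₂, Prog.run, NExpr.eval, AExpr.eval, Store.asg_setAsg]
  refine Halts.seq_le (400 * (m + 1)) 80 (env₂.halts_readPat hrun (b := b) ?_)
    (by omega) ?_
  · rw [(hsame₂ 50 (by omega)).1]; exact h50
  rintro s₃ ⟨hs₃, hrun₃⟩
  have hsame₃ : Same (fun a => a < 70 ∧ a ≠ 50 ∧ a ≠ 51 ∧ a ≠ 52) s s₃ :=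
    (hs₁.mono (by intro a ha; omega)).trans
      ((hsame₂.mono (by intro a ha; omega)).trans (hs₃.mono (by intro a ha; omega)))
  have env₃ := hs.of_same hsame₃ (by intro a ha; omega)
  have h51₃ : s₃.num 51 0 = st b := by
    rw [(hs₃ 51 (by omega)).1, (hsame₂ 51 (by omega)).1, h51]
  have h42₃ : s₃.num 42 0 = b := by rw [(hsame₃ 42 (by omega)).1, h42]
  have hI₃ := hI.of_same hsame₃ (by omega)
  have hst_lt : st b < 2 ^ n := setNumber_lt _ _
  change HoldsRun s₃ (initRun T b) at hrun₃
  refine (Halts.ite (t := 70) ?_ ?_).mono (by simp [NExpr.cost]) fun _ h => h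
  · intro h70
    cases hc : initRun T b with
    | none =>
      rw [hc] at hrun₃
      exact absurd hrun₃ h70
    | some d =>
      rw [hc] at hrun₃
      obtain ⟨e70, a70⟩ := hrun₃
      refine Halts.of_run rfl (by simp [stateExpr, Prog.bound, NExpr.cost, AExpr.cost])
        ⟨(hsame₃.mono (by intro a ha; omega)).trans (Same.run (by simp [Prog.writes])), ?_⟩
      have hidx : (stateExpr (.var 51) (.var 42) (.sub (.var 70) (.lit 1))).eval s₃ =
          stateNum m h (st b) b d.2 := by
        rw [env₃.eval_stateExpr (by simp only [NExpr.eval, h51₃]; omega)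
          (by simp only [NExpr.eval, h42₃]; omega)]
        simp only [NExpr.eval, h51₃, h42₃, e70, Nat.add_sub_cancel]
      intro i
      set P₁ := Prog.seq (.setVar 55 (stateExpr (.var 51) (.var 42) (.sub (.var 70) (.lit 1))))
        (.seq (.setNum 11 (.var 55) (.lit 1)) (.setAsg 11 (.var 55) (.get 70 (.lit 0)))) with hP₁
      have hn : (P₁.run s₃).num 11 i =
          if i = stateNum m h (st b) b d.2 then 1 else s₃.num 11 i := by
        simp [hP₁, Prog.run, NExpr.eval, Store.num_setNum, hidx]
      have ha : (P₁.run s₃).asg 11 i =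
          if i = stateNum m h (st b) b d.2 then d.1 else s₃.asg 11 i := by
        simp [hP₁, Prog.run, NExpr.eval, AExpr.eval, Store.num_setNum, Store.asg_setAsg, hidx, a70]
      rw [hn, ha]
      by_cases hi : i = stateNum m h (st b) b d.2
      · exact .inr ⟨by simp [hi], b, by omega, d, hc, hi.symm, by simp [hi]⟩
      · rw [if_neg hi, if_neg hi]
        rcases hI₃ i with ⟨h1, h2⟩ | ⟨h1, b', hb', c, h2⟩
        · refine .inl ⟨h1, fun b' hb' c hcc => ?_⟩
          rcases Nat.lt_succ_iff_lt_or_eq.1 hb' with h3 | rfl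
          · exact h2 b' h3 _ hcc
          · rw [hc] at hcc
            obtain rfl := Option.some.inj hcc
            exact fun h => hi h.symm
        · exact .inr ⟨h1, b', by omega, c, h2⟩
  · intro h70
    have hc : initRun T b = none := by
      cases hcc : initRun T b with
      | none => rfl
      | some d =>
        rw [hcc] at hrun₃
        have : s₃.num 70 0 = 0 := h70
        rw [hrun₃.1] at this
        omega
    refine Halts.of_run rfl (by simp [Prog.bound])
      ⟨hsame₃.mono (by intro a ha; omega), fun i => ?_⟩
    change (s₃.num 11 i = 0 ∧ _) ∨ _
    rcases hI₃ i with ⟨h1, h2⟩ | ⟨h1, b', hb', c, h2⟩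
    · refine .inl ⟨h1, fun b' hb' c hcc => ?_⟩
      rcases Nat.lt_succ_iff_lt_or_eq.1 hb' with h3 | rfl
      · exact h2 b' h3 _ hcc
      · rw [hc] at hcc
        exact absurd hcc (by simp)
    · exact .inr ⟨h1, b', by omega, c, h2⟩

/-- Array `11` is never cleared by the program, so states that are not initial rely on the zeros of
the given memory. -/
theorem Env.halts_writeInit (hs : Env T n ne es el et I F s) (hE : ∀ e < ne, es e < n ∧ et e < n)
    (h11 : ∀ i, s.num 11 i = 0) :
    Halts writeInit s (4000 * ((n + 1) * (2 ^ (3 * m) * (2 ^ (3 * m) * (m + ne + 1))))) fun s₂ =>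
      Same (fun a => a ≠ 11 ∧ a < 40) s s₂ ∧
      InitWritten T (startNumber k m n ne es el et I) (2 ^ (3 * m)) s₂ := by
  set P := 2 ^ (3 * m) with hP
  have hPpos : 1 ≤ P := Nat.one_le_two_pow
  set Y := m + ne + 1 with hY
  set X := (n + 1) * (P * (P * Y)) with hX
  have hYP : P * Y ≤ P * (P * Y) := Nat.le_mul_of_pos_left _ hPpos
  have hXP : P * (m + n + 1) ≤ X := by
    calc P * (m + n + 1) ≤ P * ((n + 1) * Y) := by gcongr; nlinarith
      _ = (n + 1) * (1 * (P * Y)) := by ring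
      _ ≤ X := by rw [hX]; gcongr
  have hXn : n + 1 ≤ X := by nlinarith
  refine Halts.seq_le ((10 + 2 + 20) * ((n + 1) * 1)) (3900 * X)
    (Halts.forK (K := fun a => a ≠ 40 ∧ a ≠ 41) (fun j s₁ => ∀ p < j, s₁.num 40 p = I p) n 10 1
      le_rfl (by simp) ?_ (by simp) ?_ ?_) (by omega) ?_
  · intro j s₁ i y h p hp
    rw [Store.num_setNum_ne _ _ _ (by decide), h p hp]
  · exact fun s₁ h1 => (hs.of_same h1 (by intro a ha; omega)).n_eq
  · intro j s₁ hj hss hJ hv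
    have env := hs.of_same hss (by intro a ha; omega)
    refine Halts.of_run rfl (by simp [Prog.bound, NExpr.cost])
      ⟨by simp [Prog.run, NExpr.eval, Store.num_setNum, hv], Same.run (by simp [Prog.writes]),
        fun i hi => ?_⟩
    simp only [Prog.run, NExpr.eval, Store.num_setNum, hv, true_and, env.init_eq]
    split_ifs with h1
    · rw [h1]
    · exact hJ i (by omega)
  rintro s₁ ⟨hs₁, h40⟩
  have env₁ := hs.of_same hs₁ (by intro a ha; omega)
  refine Halts.seq_le (2000 * X) (1800 * X) (env₁.halts_closureProg hE) (by omega) ?_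
  rintro s₂ ⟨hs₂, h60⟩
  have hset : {p | p < n ∧ s₁.num 40 p ≠ 0} = {p | p < n ∧ I p ≠ 0} := by
    ext p
    refine and_congr_right fun hp => ?_
    rw [h40 p hp]
  rw [hset] at h60
  have env₂ := env₁.of_same hs₂ (by intro a ha; omega)
  have hs₂' : Same (fun a => a < 40) s s₂ :=
    (hs₁.mono (by intro a ha; omega)).trans (hs₂.mono (by intro a ha; omega))
  refine (Halts.forK (K := fun a => a ≠ 11 ∧ (a < 42 ∨ a = 60)) (fun j s₃ =>
    InitWritten T (startNumber k m n ne es el et I) j s₃) P 800 (m + n + 1) (by omega) (by simp)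
    ?_ ?_ ?_ ?_).mono ?_ ?_
  · intro j s₃ i y h
    exact h.of_same (K := fun a => a = 11) ((Same.refl _ _).setNum (by simp) _ _) rfl
  · intro i
    refine .inl ⟨by rw [(hs₂' 11 (by omega)).1, h11], by simp⟩
  · exact fun s₃ h3 => (env₂.of_same h3 (by intro a ha; omega)).eval_numPat
  · intro j s₃ hj hss hJ hv
    have env₃ := env₂.of_same hss (by intro a ha; omega)
    refine (env₃.halts_writeInitState hv hj ?_ hJ).mono le_rfl ?_
    · rw [(hss 60 (by omega)).1]; exact h60
    · rintro s₄ ⟨h4, h5⟩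
      exact ⟨by rw [(h4 42 (by omega)).1, hv], h4.mono (by intro a ha; omega), h5⟩
  · refine (mul_succ_le_two_mul hPpos _ _).trans ?_
    refine Nat.mul_le_mul ?_ hXP
    simp [NExpr.cost]
  · rintro s₃ ⟨h3, h4⟩
    exact ⟨(hs₂'.mono (by intro a ha; omega)).trans (h3.mono (by intro a ha; omega)), h4⟩

/-! #### The final function -/

/-- Find out whether the set whose bits are in the array `36` contains an accepting state. -/
def testFinal : Prog :=
  .seq (.setVar 37 (.lit 0)) (.for 38 (.var 20) (.ite (.get 36 (.var 38))
    (.ite (.get 5 (.var 38)) (.setVar 37 (.lit 1)) .skip) .skip))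

/-- The set with number `S` contains an accepting state. -/
def AcceptingSet (n : ℕ) (F : ℕ → ℕ) (S : ℕ) : Prop := ∃ p < n, S.testBit p = true ∧ F p ≠ 0

theorem Env.halts_testFinal (hs : Env T n ne es el et I F s) {S : ℕ}
    (h36 : ∀ i < n, s.num 36 i = (S.testBit i).toNat) :
    Halts testFinal s (60 * (n + 1)) fun s₂ => Same (fun a => a ≠ 37 ∧ a ≠ 38) s s₂ ∧
      (s₂.num 37 0 ≠ 0 ↔ AcceptingSet n F S) := by
  have h0 : Same (fun a => a ≠ 37 ∧ a ≠ 38) s (s.setNum 37 0 0) :=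
    (Same.refl _ s).setNum (by simp) _ _
  refine Halts.run_seq ((20 + 2 + 20) * ((n + 1) * 1)) rfl ?_ ?_
  · simp only [Prog.bound, NExpr.cost]
    omega
  refine (Halts.forK (K := fun a => a ≠ 37 ∧ a ≠ 38) (fun j s₁ => s₁.num 37 0 ≠ 0 ↔
    AcceptingSet j F S) n 20 1 le_rfl (by simp) ?_ ?_ ?_ ?_).mono
      le_rfl fun s₂ h => ⟨h0.trans h.1, h.2⟩
  · intro j s₁ i y h
    rw [Store.num_setNum_ne _ _ _ (by decide)]
    exact h
  · simp [Prog.run, NExpr.eval, Store.num_setNum, AcceptingSet]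
  · exact fun s₁ h1 => (hs.of_same (h0.trans h1) (by intro a ha; omega)).n_eq
  · intro j s₁ hj hss hJ hv
    have hss' := h0.trans hss
    have env := hs.of_same hss' (by intro a ha; omega)
    have e36 : s₁.num 36 j = (S.testBit j).toNat := by rw [(hss' 36 (by omega)).1, h36 j hj]
    have hsucc : AcceptingSet (j + 1) F S ↔
        AcceptingSet j F S ∨ (S.testBit j = true ∧ F j ≠ 0) := by
      constructor
      · rintro ⟨p, hp, h1⟩
        rcases Nat.lt_succ_iff_lt_or_eq.1 hp with h2 | rfl
        · exact .inl ⟨p, h2, h1⟩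
        · exact .inr h1
      · rintro (⟨p, hp, h1⟩ | h1)
        · exact ⟨p, by omega, h1⟩
        · exact ⟨j, by omega, h1⟩
    refine Halts.of_run rfl (by simp [Prog.bound, NExpr.cost])
      ⟨?_, Same.run (by simp [Prog.writes]), ?_⟩
    · rw [(Same.run (K := fun a => a = 38) (by simp [Prog.writes]) 38 rfl).1, hv]
    · rw [hsucc]
      simp only [Prog.run, NExpr.eval, hv, e36, env.acc_eq, toNat_eq_zero_iff]
      split_ifs with h1 h2
      · rw [hJ, or_iff_left]
        simp [h1]
      · rw [hJ, or_iff_left]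
        simp [h2]
      · simp only [Store.num_setNum, and_self, if_true, ne_eq, one_ne_zero, not_false_eq_true,
          true_iff]
        exact .inr ⟨by simpa using h1, h2⟩

open Classical in
/-- The final function is written for the states with numbers less than `j`. -/
def FinalWritten (T : DSST (Fin h) (RefSym (Fin k) m) R Ω) (n : ℕ) (F : ℕ → ℕ) (j : ℕ)
    (s : Store R Ω) : Prop :=
  ∀ i < j, s.num 12 i =
    (if AcceptingSet n F (i / (2 ^ (3 * m) * h)) then T.store.num 2 (i % h) else 0) ∧
    s.str 12 i = T.store.str 2 (i % h)

theorem FinalWritten.of_same {j : ℕ} (hs : FinalWritten T n F j s) {K : ℕ → Prop}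
    (h : Same K s s₁) (hK : K 12) : FinalWritten T n F j s₁ := by
  unfold FinalWritten at *
  rw [(h 12 hK).1, (h 12 hK).2.2]
  exact hs

theorem stateNum_div {S b q : ℕ} (hb : b < 2 ^ (3 * m)) (hq : q < h) :
    stateNum m h S b q / (2 ^ (3 * m) * h) = S := by
  have h1 : b * h + q < 2 ^ (3 * m) * h := by
    calc b * h + q < (b + 1) * h := by nlinarith
      _ ≤ _ := Nat.mul_le_mul_right _ hb
  rw [stateNum, add_assoc, mul_comm, Nat.mul_add_div (by omega), Nat.div_eq_of_lt h1, add_zero]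

theorem stateNum_mod {S b q : ℕ} (hq : q < h) : stateNum m h S b q % h = q := by
  have : stateNum m h S b q = h * (S * 2 ^ (3 * m) + b) + q := by rw [stateNum]; ring
  rw [this, Nat.mul_add_mod, Nat.mod_eq_of_lt hq]

/-- Write the final function. -/
def writeFinal : Prog :=
  .for 35 numSets (.seq (unpack 36 (.var 35) (.var 20)) (.seq testFinal
    (.for 54 numPat (.for 53 (.get 0 (.lit 2))
      (.seq (.setVar 55 (stateExpr (.var 35) (.var 54) (.var 53)))
        (.seq (.ite (.var 37) (.setNum 12 (.var 55) (.get 2 (.var 53)))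
            (.setNum 12 (.var 55) (.lit 0)))
          (.setStr 12 (.var 55) 2 (.var 53))))))))

/-- The nested loops visit the states in the order of their numbers, so the invariant is simply that
all smaller numbers are done; set and state of the DSST are recovered from a number by division. A
string is also written for states where the final function is undefined, which does no harm. -/
theorem Env.halts_writeFinal (hs : Env T n ne es el et I F s) :
    Halts writeFinal s (1000 * (2 ^ n * ((n + 1) * (2 ^ (3 * m) * h)))) fun s₂ =>
      Same (fun a => a ≠ 12 ∧ a < 35) s s₂ ∧
      FinalWritten T n F (2 ^ n * (2 ^ (3 * m) * h)) s₂ := by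
  classical
  set P := 2 ^ (3 * m) with hP
  have hPpos : 1 ≤ P := Nat.one_le_two_pow
  have hWpos : 1 ≤ 2 ^ n := Nat.one_le_two_pow
  have hhpos : 1 ≤ h := by have := T.start.2; omega
  have hX : P * h ≤ (n + 1) * (P * h) := Nat.le_mul_of_pos_left _ (by omega)
  have hX1 : 1 ≤ P * h := by nlinarith
  have hX2 : n + 1 ≤ (n + 1) * (P * h) := by nlinarith
  refine (Halts.forK (K := fun a => a ≠ 12 ∧ a < 35) (fun j s₁ =>
    FinalWritten T n F (j * (P * h)) s₁) (2 ^ n) 450 ((n + 1) * (P * h)) (by omega) (by simp)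
    ?_ (by simp [FinalWritten]) ?_ ?_).mono ?_ fun _ h => h
  · intro j s₃ i y h
    exact h.of_same (K := fun a => a = 12) ((Same.refl _ _).setNum (by simp) _ _) rfl
  · exact fun s₁ h1 => (hs.of_same h1 (by intro a ha; omega)).eval_numSets
  swap
  · refine (mul_succ_le_two_mul hWpos _ _).trans ?_
    exact Nat.mul_le_mul_right _ (by simp [NExpr.cost])
  intro S s₁ hS hs₁ hJ h35
  have env₁ := hs.of_same hs₁ (by intro a ha; omega)
  refine Halts.seq_le (80 * (n + 1)) (360 * ((n + 1) * (P * h)))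
    ((halts_unpack (e := .var 35) (w := .var 20)
    (by omega) (n + 3 * m) S n env₁.half_eq (by omega) h35
    (hS.trans_le (Nat.pow_le_pow_right (by omega) (by omega)))
    (fun s₂ h2 => (env₁.of_same h2 (by intro a ha; omega)).n_eq)).mono
    (Nat.mul_le_mul_right _ (by simp [NExpr.cost])) fun _ h => h) (by omega) ?_
  rintro s₂ ⟨hs₂, h36⟩
  have env₂ := env₁.of_same hs₂ (by intro a ha; omega)
  refine Halts.seq_le (60 * (n + 1)) (300 * (P * h)) (env₂.halts_testFinal h36) (by omega) ?_
  rintro s₃ ⟨hs₃, h37⟩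
  have env₃ := env₂.of_same hs₃ (by intro a ha; omega)
  have hs₃' : Same (fun a => a < 36) s₁ s₃ :=
    (hs₂.mono (by intro a ha; omega)).trans (hs₃.mono (by intro a ha; omega))
  have h35₃ : s₃.num 35 0 = S := by rw [(hs₃' 35 (by omega)).1, h35]
  refine (Halts.forK (K := fun a => a ≠ 12 ∧ a < 53) (fun b s₄ =>
    FinalWritten T n F (S * (P * h) + b * h) s₄) P 120 h hhpos (by simp)
    ?_ ?_ ?_ ?_).mono ?_ ?_
  · intro j s₃ i y h
    exact h.of_same (K := fun a => a = 12) ((Same.refl _ _).setNum (by simp) _ _) rfl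
  · simpa using hJ.of_same hs₃' (by omega)
  · exact fun s₁ h1 => (env₃.of_same h1 (by intro a ha; omega)).eval_numPat
  rotate_left
  · refine (mul_succ_le_two_mul hPpos _ _).trans ?_
    exact Nat.mul_le_mul_right _ (by simp [NExpr.cost])
  · rintro s₄ ⟨h4, h5⟩
    refine ⟨by rw [(h4 35 (by omega)).1, h35₃],
      (hs₃'.mono (by intro a ha; omega)).trans (h4.mono (by intro a ha; omega)), ?_⟩
    rwa [show (S + 1) * (P * h) = S * (P * h) + P * h by ring]
  intro b s₄ hb hs₄ hJ₄ h54
  have env₄ := env₃.of_same hs₄ (by intro a ha; omega)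
  refine (Halts.forK (K := fun a => a ≠ 12 ∧ (a < 53 ∨ a = 54)) (fun q s₅ =>
    FinalWritten T n F (stateNum m h S b q) s₅) h 35 1 le_rfl (by simp)
    ?_ ?_ ?_ ?_).mono ?_ ?_
  · intro j s₃ i y h
    exact h.of_same (K := fun a => a = 12) ((Same.refl _ _).setNum (by simp) _ _) rfl
  · simpa using hJ₄
  · exact fun s₁ h1 => (env₄.of_same h1 (by intro a ha; omega)).h_eq
  rotate_left
  · refine (mul_succ_le_two_mul hhpos _ _).trans ?_
    rw [mul_one]
    exact Nat.mul_le_mul_right _ (by simp [NExpr.cost])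
  · rintro s₅ ⟨h5, h6⟩
    refine ⟨by rw [(h5 54 (by omega)).1, h54], h5.mono (by intro a ha; omega), ?_⟩
    rwa [show S * (P * h) + (b + 1) * h = stateNum m h S b h by rw [stateNum]; ring]
  intro q s₅ hq hs₅ hJ₅ h53
  have env₅ := env₄.of_same hs₅ (by intro a ha; omega)
  have e35 : s₅.num 35 0 = S := by rw [(hs₅ 35 (by omega)).1, (hs₄ 35 (by omega)).1, h35₃]
  have e54 : s₅.num 54 0 = b := by rw [(hs₅ 54 (by omega)).1, h54]
  have e37 : s₅.num 37 0 = 0 ↔ ¬ AcceptingSet n F S := by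
    rw [← h37, not_not, (hs₅ 37 (by omega)).1, (hs₄ 37 (by omega)).1]
  have hidx : (stateExpr (.var 35) (.var 54) (.var 53)).eval s₅ = stateNum m h S b q := by
    rw [env₅.eval_stateExpr (by simp only [NExpr.eval, e35]; omega)
      (by simp only [NExpr.eval, e54]; omega)]
    simp only [NExpr.eval, e35, e54, h53]
  refine Halts.of_run rfl (by simp [stateExpr, Prog.bound, NExpr.cost])
    ⟨?_, Same.run (by simp [Prog.writes]), fun i hi => ?_⟩
  · rw [(Same.run (K := fun a => a = 53) (by simp [Prog.writes]) 53 rfl).1, h53]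
  · have hi' : i < stateNum m h S b q ∨ i = stateNum m h S b q := by
      simp only [stateNum] at hi ⊢
      omega
    set P₁ := Prog.seq (.setVar 55 (stateExpr (.var 35) (.var 54) (.var 53)))
        (.seq (.ite (.var 37) (.setNum 12 (.var 55) (.get 2 (.var 53)))
            (.setNum 12 (.var 55) (.lit 0)))
          (.setStr 12 (.var 55) 2 (.var 53))) with hP₁
    have hn : (P₁.run s₅).num 12 i = if i = stateNum m h S b q then
        (if AcceptingSet n F S then T.store.num 2 q else 0) else s₅.num 12 i := by
      by_cases hA : s₅.num 37 0 = 0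
      · simp [hP₁, Prog.run, NExpr.eval, Store.num_setNum, hidx, hA, e37.1 hA]
      · have hA' : AcceptingSet n F S := by rwa [e37, not_not] at hA
        simp [hP₁, Prog.run, NExpr.eval, Store.num_setNum, hidx, hA, hA', h53, env₅.final_eq]
    have hstr : (P₁.run s₅).str 12 i = if i = stateNum m h S b q then
        T.store.str 2 q else s₅.str 12 i := by
      by_cases hA : s₅.num 37 0 = 0 <;>
        simp [hP₁, Prog.run, NExpr.eval, Store.num_setNum, Store.str_setStr, hidx, hA, h53,
          env₅.str_eq]
    rw [hn, hstr]
    rcases hi' with h1 | h1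
    · rw [if_neg h1.ne, if_neg h1.ne]
      exact hJ₅ i h1
    · rw [if_pos h1, if_pos h1, h1, stateNum_div hb hq, stateNum_mod hq]
      exact ⟨rfl, rfl⟩

/-! #### The tables -/

/-- Compute all tables. -/
def makeTables : Prog :=
  .seq (powTable (.add (.var 20) numBits))
    (.seq (halfTable (.get 24 (.add (.var 20) numBits)))
      (.seq (mulTable 27 (.var 20) numPat)
        (.seq (mulTable 28 (.get 0 (.lit 2))
            (.add (.get 0 (.lit 0)) (.add (.get 0 (.lit 1)) (.get 0 (.lit 1)))))
          (.seq (mulTable 30 numPat (.get 0 (.lit 2)))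
            -- Cell `2 ^ (3 * m)` of array `30` is the product `2 ^ (3 * m) * h`; hence array `30`
            -- is filled before array `29`.
            (mulTable 29 numSets (.get 30 numPat))))))

/-- Each table supplies the bounds and summands of later ones, beginning with the powers of two. The
largest is that of the halves, with `2 ^ (n + 3 * m)` entries, enough for numbers of sets and of
patterns alike. -/
theorem Loaded.halts_makeTables (hs : Loaded T n ne es el et I F s) :
    Halts makeTables s (1000 * (2 ^ n * (2 ^ (3 * m) * h))) fun s₂ =>
      Same (fun a => a < 24) s s₂ ∧ Env T n ne es el et I F s₂ := by
  set P := 2 ^ (3 * m) with hP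
  have hPpos : 1 ≤ P := Nat.one_le_two_pow
  have hWpos : 1 ≤ 2 ^ n := Nat.one_le_two_pow
  have hhpos : 1 ≤ h := by have := T.start.2; omega
  have hnW : n < 2 ^ n := Nat.lt_two_pow_self
  have hbP : 3 * m < P := Nat.lt_two_pow_self
  set X := 2 ^ n * (P * h) with hX
  have hPX : P * h ≤ X := by rw [hX]; nlinarith
  have hpX : P ≤ X := by nlinarith
  have hhX : h ≤ X := by nlinarith
  have hWPX : 2 ^ n * P ≤ X := by
    rw [hX, ← mul_assoc]
    nlinarith [Nat.zero_le (2 ^ n * P)]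
  have hWX : 2 ^ n ≤ X := by nlinarith
  have hbits : ∀ {s₁ : Store R Ω}, Loaded T n ne es el et I F s₁ → numBits.eval s₁ = 3 * m := by
    intro s₁ h1
    simp only [NExpr.eval, h1.m_eq]
    omega
  refine Halts.seq_le (t := 80 * (n + 3 * m + 1)) (t₂ := 840 * X)
    ((halts_powTable (n + 3 * m) ?_).mono (Nat.mul_le_mul_right _ (by simp [NExpr.cost]))
      fun _ h => h) (by omega) ?_
  · intro s₁ h1
    have := hs.of_same h1 (by intro a ha; omega)
    change s₁.num 20 0 + numBits.eval s₁ = _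
    rw [this.n_eq, hbits this]
  rintro s₁ ⟨hs₁, h24⟩
  have l₁ := hs.of_same hs₁ (by intro a ha; omega)
  have hpat : ∀ {s₂ : Store R Ω}, Loaded T n ne es el et I F s₂ → s₂.num 24 = s₁.num 24 →
      numPat.eval s₂ = P := by
    intro s₂ h1 h2
    change s₂.num 24 (numBits.eval s₂) = P
    rw [hbits h1, h2, h24 _ (by omega)]
  refine Halts.seq_le (t := 95 * (2 ^ (n + 3 * m) + 1)) (t₂ := 640 * X)
    ((halts_halfTable (2 ^ (n + 3 * m)) ?_).mono (Nat.mul_le_mul_right _ (by simp [NExpr.cost]))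
      fun _ h => h) (by rw [pow_add, ← hP]; omega) ?_
  · intro s₂ h2
    have := l₁.of_same h2 (by intro a ha; omega)
    change s₂.num 24 (s₂.num 20 0 + numBits.eval s₂) = _
    rw [this.n_eq, hbits this, (h2 24 (by omega)).1, h24 _ le_rfl]
  rintro s₂ ⟨hs₂, h25⟩
  have l₂ := l₁.of_same hs₂ (by intro a ha; omega)
  have e24 : s₂.num 24 = s₁.num 24 := (hs₂ 24 (by omega)).1
  refine Halts.seq_le (t := 80 * (n + 1)) (t₂ := 560 * X)
    ((halts_mulTable (by omega) n P ?_ ?_).mono (Nat.mul_le_mul_right _ (by simp [NExpr.cost]))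
      fun _ h => h) (by omega) ?_
  · exact fun s₃ h3 => (l₂.of_same h3 (by intro a ha; omega)).n_eq
  · exact fun s₃ h3 => hpat (l₂.of_same h3 (by intro a ha; omega)) ((h3 24 (by omega)).1.trans e24)
  rintro s₃ ⟨hs₃, h27⟩
  have l₃ := l₂.of_same hs₃ (by intro a ha; omega)
  have e24₃ : s₃.num 24 = s₁.num 24 := ((hs₃ 24 (by omega)).1).trans e24
  refine Halts.seq_le (t := 80 * (h + 1)) (t₂ := 400 * X)
    ((halts_mulTable (by omega) h (k + 2 * m) ?_ ?_).mono
      (Nat.mul_le_mul_right _ (by simp [NExpr.cost]))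
      fun _ h => h) (by omega) ?_
  · exact fun s₄ h4 => (l₃.of_same h4 (by intro a ha; omega)).h_eq
  · intro s₄ h4
    have := l₃.of_same h4 (by intro a ha; omega)
    simp only [NExpr.eval, this.k_eq, this.m_eq]
    omega
  rintro s₄ ⟨hs₄, h28⟩
  have l₄ := l₃.of_same hs₄ (by intro a ha; omega)
  have e24₄ : s₄.num 24 = s₁.num 24 := ((hs₄ 24 (by omega)).1).trans e24₃
  refine Halts.seq_le (t := 80 * (P + 1)) (t₂ := 200 * X)
    ((halts_mulTable (by omega) P h ?_ ?_).mono
      (Nat.mul_le_mul_right _ (by simp [NExpr.cost]))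
      fun _ h => h) (by omega) ?_
  · exact fun s₅ h5 => hpat (l₄.of_same h5 (by intro a ha; omega)) ((h5 24 (by omega)).1.trans e24₄)
  · exact fun s₅ h5 => (l₄.of_same h5 (by intro a ha; omega)).h_eq
  rintro s₅ ⟨hs₅, h30⟩
  have l₅ := l₄.of_same hs₅ (by intro a ha; omega)
  have e24₅ : s₅.num 24 = s₁.num 24 := ((hs₅ 24 (by omega)).1).trans e24₄
  refine ((halts_mulTable (by omega) (2 ^ n) (P * h) ?_ ?_).mono
      (t' := 80 * (2 ^ n + 1)) (Nat.mul_le_mul_right _ (by simp [NExpr.cost]))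
      fun _ h => h).mono (by omega) ?_
  · intro s₆ h6
    have := l₅.of_same h6 (by intro a ha; omega)
    change s₆.num 24 (s₆.num 20 0) = _
    rw [this.n_eq, (h6 24 (by omega)).1, e24₅, h24 _ (by omega)]
  · intro s₆ h6
    have := l₅.of_same h6 (by intro a ha; omega)
    change s₆.num 30 (numPat.eval s₆) = _
    rw [hpat this ((h6 24 (by omega)).1.trans e24₅), (h6 30 (by omega)).1, h30 P le_rfl]
  rintro s₆ ⟨hs₆, h29⟩
  refine ⟨?_, l₅.of_same hs₆ (by intro a ha; omega), ?_, ?_, ?_, ?_, h29, ?_⟩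
  · exact (hs₁.mono (by intro a ha; omega)).trans <| (hs₂.mono (by intro a ha; omega)).trans <|
      (hs₃.mono (by intro a ha; omega)).trans <| (hs₄.mono (by intro a ha; omega)).trans <|
      (hs₅.mono (by intro a ha; omega)).trans <| (hs₆.mono (by intro a ha; omega))
  · rw [(hs₆ 24 (by omega)).1, e24₅]; exact h24
  · rw [(hs₆ 25 (by omega)).1, (hs₅ 25 (by omega)).1, (hs₄ 25 (by omega)).1,
      (hs₃ 25 (by omega)).1, (hs₆ 26 (by omega)).1, (hs₅ 26 (by omega)).1, (hs₄ 26 (by omega)).1,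
      (hs₃ 26 (by omega)).1]
    exact h25
  · rw [(hs₆ 27 (by omega)).1, (hs₅ 27 (by omega)).1, (hs₄ 27 (by omega)).1]; exact h27
  · rw [(hs₆ 28 (by omega)).1, (hs₅ 28 (by omega)).1]; exact h28
  · rw [(hs₆ 30 (by omega)).1]; exact h30

end Construction

/-! ### The constructed NSST is the product, and the cost of constructing it. -/

section Main

variable {R Ω : Type*} {h k m : ℕ} {T : DSST (Fin h) (RefSym (Fin k) m) R Ω} {n ne : ℕ}
  {es el et I F : ℕ → ℕ} {s s₁ : Store R Ω}

/-- The numbering of the states of the product. -/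
noncomputable def stateEquiv (n m h : ℕ) :
    Fin (2 ^ n * (2 ^ (3 * m) * h)) ≃ Fin (2 ^ n) × Pat m × Fin h :=
  finProdFinEquiv.symm.trans (Equiv.prodCongr (.refl _)
    (finProdFinEquiv.symm.trans (Equiv.prodCongr (patEquiv m) (.refl _))))

theorem stateEquiv_symm_val (S : Fin (2 ^ n)) (π : Pat m) (q : Fin h) :
    ((stateEquiv n m h).symm (S, π, q) : ℕ) = stateNum m h S ((patEquiv m).symm π) q := by
  simp [stateEquiv, stateNum, finProdFinEquiv]
  ring

theorem patOf_patEquiv_symm (π : Pat m) : patOf m ((patEquiv m).symm π) = π := by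
  rw [← patEquiv_apply, Equiv.apply_symm_apply]

theorem lt_of_mem_blockSet (hE : ∀ e < ne, es e < n ∧ et e < n) {S : Set ℕ} (hS : ∀ p ∈ S, p < n)
    {π : Pat m} {q : ℕ} (hq : q ∈ blockSet k (edgeRel ne es el et) S π) : q < n := by
  obtain ⟨p, hp, h1⟩ := hq
  rcases Relation.ReflTransGen.cases_tail h1 with h2 | ⟨u, -, j, ⟨e, he, -, -, h3⟩, -⟩
  · simp only [Prod.mk.injEq] at h2
    rw [h2.1]
    exact hS p hp
  · simp only at h3
    rw [← h3]
    exact (hE e he).2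

theorem testBit_blockNumber (hE : ∀ e < ne, es e < n ∧ et e < n) {S : Set ℕ}
    (hS : ∀ p ∈ S, p < n) (π : Pat m) :
    {p | (blockNumber k m n ne es el et S ((patEquiv m).symm π)).testBit p} =
      blockSet k (edgeRel ne es el et) S π := by
  ext p
  simp only [blockNumber, Set.mem_ofPred_eq, testBit_setNumber, patOf_patEquiv_symm]
  exact ⟨fun h => h.2, fun h => ⟨lt_of_mem_blockSet hE hS h, h⟩⟩

/-- The NSST that is constructed. -/
noncomputable def outputNSST (T : DSST (Fin h) (RefSym (Fin k) m) R Ω) (n ne : ℕ)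
    (es el et I F : ℕ → ℕ) : NSST (Fin (2 ^ n * (2 ^ (3 * m) * h))) (Fin k) R Ω :=
  prodNSST (Sg := Fin (2 ^ n)) T (fun π => ⟨startNumber k m n ne es el et I ((patEquiv m).symm π), setNumber_lt _ _⟩)
    (fun S a π => ⟨nextNumber k m n ne es el et S a ((patEquiv m).symm π), setNumber_lt _ _⟩)
    (fun S : Fin (2 ^ n) => AcceptingSet n F S) (stateEquiv n m h)

theorem outputNSST_sem (hE : ∀ e < ne, es e < n ∧ et e < n)
    (hL : ∀ w ∈ pathLang k m (edgeRel ne es el et) (fun p => p < n ∧ I p ≠ 0) (fun p => F p ≠ 0),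
      IsMultirefWord w) (D : List (Fin k)) :
    (outputNSST T n ne es el et I F).sem D = etSem (spannerOf (pathLang k m (edgeRel ne es el et)
      (fun p => p < n ∧ I p ≠ 0) (fun p => F p ≠ 0))) T.eval D := by
  refine prodNSST_sem_eq_etSem T _ _ _ _ hL (fun π => ?_) (fun S a π => ?_) (fun S => ?_) D
  · exact testBit_blockNumber hE (fun p hp => hp.1) π
  · refine testBit_blockNumber hE (fun p hp => ?_) π
    obtain ⟨p', -, e, he, -, -, rfl⟩ := hp
    exact (hE e he).2
  · constructor
    · rintro ⟨p, -, h1⟩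
      exact ⟨p, h1⟩
    · rintro ⟨p, h1⟩
      refine ⟨p, ?_, h1⟩
      -- A number below `2 ^ n` has no digit at `n` or beyond, so restricting the accepting states
      -- to `p < n` loses nothing.
      by_contra hp
      have h2 : 2 ^ n ≤ 2 ^ p := Nat.pow_le_pow_right (by omega) (by omega)
      rw [Nat.testBit_lt_two_pow (S.2.trans_le h2)] at h1
      simp at h1

theorem stateNum_inj {S S' b b' q q' : ℕ} (hb : b < 2 ^ (3 * m)) (hb' : b' < 2 ^ (3 * m))
    (hq : q < h) (hq' : q' < h) (he : stateNum m h S b q = stateNum m h S' b' q') :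
    S = S' ∧ b = b' ∧ q = q' := by
  have h1 : S = S' := by rw [← stateNum_div (S := S) hb hq, he, stateNum_div hb' hq']
  subst h1
  have h2 : b * h + q = b' * h + q' := by simp only [stateNum] at he; omega
  exact ⟨rfl, mul_add_inj hq hq' h2⟩

/-- All components of the product are indexed by triples; `stateNum` and `patEquiv` carry them over
to the numbers in the memory, and sums over finite types become sums over ranges. -/
theorem represents_outputNSST
    (h10 : s.num 10 0 = 2 ^ n * (2 ^ (3 * m) * h))
    (hI : InitWritten T (startNumber k m n ne es el et I) (2 ^ (3 * m)) s)
    (hF : FinalWritten T n F (2 ^ n * (2 ^ (3 * m) * h)) s)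
    (hT : s.emitted = ∑ S ∈ Finset.range (2 ^ n), ∑ a ∈ Finset.range k,
      ∑ b ∈ Finset.range (2 ^ (3 * m)), ∑ q ∈ Finset.range h,
        numTrans T S a b q (nextNumber k m n ne es el et S a b)) :
    s.Represents (outputNSST T n ne es el et I F) := by
  classical
  refine ⟨h10, fun i => ?_, fun i => ?_, ?_⟩
  · obtain ⟨⟨S, π, q⟩, rfl⟩ := (stateEquiv n m h).symm.surjective i
    rw [stateEquiv_symm_val]
    simp only [outputNSST, prodNSST, Equiv.apply_symm_apply, Fin.ext_iff]
    set b := (patEquiv m).symm π with hb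
    have hrun : initRun T b = (T.runFrom (T.start, Valuation.empty R Ω) (π.word (Fin k))).map
        fun c => (c.2.toAssignment, c.1) := by
      rw [initRun, hb, patOf_patEquiv_symm, DSST.runA_toAssignment]
    -- The cell may be zero, and then no pattern leads to this state, or it was written for some
    -- pattern `b'`.
    rcases hI (stateNum m h S b q) with ⟨h1, h2⟩ | ⟨h1, b', hb', c, hc, h3, h4⟩
    · rw [if_pos h1]
      split_ifs with hS
      · cases hr : T.runFrom (T.start, Valuation.empty R Ω) (π.word (Fin k)) with
        | none => rfl
        | some d =>
          rw [Option.bind_some, if_neg, Option.map_none]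
          intro hq
          rw [hr, Option.map_some] at hrun
          refine h2 b b.2 _ hrun ?_
          simp only [← hS, hq]
      · rfl
    · rw [if_neg h1]
      -- The number determines the triple, so the cell was written for the very pattern `b` of the
      -- state.
      obtain ⟨h5, h6, h7⟩ := stateNum_inj hb' b.2 c.2.2 q.2 h3
      subst h6
      rw [if_pos h5.symm]
      rw [hrun] at hc
      obtain ⟨d, hd, rfl⟩ := Option.map_eq_some_iff.1 hc
      rw [hd, Option.bind_some, if_pos h7, h4, Option.map_some]
  · obtain ⟨⟨S, π, q⟩, rfl⟩ := (stateEquiv n m h).symm.surjective i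
    have h1 := hF _ ((stateEquiv n m h).symm (S, π, q)).2
    rw [stateEquiv_symm_val] at h1 ⊢
    rw [stateNum_div ((patEquiv m).symm π).2 q.2, stateNum_mod q.2] at h1
    simp only [outputNSST, prodNSST, Equiv.apply_symm_apply]
    rw [h1.1, h1.2]
    split_ifs with h2 h3 h3
    · cases hf : T.final q with
      | none => rfl
      | some w => simp [DSST.store, hf] at h3
    · cases hf : T.final q with
      | none => simp [DSST.store, hf] at h3
      | some w => simp [DSST.store, hf]
    · rfl
    · exact absurd rfl h3
  · change _ = s.emitted
    rw [hT]
    simp only [outputNSST, prodNSST]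
    set φ := Multiset.mapAddMonoidHom (fun τ : Fin (2 ^ n * (2 ^ (3 * m) * h)) × Fin k ×
      Assignment R Ω × Fin (2 ^ n * (2 ^ (3 * m) * h)) =>
        ((τ.1 : ℕ), (τ.2.1 : ℕ), τ.2.2.1, (τ.2.2.2 : ℕ))) with hφ
    change φ _ = _
    simp only [map_sum, Finset.sum_range]
    refine Finset.sum_congr rfl fun S _ => Finset.sum_congr rfl fun a _ => ?_
    rw [← Equiv.sum_comp (patEquiv m)]
    refine Finset.sum_congr rfl fun b _ => Finset.sum_congr rfl fun q _ => ?_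
    have hsym : symAt k m a = some (.letter a) := symAt_eq_letter.2 rfl
    have hr : T.letterRun q a (patEquiv m b) =
        T.runA (T.entry (q * (k + 2 * m) + a)) ((patOf m b).word (Fin k)) := by
      rw [DSST.letterRun, T.entry_eq q hsym, patEquiv_apply]
    rw [prodTrans, numTrans, hr]
    cases T.runA (T.entry (q * (k + 2 * m) + a)) ((patOf m b).word (Fin k)) with
    | none => simp
    | some c =>
      simp only [Option.elim_some, map_sum, Finset.sum_range]
      rw [← Equiv.sum_comp (patEquiv m)]
      refine Finset.sum_congr rfl fun b' _ => ?_
      simp only [hφ, Multiset.coe_mapAddMonoidHom, Multiset.map_singleton, stateEquiv_symm_val,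
        Equiv.symm_apply_apply]

/-- Construct the NSST from an automaton that is given by a list of edges. -/
def constructProg : Prog :=
  .seq makeTables (.seq writeInit (.seq writeFinal (.seq emitAll
    (.setNum 10 (.lit 0) (.get 29 numSets)))))

/-- The cost of `emitAll` dominates; the other three parts lack some of its factors, all of which
are at least `1`. The counter of the transitions has to be zero at the beginning. -/
theorem Loaded.halts_constructProg (hs : Loaded T n ne es el et I F s)
    (hE : ∀ e < ne, es e < n ∧ et e < n) (hk : 1 ≤ k) (h11 : ∀ i, s.num 11 i = 0)
    (h10 : s.num 10 1 = 0) :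
    Halts constructProg s (40000 *
      (2 ^ n * (k * (2 ^ (3 * m) * ((n + 1) * (h * (2 ^ (3 * m) * (m + ne + 1)))))))) fun s₂ =>
      s₂.Represents (outputNSST T n ne es el et I F) := by
  set P := 2 ^ (3 * m) with hP
  have hPpos : 1 ≤ P := Nat.one_le_two_pow
  set W := 2 ^ n with hW
  have hWpos : 1 ≤ W := Nat.one_le_two_pow
  have hhpos : 1 ≤ h := by have := T.start.2; omega
  set Y := m + ne + 1 with hY
  have hYpos : 1 ≤ Y := by omega
  set X := W * (k * (P * ((n + 1) * (h * (P * Y))))) with hX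
  have hX1 : W * (P * h) ≤ X := by
    calc W * (P * h) = W * (1 * (P * (1 * (h * (1 * 1))))) := by ring
      _ ≤ X := by rw [hX]; gcongr; omega
  have hX2 : (n + 1) * (P * (P * Y)) ≤ X := by
    calc (n + 1) * (P * (P * Y)) = 1 * (1 * (P * ((n + 1) * (1 * (P * Y))))) := by ring
      _ ≤ X := by rw [hX]; gcongr
  have hX3 : W * ((n + 1) * (P * h)) ≤ X := by
    calc W * ((n + 1) * (P * h)) = W * (1 * (P * ((n + 1) * (h * (1 * 1))))) := by ring
      _ ≤ X := by rw [hX]; gcongr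
  have hX0 : 1 ≤ X := (Nat.mul_pos hWpos (Nat.mul_pos hPpos hhpos)).trans_le hX1
  refine Halts.seq_le (1000 * (W * (P * h))) (39000 * X) hs.halts_makeTables (by omega) ?_
  rintro s₁ ⟨hs₁, env₁⟩
  refine Halts.seq_le (4000 * ((n + 1) * (P * (P * Y)))) (35000 * X) (env₁.halts_writeInit hE ?_)
    (by omega) ?_
  · intro i
    rw [(hs₁ 11 (by omega)).1, h11]
  rintro s₂ ⟨hs₂, hI⟩
  have env₂ := env₁.of_same hs₂ (by intro a ha; omega)
  refine Halts.seq_le (1000 * (W * ((n + 1) * (P * h)))) (34000 * X) env₂.halts_writeFinal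
    (by omega) ?_
  rintro s₃ ⟨hs₃, hF⟩
  have env₃ := env₂.of_same hs₃ (by intro a ha; omega)
  refine Halts.seq_le (23300 * X) (10 * X) (env₃.halts_emitAll hE hk) (by omega) ?_
  rintro s₄ ⟨hs₄, hT⟩
  have env₄ := env₃.of_same hs₄ (by intro a ha; simp only [NoOutput]; omega)
  have he : s₃.emitted = 0 := by
    have : s₃.num 10 1 = 0 := by
      rw [(hs₃ 10 (by omega)).1, (hs₂ 10 (by omega)).1, (hs₁ 10 (by omega)).1, h10]
    simp [Store.emitted, this]
  have h29 : NExpr.eval s₄ (.get 29 numSets) = W * (P * h) := by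
    change s₄.num 29 (numSets.eval s₄) = _
    rw [env₄.eval_numSets, env₄.set_eq _ le_rfl]
  refine Halts.of_run rfl (by simp only [Prog.bound, NExpr.cost]; omega) ?_
  have hlast : Same (fun a => a ≠ 10) s₄
      ((Prog.setNum 10 (.lit 0) (.get 29 numSets)).run s₄) := Same.run (by simp [Prog.writes])
  refine represents_outputNSST ?_ ?_ ?_ ?_
  · simp only [Prog.run, h29]
    simp [Store.num_setNum, NExpr.eval, hW, hP]
  · exact ((hI.of_same hs₃ (by omega)).of_same hs₄ (by simp [NoOutput])).of_same hlast (by omega)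
  · exact (hF.of_same hs₄ (by simp [NoOutput])).of_same hlast (by omega)
  · rw [he, zero_add] at hT
    rw [← hT]
    simp [Store.emitted, Prog.run, Store.num_setNum, NExpr.eval]

end Main

/-! ### Reading an NFA from its table. -/

section Automata

variable {R Ω : Type*} {h k m : ℕ} {T : DSST (Fin h) (RefSym (Fin k) m) R Ω} {n : ℕ}
  {s s₁ : Store R Ω}

theorem exists_lt_succ_iff {p : ℕ → Prop} (j : ℕ) : (∃ e < j + 1, p e) ↔ (∃ e < j, p e) ∨ p j := by
  constructor
  · rintro ⟨e, he, h1⟩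
    rcases Nat.lt_succ_iff_lt_or_eq.1 he with h2 | rfl
    · exact .inl ⟨e, h2, h1⟩
    · exact .inr h1
  · rintro (⟨e, he, h1⟩ | h1)
    · exact ⟨e, by omega, h1⟩
    · exact ⟨j, by omega, h1⟩

/-- Append an edge to the list of the edges. -/
def addEdge (p j q : NExpr) : Prog :=
  .seq (.setNum 21 (.var 19) p) (.seq (.setNum 22 (.var 19) j) (.seq (.setNum 23 (.var 19) q)
    (.setVar 19 (.add (.var 19) (.lit 1)))))

/-- The relation of the edges in the list. -/
def Store.edges (s : Store R Ω) : ℕ → ℕ → ℕ → Prop :=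
  edgeRel (s.num 19 0) (s.num 21) (s.num 22) (s.num 23)

theorem Store.edges_of_same {K : ℕ → Prop} (hs : Same K s s₁) (h19 : K 19) (h21 : K 21)
    (h22 : K 22) (h23 : K 23) : s₁.edges = s.edges := by
  unfold Store.edges
  rw [(hs 19 h19).1, (hs 21 h21).1, (hs 22 h22).1, (hs 23 h23).1]

/-- The expression reads none of the arrays that hold the edges. -/
def NExpr.NoEdge : NExpr → Prop
  | lit _ => True
  | get a i => (a < 19 ∨ 24 ≤ a) ∧ i.NoEdge
  | add e f => e.NoEdge ∧ f.NoEdge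
  | sub e f => e.NoEdge ∧ f.NoEdge

theorem NExpr.NoEdge.eval_eq {e : NExpr} (he : e.NoEdge)
    (hs : Same (fun a => a < 19 ∨ 24 ≤ a) s s₁) : e.eval s₁ = e.eval s := by
  induction e with
  | lit => rfl
  | get a i ih => simp only [NExpr.eval, ih he.2, (hs a he.1).1]
  | add e f ih ih₂ => simp only [NExpr.eval, ih he.1, ih₂ he.2]
  | sub e f ih ih₂ => simp only [NExpr.eval, ih he.1, ih₂ he.2]

/-- Label and target are evaluated when parts of the edge have already been written, hence they must
not read the arrays of the edges; the source is evaluated first. -/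
theorem addEdge_run {p j q : NExpr} (hj : j.NoEdge) (hq : q.NoEdge) :
    ((addEdge p j q).run s).num 19 0 = s.num 19 0 + 1 ∧
    ∀ p' j' q', ((addEdge p j q).run s).edges p' j' q' ↔ s.edges p' j' q' ∨
      (p.eval s = p' ∧ j.eval s = j' ∧ q.eval s = q') := by
  set s₁ := s.setNum 21 (s.num 19 0) (p.eval s) with h1
  have hs₁ : Same (fun a => a < 19 ∨ 24 ≤ a) s s₁ := (Same.refl _ _).setNum (by omega) _ _
  set s₂ := s₁.setNum 22 (s.num 19 0) (j.eval s) with h2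
  have hs₂ : Same (fun a => a < 19 ∨ 24 ≤ a) s s₂ := hs₁.setNum (by omega) _ _
  have hrun : (addEdge p j q).run s =
      (s₂.setNum 23 (s.num 19 0) (q.eval s)).setNum 19 0 (s.num 19 0 + 1) := by
    have e1 : s₁.num 19 0 = s.num 19 0 := by simp [h1, Store.num_setNum]
    have e2 : s₂.num 19 0 = s.num 19 0 := by simp [h2, Store.num_setNum, e1]
    simp only [addEdge, Prog.run, NExpr.eval, ← h1, e1, hj.eval_eq hs₁, ← h2, e2, hq.eval_eq hs₂]
    simp [Store.num_setNum, e2]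
  rw [hrun]
  refine ⟨by simp [Store.num_setNum], fun p' j' q' => ?_⟩
  simp only [Store.edges, edgeRel]
  rw [show ((s₂.setNum 23 (s.num 19 0) (q.eval s)).setNum 19 0 (s.num 19 0 + 1)).num 19 0 =
    s.num 19 0 + 1 by simp [Store.num_setNum], exists_lt_succ_iff]
  refine or_congr ?_ ?_
  · refine exists_congr fun e => and_congr_right fun he => ?_
    simp [h1, h2, Store.num_setNum, he.ne]
  · simp [h1, h2, Store.num_setNum]

theorem addEdge_writes (p j q : NExpr) : (addEdge p j q).writes = [21, 22, 23, 19] := rfl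

theorem addEdge_bound (p j q : NExpr) :
    (addEdge p j q).bound = p.cost + j.cost + q.cost + 15 := by
  simp only [addEdge, Prog.bound, NExpr.cost]
  omega

/-- The expression for the number of symbols. -/
abbrev numSyms : NExpr := .add (.get 0 (.lit 0)) (.add (.get 0 (.lit 1)) (.get 0 (.lit 1)))

/-- Compute the list of edges of an NFA. -/
def loadNFA : Prog :=
  .seq (.setVar 20 (.get 0 (.lit 4)))
    (.for 82 (.var 20) (.for 83 numSyms (.for 84 (.var 20)
      (.seq (.ite (.get 3 (.var 85)) (addEdge (.var 82) (.var 83) (.var 84)) .skip)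
        (.setVar 85 (.add (.var 85) (.lit 1)))))))

/-- The edges of the first `c` cells of the table are in the list. -/
def TableRead (n K : ℕ) (tab : ℕ → ℕ) (c : ℕ) (s : Store R Ω) : Prop :=
  s.num 19 0 ≤ c ∧ s.num 85 0 = c ∧ ∀ p j q, s.edges p j q ↔
    p < n ∧ j < K ∧ q < n ∧ (p * K + j) * n + q < c ∧ tab ((p * K + j) * n + q) ≠ 0

theorem TableRead.of_same {n K c : ℕ} {tab : ℕ → ℕ} (hs : TableRead n K tab c s) {X : ℕ → Prop}
    (h : Same X s s₁) (h19 : X 19) (h21 : X 21) (h22 : X 22) (h23 : X 23) (h85 : X 85) :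
    TableRead n K tab c s₁ := by
  unfold TableRead
  rw [Store.edges_of_same h h19 h21 h22 h23, (h 19 h19).1, (h 85 h85).1]
  exact hs

/-- The three loops visit the cells of the table in the order of their addresses, so the counter
`85` is always the address of the current cell and no multiplication is needed. The counters `19`
and `85` rely on the zeros of the given memory. -/
theorem halts_loadNFA {tab : ℕ → ℕ} (h3 : s.num 3 = tab) (h0 : s.num 0 0 = k) (h1 : s.num 0 1 = m)
    (h4 : s.num 0 4 = n) (h19 : s.num 19 0 = 0) (h85 : s.num 85 0 = 0) :
    Halts loadNFA s (300 * ((n + 1) * ((k + 2 * m + 1) * (n + 1)))) fun s₂ =>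
      Same (fun a => a < 19) s s₂ ∧ s₂.num 20 0 = n ∧
        TableRead n (k + 2 * m) tab (n * (k + 2 * m) * n) s₂ := by
  set K := k + 2 * m with hK
  set s' := (Prog.setVar 20 (.get 0 (.lit 4))).run s with hs'
  have hsame : Same (fun a => a ≠ 20) s s' := Same.run (by simp [Prog.writes])
  have h20 : s'.num 20 0 = n := by simp [hs', Prog.run, NExpr.eval, Store.num_setNum, h4]
  have hpos : 1 ≤ (n + 1) * ((K + 1) * (n + 1)) := Nat.one_le_iff_ne_zero.2 (by positivity)
  refine Halts.run_seq ((200 + 2 + 20) * ((n + 1) * ((K + 1) * (n + 1)))) rfl ?_ ?_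
  · simp only [Prog.bound, NExpr.cost]
    omega
  have hinit : TableRead n K tab 0 s' := by
    refine ⟨?_, ?_, ?_⟩
    · rw [(hsame 19 (by omega)).1, h19]
    · rw [(hsame 85 (by omega)).1, h85]
    · intro p j q
      simp only [Store.edges, edgeRel]
      rw [(hsame 19 (by omega)).1, h19]
      simp
  refine (Halts.forK (K := fun a => a < 19 ∨ a = 20) (fun p s₁ => TableRead n K tab (p * K * n) s₁)
    n 200 ((K + 1) * (n + 1)) (Nat.one_le_iff_ne_zero.2 (by positivity)) (by omega) ?_
    (by simpa using hinit) ?_ ?_).mono le_rfl ?_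
  · intro j s₁ i y hJ
    exact hJ.of_same (X := fun a => a ≠ 82) ((Same.refl _ _).setNum (by simp) _ _)
      (by omega) (by omega) (by omega) (by omega) (by omega)
  · exact fun s₁ hs₁ => by simp only [NExpr.eval]; rw [(hs₁ 20 (by omega)).1, h20]
  swap
  · rintro s₁ ⟨hs₁, hJ⟩
    exact ⟨(hsame.mono (by intro a ha; omega)).trans (hs₁.mono (by intro a ha; omega)),
      by rw [(hs₁ 20 (by omega)).1, h20], hJ⟩
  intro p s₁ hp hs₁ hJ₁ h82
  refine (Halts.forK (K := fun a => a < 19 ∨ a = 20 ∨ a = 82)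
    (fun j s₂ => TableRead n K tab ((p * K + j) * n) s₂)
    K 100 (n + 1) (by omega) (by omega) ?_ (by simpa using hJ₁) ?_ ?_).mono ?_ ?_
  · intro j s₁ i y hJ
    exact hJ.of_same (X := fun a => a ≠ 83) ((Same.refl _ _).setNum (by simp) _ _)
      (by omega) (by omega) (by omega) (by omega) (by omega)
  · intro s₂ hs₂
    simp only [NExpr.eval]
    rw [(hs₂ 0 (by omega)).1, (hs₁ 0 (by omega)).1, (hsame 0 (by omega)).1, h0, h1, hK]
    omega
  rotate_left
  · exact Nat.mul_le_mul_right _ (by simp [NExpr.cost])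
  · rintro s₂ ⟨hs₂, hJ⟩
    refine ⟨by rw [(hs₂ 82 (by omega)).1, h82], hs₂.mono (by intro a ha; omega), ?_⟩
    rwa [show (p + 1) * K * n = (p * K + K) * n by ring]
  intro j s₂ hj hs₂ hJ₂ h83
  refine (Halts.forK (K := fun a => a < 19 ∨ a = 20 ∨ a = 82 ∨ a = 83)
    (fun q s₃ => TableRead n K tab ((p * K + j) * n + q) s₃)
    n 50 1 le_rfl (by omega) ?_ (by simpa using hJ₂) ?_ ?_).mono ?_ ?_
  · intro j s₁ i y hJ
    exact hJ.of_same (X := fun a => a ≠ 84) ((Same.refl _ _).setNum (by simp) _ _)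
      (by omega) (by omega) (by omega) (by omega) (by omega)
  · intro s₃ hs₃
    simp only [NExpr.eval]
    rw [(hs₃ 20 (by omega)).1, (hs₂ 20 (by omega)).1, (hs₁ 20 (by omega)).1, h20]
  rotate_left
  · rw [mul_one]
    exact Nat.mul_le_mul_right _ (by simp [NExpr.cost])
  · rintro s₃ ⟨hs₃, hJ⟩
    refine ⟨by rw [(hs₃ 83 (by omega)).1, h83], hs₃.mono (by intro a ha; omega), ?_⟩
    rwa [show (p * K + (j + 1)) * n = (p * K + j) * n + n by ring]
  intro q s₃ hq hs₃ ⟨hc, h85₃, hedges⟩ h84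
  have e82 : s₃.num 82 0 = p := by rw [(hs₃ 82 (by omega)).1, (hs₂ 82 (by omega)).1, h82]
  have e83 : s₃.num 83 0 = j := by rw [(hs₃ 83 (by omega)).1, h83]
  have e3 : s₃.num 3 = tab := by
    rw [(hs₃ 3 (by omega)).1, (hs₂ 3 (by omega)).1, (hs₁ 3 (by omega)).1, (hsame 3 (by omega)).1, h3]
  set c := (p * K + j) * n + q with hcdef
  have hinj : ∀ p' j' q', j' < K → q' < n → ((p' * K + j') * n + q' = c ↔
      p = p' ∧ j = j' ∧ q = q') := by
    intro p' j' q' hj' hq'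
    constructor
    · intro he
      obtain ⟨h5, h6⟩ := mul_add_inj hq' hq he
      obtain ⟨h7, h8⟩ := mul_add_inj hj' hj h5
      exact ⟨h7.symm, h8.symm, h6.symm⟩
    · rintro ⟨rfl, rfl, rfl⟩
      rfl
  -- One more cell adds the triple `(p, j, q)` at most, since a cell number determines its triple by
  -- uniqueness of quotient and remainder.
  have hnew : ∀ p' j' q', (s₃.edges p' j' q' ∨ (tab c ≠ 0 ∧ p = p' ∧ j = j' ∧ q = q')) ↔
      p' < n ∧ j' < K ∧ q' < n ∧ (p' * K + j') * n + q' < c + 1 ∧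
        tab ((p' * K + j') * n + q') ≠ 0 := by
    intro p' j' q'
    rw [hedges]
    constructor
    · rintro (⟨g1, g2, g3, g4, g5⟩ | ⟨g1, rfl, rfl, rfl⟩)
      · exact ⟨g1, g2, g3, by omega, g5⟩
      · exact ⟨hp, hj, hq, by omega, g1⟩
    · rintro ⟨g1, g2, g3, g4, g5⟩
      rcases Nat.lt_succ_iff_lt_or_eq.1 g4 with g6 | g6
      · exact .inl ⟨g1, g2, g3, g6, g5⟩
      · exact .inr ⟨g6 ▸ g5, (hinj _ _ _ g2 g3).1 g6⟩
  refine Halts.of_run rfl ?_ ⟨?_, Same.run ?_, ?_⟩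
  · simp [Prog.bound, addEdge_bound, NExpr.cost]
  · rw [(Same.run (K := fun a => a = 84) (by simp [Prog.writes, addEdge_writes]) 84 rfl).1, h84]
  · simp [Prog.writes, addEdge_writes]
  · change TableRead n K tab (c + 1) (Prog.run (.seq _ _) s₃)
    by_cases ht : tab c = 0
    · have hrun : Prog.run (.seq (.ite (.get 3 (.var 85)) (addEdge (.var 82) (.var 83) (.var 84))
          .skip) (.setVar 85 (.add (.var 85) (.lit 1)))) s₃ = s₃.setNum 85 0 (c + 1) := by
        simp [Prog.run, NExpr.eval, h85₃, e3, ht]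
      rw [hrun]
      have hsm : Same (fun a => a ≠ 85) s₃ (s₃.setNum 85 0 (c + 1)) :=
        (Same.refl _ _).setNum (by simp) _ _
      refine ⟨?_, by simp [Store.num_setNum], fun p' j' q' => ?_⟩
      · rw [(hsm 19 (by omega)).1]; omega
      · rw [Store.edges_of_same hsm (by omega) (by omega) (by omega) (by omega), ← hnew]
        simp [ht]
    · set s₄ := (addEdge (.var 82) (.var 83) (.var 84)).run s₃ with hs₄
      obtain ⟨h19₄, hedges₄⟩ := addEdge_run (s := s₃) (p := .var 82) (j := .var 83) (q := .var 84)
        (by simp [NExpr.NoEdge]) (by simp [NExpr.NoEdge])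
      rw [← hs₄] at h19₄ hedges₄
      have e85 : s₄.num 85 0 = c := by
        rw [(Same.run (K := fun a => a = 85) (by simp [addEdge_writes]) 85 rfl).1, h85₃]
      have hrun : Prog.run (.seq (.ite (.get 3 (.var 85)) (addEdge (.var 82) (.var 83) (.var 84))
          .skip) (.setVar 85 (.add (.var 85) (.lit 1)))) s₃ = s₄.setNum 85 0 (c + 1) := by
        simp [Prog.run, NExpr.eval, h85₃, e3, ht, ← hs₄, e85]
      rw [hrun]
      have hsm : Same (fun a => a ≠ 85) s₄ (s₄.setNum 85 0 (c + 1)) :=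
        (Same.refl _ _).setNum (by simp) _ _
      refine ⟨?_, by simp [Store.num_setNum], fun p' j' q' => ?_⟩
      · rw [(hsm 19 (by omega)).1]; omega
      · rw [Store.edges_of_same hsm (by omega) (by omega) (by omega) (by omega), ← hnew, hedges₄]
        simp [ht, NExpr.eval, e82, e83, h84]

/-- All labels in the list are numbers of symbols, so the paths have no steps that read nothing and
agree with the runs of the NFA. -/
theorem path_iff_mem_evalFrom (M : NFA (RefSym (Fin k) m) (Fin n)) {E : ℕ → ℕ → ℕ → Prop}
    (hE : ∀ p j q, E p j q ↔ ∃ (hp : p < n) (hq : q < n) (b : RefSym (Fin k) m),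
      symAt k m j = some b ∧ (⟨q, hq⟩ : Fin n) ∈ M.step ⟨p, hp⟩ b)
    (hsym : ∀ b : RefSym (Fin k) m, ∃ j, symAt k m j = some b) (w : List (RefSym (Fin k) m)) :
    ∀ (p q : Fin n), Path E p w q ↔ q ∈ M.evalFrom {p} w := by
  have hnoeps : ∀ {p j q}, E p j q → symAt k m j ≠ none := by
    intro p j q h1 h2
    obtain ⟨-, -, b, h3, -⟩ := (hE _ _ _).1 h1
    rw [h2] at h3
    simp at h3
  induction w with
  | nil =>
    intro p q
    simp only [NFA.evalFrom_nil, Set.mem_singleton_iff]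
    constructor
    · intro h1
      generalize hp : (p : ℕ) = p' at h1
      generalize hq : (q : ℕ) = q' at h1
      cases h1 with
      | nil => exact Fin.ext (hq.trans hp.symm)
      | eps h1 h2 => exact absurd h2 (hnoeps h1)
    · rintro rfl
      exact .nil _
  | cons b w ih =>
    intro p q
    rw [NFA.evalFrom_cons, NFA.stepSet_singleton, NFA.mem_evalFrom_iff_exists]
    constructor
    · intro h1
      generalize hp : (p : ℕ) = p' at h1
      generalize hq : (q : ℕ) = q' at h1
      cases h1 with
      | eps h1 h2 => exact absurd h2 (hnoeps h1)
      | @sym _ j r _ _ _ h1 h2 h3 =>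
        obtain ⟨hp', hr, b', h4, h5⟩ := (hE _ _ _).1 h1
        rw [h2] at h4
        obtain rfl := Option.some.inj h4
        subst hp
        subst hq
        exact ⟨⟨r, hr⟩, h5, (ih ⟨r, hr⟩ q).1 h3⟩
    · rintro ⟨r, h1, h2⟩
      obtain ⟨j, hj⟩ := hsym b
      exact .sym ((hE _ _ _).2 ⟨p.2, r.2, b, hj, h1⟩) hj ((ih r q).2 h2)

theorem exists_symAt (b : RefSym (Fin k) m) : ∃ j, symAt k m j = some b := by
  cases b with
  | letter a => exact ⟨a, symAt_eq_letter.2 rfl⟩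
  | opn x => exact ⟨k + x, by simp [symAt]⟩
  | cls x =>
    refine ⟨k + m + x, ?_⟩
    have h1 : ¬ k + m + x < k := by omega
    have h2 : ¬ k + m + x - k < m := by omega
    have h3 : k + m + x - k - m = x := by omega
    simp [symAt, h1, h2, h3]

theorem inputNFA_table (M : NFA (RefSym (Fin k) m) (Fin n))
    (T : DSST (Fin h) (RefSym (Fin k) m) R Ω) {p j q : ℕ} (hp : p < n) (hj : j < k + 2 * m)
    (hq : q < n) : (inputNFA M T).num 3 ((p * (k + 2 * m) + j) * n + q) ≠ 0 ↔
      ∃ b, symAt k m j = some b ∧ (⟨q, hq⟩ : Fin n) ∈ M.step ⟨p, hp⟩ b := by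
  have e1 : ((p * (k + 2 * m) + j) * n + q) / n = p * (k + 2 * m) + j := by
    rw [mul_comm, Nat.mul_add_div (by omega), Nat.div_eq_of_lt hq, add_zero]
  have e2 : ((p * (k + 2 * m) + j) * n + q) % n = q := by
    rw [mul_comm, Nat.mul_add_mod, Nat.mod_eq_of_lt hq]
  have e3 : (p * (k + 2 * m) + j) / (k + 2 * m) = p := by
    rw [mul_comm, Nat.mul_add_div (by omega), Nat.div_eq_of_lt hj, add_zero]
  have e4 : (p * (k + 2 * m) + j) % (k + 2 * m) = j := by
    rw [mul_comm, Nat.mul_add_mod, Nat.mod_eq_of_lt hj]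
  have e5 : entryAt n k m (p * (k + 2 * m) + j) = (symAt k m j).map fun b => (⟨p, hp⟩, b) := by
    simp [entryAt, e3, e4, hp]
  simp only [inputNFA]
  rw [if_neg (by simp), if_pos trivial, e1, e2, e5]
  split_ifs with h0
  · refine iff_of_true one_ne_zero ?_
    obtain ⟨e, q', h1, h2, h3⟩ := h0
    obtain ⟨b, h4, rfl⟩ := Option.map_eq_some_iff.1 h1
    obtain rfl : q' = ⟨q, hq⟩ := Fin.ext h2
    exact ⟨b, h4, h3⟩
  · refine iff_of_false (fun h => h rfl) ?_
    rintro ⟨b, h1, h2⟩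
    exact h0 ⟨(⟨p, hp⟩, b), ⟨q, hq⟩, by rw [h1, Option.map_some], rfl, h2⟩

theorem loaded_of_same {s₀ : Store R Ω} (h0 : ∀ i < 4, s₀.num 0 i = T.store.num 0 i)
    (h1 : s₀.num 1 = T.store.num 1) (h2 : s₀.num 2 = T.store.num 2) (ha : s₀.asg = T.store.asg)
    (hst : s₀.str = T.store.str) (hs : Same (fun a => a < 4) s₀ s) :
    Loaded T (s.num 20 0) (s.num 19 0) (s.num 21) (s.num 22) (s.num 23) (s.num 4) (s.num 5) s where
  k_eq := by rw [(hs 0 (by omega)).1, h0 0 (by omega)]; rfl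
  m_eq := by rw [(hs 0 (by omega)).1, h0 1 (by omega)]; rfl
  h_eq := by rw [(hs 0 (by omega)).1, h0 2 (by omega)]; rfl
  start_eq := by rw [(hs 0 (by omega)).1, h0 3 (by omega)]; rfl
  step_eq := by rw [(hs 1 (by omega)).1, h1]
  asg_eq := by rw [(hs 1 (by omega)).2.1, ha]
  final_eq := by rw [(hs 2 (by omega)).1, h2]
  str_eq := by rw [(hs 2 (by omega)).2.2, hst]
  init_eq := rfl
  acc_eq := rfl
  ne_eq := rfl
  n_eq := rfl
  es_eq := rfl
  el_eq := rfl
  et_eq := rfl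

/-- The list has at most `n * K * n` edges with `K = k + 2 * m`, so every quantity besides the sets
and patterns is polynomial in `n` and is absorbed by powers of `2 ^ n`. -/
theorem constructs_inputNFA (M : NFA (RefSym (Fin k) m) (Fin n))
    (T : DSST (Fin h) (RefSym (Fin k) m) R Ω) (hk : 1 ≤ k) (hm : 1 ≤ m)
    (hM : ∀ w ∈ M.accepts, IsMultirefWord w) :
    Constructs (.seq loadNFA constructProg) (inputNFA M T)
      (200000 * (2 ^ (4 * n + 9 * m) * k ^ 3 * m ^ 2 * h ^ 2))
      (etSem (spannerOf M.accepts) T.eval) := by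
  set K := k + 2 * m with hK
  have hhpos : 1 ≤ h := by have := T.start.2; omega
  set X := 2 ^ (4 * n + 9 * m) * k ^ 3 * m ^ 2 * h ^ 2 with hX
  have hn2 : n + 1 ≤ 2 ^ n := Nat.lt_two_pow_self
  have hXeq : X = (2 ^ n * ((2 ^ n) * ((2 ^ n) * (2 ^ n)))) *
      (2 ^ (3 * m) * (2 ^ (3 * m) * 2 ^ (3 * m)) * (k * (k * k) * ((m * m) * (h * h)))) := by
    rw [hX, pow_add, show 4 * n = n + (n + (n + n)) by ring,
      show 9 * m = 3 * m + (3 * m + 3 * m) by ring]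
    simp only [pow_add]
    ring
  -- The factor `3` comes from `k + 2 * m ≤ 3 * (k * m)`, which uses that `k` and `m` are positive.
  have hY : m + n * K * n + 1 ≤ 3 * ((n + 1) * ((n + 1) * (k * m))) := by
    have h1 : k ≤ k * m := Nat.le_mul_of_pos_right _ hm
    have h2 : m ≤ k * m := Nat.le_mul_of_pos_left _ hk
    have h3 : n * K * n ≤ n * (3 * (k * m)) * n := by
      rw [hK]
      gcongr
      omega
    nlinarith
  have hKm : K + 1 ≤ 4 * (k * m) := by
    have h1 : k ≤ k * m := Nat.le_mul_of_pos_right _ hm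
    have h2 : m ≤ k * m := Nat.le_mul_of_pos_left _ hk
    omega
  have hP : 1 ≤ 2 ^ (3 * m) := Nat.one_le_two_pow
  have hW : 1 ≤ 2 ^ n := Nat.one_le_two_pow
  have hcost1 : (n + 1) * ((K + 1) * (n + 1)) ≤ 4 * X := by
    calc (n + 1) * ((K + 1) * (n + 1)) ≤ 2 ^ n * (4 * (k * m) * 2 ^ n) := by gcongr
      _ = 4 * ((2 ^ n * (2 ^ n * (1 * 1))) * (1 * (1 * 1) * (k * (1 * 1) * ((m * 1) * (1 * 1)))))
          := by ring
      _ ≤ 4 * X := by rw [hXeq]; gcongr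
  refine Halts.seq_le (t := 300 * ((n + 1) * ((K + 1) * (n + 1)))) (t₂ := 120000 * X)
    (halts_loadNFA (k := k) (m := m) (n := n) rfl ?_ ?_ ?_ ?_ ?_) (by omega) ?_
  · simp [inputNFA, DSST.store]
  · simp [inputNFA, DSST.store]
  · simp [inputNFA]
  · simp [inputNFA, DSST.store]
  · simp [inputNFA, DSST.store]
  rintro s₁ ⟨hs₁, h20, hne, -, hedges⟩
  have hl := loaded_of_same (T := T) (s₀ := inputNFA M T) (s := s₁)
    (by intro i hi; simp [inputNFA]; omega) (by funext i; simp [inputNFA])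
    (by funext i; simp [inputNFA]) rfl rfl (hs₁.mono (by intro a ha; omega))
  rw [h20] at hl
  have hE : ∀ e < s₁.num 19 0, s₁.num 21 e < n ∧ s₁.num 23 e < n := by
    intro e he
    obtain ⟨g1, g2, g3, -⟩ := (hedges _ _ _).1 ⟨e, he, rfl, rfl, rfl⟩
    exact ⟨g1, g3⟩
  have hErel : ∀ p j q, s₁.edges p j q ↔ ∃ (hp : p < n) (hq : q < n) (b : RefSym (Fin k) m),
      symAt k m j = some b ∧ (⟨q, hq⟩ : Fin n) ∈ M.step ⟨p, hp⟩ b := by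
    intro p j q
    rw [hedges]
    constructor
    · rintro ⟨hp, hj, hq, -, h1⟩
      exact ⟨hp, hq, (inputNFA_table M T hp hj hq).1 h1⟩
    · rintro ⟨hp, hq, b, h1⟩
      have hj : j < K := symAt_lt h1.1
      refine ⟨hp, hj, hq, ?_, (inputNFA_table M T hp hj hq).2 ⟨b, h1⟩⟩
      calc (p * K + j) * n + q < (p * K + j + 1) * n := by rw [Nat.succ_mul]; omega
        _ ≤ (p * K + K) * n := Nat.mul_le_mul_right _ (by omega)
        _ = (p + 1) * K * n := by ring
        _ ≤ n * K * n := by gcongr; omega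
  have h4 : ∀ i, s₁.num 4 i ≠ 0 ↔ ∃ p ∈ M.start, (p : ℕ) = i := by
    intro i
    rw [(hs₁ 4 (by omega)).1]
    simp [inputNFA]
  have h5 : ∀ i, s₁.num 5 i ≠ 0 ↔ ∃ p ∈ M.accept, (p : ℕ) = i := by
    intro i
    rw [(hs₁ 5 (by omega)).1]
    simp [inputNFA]
  have hlang : pathLang k m s₁.edges (fun p => p < n ∧ s₁.num 4 p ≠ 0) (fun p => s₁.num 5 p ≠ 0) =
      M.accepts := by
    ext w
    rw [NFA.mem_accepts]
    constructor
    · rintro ⟨p, q, ⟨-, hp⟩, hq, h1⟩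
      obtain ⟨p, hp', rfl⟩ := (h4 _).1 hp
      obtain ⟨q, hq', rfl⟩ := (h5 _).1 hq
      exact ⟨q, hq', M.mem_evalFrom_iff_exists.2
        ⟨p, hp', (path_iff_mem_evalFrom M hErel exists_symAt w p q).1 h1⟩⟩
    · rintro ⟨q, hq, h1⟩
      obtain ⟨p, hp, h2⟩ := M.mem_evalFrom_iff_exists.1 h1
      exact ⟨p, q, ⟨p.2, (h4 _).2 ⟨p, hp, rfl⟩⟩, (h5 _).2 ⟨q, hq, rfl⟩,
        (path_iff_mem_evalFrom M hErel exists_symAt w p q).2 h2⟩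
  refine (hl.halts_constructProg hE hk ?_ ?_).mono ?_ ?_
  · intro i
    rw [(hs₁ 11 (by omega)).1]
    simp [inputNFA, DSST.store]
  · rw [(hs₁ 10 (by omega)).1]
    simp [inputNFA, DSST.store]
  -- One factor `n + 1` comes from the construction and two come from the number of the edges; each
  -- is at most `2 ^ n`, which together with the sets gives `2 ^ (4 * n)`. Only two of the three
  -- available factors `2 ^ (3 * m)` are used.
  · calc _ ≤ 40000 * (2 ^ n * (k * (2 ^ (3 * m) * ((n + 1) * (h * (2 ^ (3 * m) *
          (3 * ((n + 1) * ((n + 1) * (k * m)))))))))) := by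
          gcongr
          exact le_trans (by gcongr) hY
      _ ≤ 40000 * (2 ^ n * (k * (2 ^ (3 * m) * (2 ^ n * (h * (2 ^ (3 * m) *
          (3 * (2 ^ n * (2 ^ n * (k * m)))))))))) := by gcongr
      _ = 120000 * ((2 ^ n * ((2 ^ n) * ((2 ^ n) * (2 ^ n)))) *
        (2 ^ (3 * m) * (2 ^ (3 * m) * 1) * (k * (k * 1) * ((m * 1) * (h * 1))))) := by ring
      _ ≤ 120000 * X := by rw [hXeq]; gcongr
  · intro s₂ h2
    refine ⟨_, _, h2, fun D => ?_⟩
    have hlang' : pathLang k m (edgeRel (s₁.num 19 0) (s₁.num 21) (s₁.num 22) (s₁.num 23))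
      (fun p => p < n ∧ s₁.num 4 p ≠ 0) (fun p => s₁.num 5 p ≠ 0) = M.accepts := hlang
    rw [outputNSST_sem hE (by rw [hlang']; exact hM) D, hlang']

end Automata

/-! ### The automaton of an expression. -/

section Expressions

variable {k m : ℕ}

/-- The edges of the node number `i` with the token `v`, whose left child is the node number `l` and
whose last child is the node number `i - 1`. The node number `i` has the states `2 * i` and
`2 * i + 1`, and `k + 2 * m` is the label of the edges that read nothing. -/
def nodeEdges (k m v l i : ℕ) : List (ℕ × ℕ × ℕ) :=
  if v = 0 then [(2 * i, k + 2 * m, 2 * i + 1)]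
  else if v = 1 then [(2 * i, k + 2 * m, 2 * l), (2 * l + 1, k + 2 * m, 2 * (i - 1)),
    (2 * (i - 1) + 1, k + 2 * m, 2 * i + 1)]
  else if v = 2 then [(2 * i, k + 2 * m, 2 * l), (2 * i, k + 2 * m, 2 * (i - 1)),
    (2 * l + 1, k + 2 * m, 2 * i + 1), (2 * (i - 1) + 1, k + 2 * m, 2 * i + 1)]
  else if v = 3 then [(2 * i, k + 2 * m, 2 * i + 1), (2 * i, k + 2 * m, 2 * (i - 1)),
    (2 * (i - 1) + 1, k + 2 * m, 2 * i)]
  else if v < 4 + k then [(2 * i, v - 4, 2 * i + 1)]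
  else [(2 * i, v - 4, 2 * (i - 1)), (2 * (i - 1) + 1, v - 4 + m, 2 * i + 1)]

theorem mem_singletonLang {α : Type*} {v w : List α} : w ∈ ({v} : Language α) ↔ w = v := Iff.rfl

namespace MExpr

theorem one_le_code_length (r : MExpr (Fin k) m) : 1 ≤ r.code.length := by
  cases r <;> simp [code] <;> omega

/-- The operator `x{ }` is a single token but counts as two symbols; all other constructors
contribute the same to both numbers. -/
theorem code_length_le_size (r : MExpr (Fin k) m) : r.code.length ≤ r.size := by
  induction r with
  | eps => simp [code, size]
  | letter => simp [code, size]
  | mul R S ih ih₂ => simp only [code, size, List.length_append, List.length_singleton]; omega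
  | add R S ih ih₂ => simp only [code, size, List.length_append, List.length_singleton]; omega
  | star R ih => simp only [code, size, List.length_append, List.length_singleton]; omega
  | bind x R ih => simp only [code, size, List.length_append, List.length_singleton]; omega

/-- The last node of an expression whose first node has the number `o`. -/
abbrev root (r : MExpr (Fin k) m) (o : ℕ) : ℕ := o + r.code.length - 1

/-- The edges of the automaton of an expression whose first node has the number `o`. -/
def edgeList : MExpr (Fin k) m → ℕ → List (ℕ × ℕ × ℕ)
  | eps, o => nodeEdges k m 0 0 o
  | letter a, o => nodeEdges k m (4 + a) 0 o
  | mul R S, o => R.edgeList o ++ S.edgeList (o + R.code.length) ++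
      nodeEdges k m 1 (R.root o) (o + R.code.length + S.code.length)
  | add R S, o => R.edgeList o ++ S.edgeList (o + R.code.length) ++
      nodeEdges k m 2 (R.root o) (o + R.code.length + S.code.length)
  | star R, o => R.edgeList o ++ nodeEdges k m 3 0 (o + R.code.length)
  | bind x R, o => R.edgeList o ++ nodeEdges k m (4 + k + x) 0 (o + R.code.length)

/-- The words that lead from the first state of the automaton of an expression to a given state
after a word of `X`. -/
def langAt : MExpr (Fin k) m → ℕ → Language (RefSym (Fin k) m) → ℕ → Language (RefSym (Fin k) m)
  | eps, _, X, _ => X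
  | letter a, o, X, p => if p = 2 * o then X else X * {[.letter a]}
  | mul R S, o, X, p =>
    if p < 2 * (o + R.code.length) then R.langAt o X p
    else if p < 2 * (o + R.code.length + S.code.length) then
      S.langAt (o + R.code.length) (X * R.lang) p
    else if p = 2 * (o + R.code.length + S.code.length) then X else X * R.lang * S.lang
  | add R S, o, X, p =>
    if p < 2 * (o + R.code.length) then R.langAt o X p
    else if p < 2 * (o + R.code.length + S.code.length) then S.langAt (o + R.code.length) X p
    else if p = 2 * (o + R.code.length + S.code.length) then X else X * (R.lang + S.lang)
  | star R, o, X, p =>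
    if p < 2 * (o + R.code.length) then R.langAt o (X * KStar.kstar R.lang) p
    else X * KStar.kstar R.lang
  | bind x R, o, X, p =>
    if p < 2 * (o + R.code.length) then R.langAt o (X * {[.opn x]}) p
    else if p = 2 * (o + R.code.length) then X else X * {[.opn x]} * R.lang * {[.cls x]}

/-- Subexpressions occupy disjoint intervals of states. This decides which branch of `langAt`
applies at the ends of an edge. -/
theorem edgeList_bounds (r : MExpr (Fin k) m) : ∀ {o : ℕ} {x : ℕ × ℕ × ℕ}, x ∈ r.edgeList o →
    2 * o ≤ x.1 ∧ x.1 < 2 * (o + r.code.length) ∧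
      2 * o ≤ x.2.2 ∧ x.2.2 < 2 * (o + r.code.length) := by
  induction r with
  | eps =>
    intro o x hx
    simp only [edgeList, nodeEdges, if_true, List.mem_singleton] at hx
    subst hx
    simp only [code, List.length_singleton]
    omega
  | letter a =>
    intro o x hx
    have h1 : 4 + (a : ℕ) < 4 + k := by omega
    simp only [edgeList, nodeEdges] at hx
    rw [if_neg (by omega), if_neg (by omega), if_neg (by omega), if_neg (by omega), if_pos h1,
      List.mem_singleton] at hx
    subst hx
    simp only [code, List.length_singleton]
    omega
  | mul R S ih ih₂ =>
    intro o x hx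
    have hR := R.one_le_code_length
    have hS := S.one_le_code_length
    simp only [code, List.length_append, List.length_singleton]
    simp only [edgeList, List.mem_append] at hx
    rcases hx with (hx | hx) | hx
    · have := ih hx
      omega
    · have := ih₂ hx
      omega
    · simp only [nodeEdges, one_ne_zero, if_false, if_true, List.mem_cons, List.not_mem_nil,
        or_false] at hx
      rcases hx with rfl | rfl | rfl <;> simp only [root] <;> omega
  | add R S ih ih₂ =>
    intro o x hx
    have hR := R.one_le_code_length
    have hS := S.one_le_code_length
    simp only [code, List.length_append, List.length_singleton]
    simp only [edgeList, List.mem_append] at hx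
    rcases hx with (hx | hx) | hx
    · have := ih hx
      omega
    · have := ih₂ hx
      omega
    · simp only [nodeEdges, OfNat.ofNat_ne_zero, OfNat.ofNat_ne_one, if_false, if_true,
        List.mem_cons, List.not_mem_nil, or_false] at hx
      rcases hx with rfl | rfl | rfl | rfl <;> simp only [root] <;> omega
  | star R ih =>
    intro o x hx
    have hR := R.one_le_code_length
    simp only [code, List.length_append, List.length_singleton]
    simp only [edgeList, List.mem_append] at hx
    rcases hx with hx | hx
    · have := ih hx
      omega
    · rw [nodeEdges, if_neg (by omega), if_neg (by omega), if_neg (by omega), if_pos rfl] at hx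
      simp only [List.mem_cons, List.not_mem_nil, or_false] at hx
      rcases hx with rfl | rfl | rfl <;> simp only <;> omega
  | bind y R ih =>
    intro o x hx
    have hR := R.one_le_code_length
    simp only [code, List.length_append, List.length_singleton]
    simp only [edgeList, List.mem_append] at hx
    rcases hx with hx | hx
    · have := ih hx
      omega
    · rw [nodeEdges, if_neg (by omega), if_neg (by omega), if_neg (by omega), if_neg (by omega),
        if_neg (by omega)] at hx
      simp only [List.mem_cons, List.not_mem_nil, or_false] at hx
      rcases hx with rfl | rfl <;> simp only <;> omega

/-- The words that an edge with label `j` reads. -/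
def labelLang (k m j : ℕ) : Language (RefSym (Fin k) m) :=
  match symAt k m j with
  | none => 1
  | some b => {[b]}

theorem labelLang_eps : labelLang k m (k + 2 * m) = 1 := by
  have : symAt k m (k + 2 * m) = none := by
    unfold symAt
    rw [dif_neg (by omega), dif_neg (by omega), dif_neg (by omega)]
  simp [labelLang, this]

theorem symAt_letter (a : Fin k) : symAt k m a = some (.letter a) := symAt_eq_letter.2 rfl

theorem symAt_opn (x : Fin m) : symAt k m (k + x) = some (.opn x) := by simp [symAt]

theorem symAt_cls (x : Fin m) : symAt k m (k + x + m) = some (.cls x) := by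
  unfold symAt
  rw [dif_neg (by omega), dif_neg (by omega), dif_pos (by omega)]
  simp only [Option.some.injEq, RefSym.cls.injEq, Fin.ext_iff]
  omega

/-- Equality fails for a star: its first state is also entered after each iteration, so its language
is `X` times the star. -/
theorem le_langAt (r : MExpr (Fin k) m) : ∀ (o : ℕ) (X : Language (RefSym (Fin k) m)),
    X ≤ r.langAt o X (2 * r.root o) := by
  have hstar : ∀ X L : Language (RefSym (Fin k) m), X ≤ X * KStar.kstar L := by
    intro X L
    calc X = X * 1 := (mul_one X).symm
      _ ≤ _ := mul_le_mul_right one_le_kstar X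
  cases r with
  | eps => exact fun o X => le_rfl
  | letter a =>
    intro o X
    simp [langAt, root, code]
  | mul R S =>
    intro o X
    simp only [langAt, root, code, List.length_append, List.length_singleton]
    rw [if_neg (by omega), if_neg (by omega), if_pos (by omega)]
  | add R S =>
    intro o X
    simp only [langAt, root, code, List.length_append, List.length_singleton]
    rw [if_neg (by omega), if_neg (by omega), if_pos (by omega)]
  | star R =>
    intro o X
    simp only [langAt, root, code, List.length_append, List.length_singleton]
    rw [if_neg (by omega)]
    exact hstar X _
  | bind x R =>
    intro o X
    simp only [langAt, root, code, List.length_append, List.length_singleton]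
    rw [if_neg (by omega), if_pos (by omega)]

theorem langAt_end (r : MExpr (Fin k) m) (o : ℕ) (X : Language (RefSym (Fin k) m)) :
    r.langAt o X (2 * r.root o + 1) = X * r.lang := by
  cases r with
  | eps => simp [langAt, lang]
  | letter a => simp [langAt, lang, root, code]
  | mul R S =>
    simp only [langAt, root, code, List.length_append, List.length_singleton, lang]
    rw [if_neg (by omega), if_neg (by omega), if_neg (by omega), mul_assoc]
  | add R S =>
    simp only [langAt, root, code, List.length_append, List.length_singleton, lang]
    rw [if_neg (by omega), if_neg (by omega), if_neg (by omega)]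
  | star R =>
    simp only [langAt, root, code, List.length_append, List.length_singleton, lang]
    rw [if_neg (by omega)]
  | bind x R =>
    simp only [langAt, root, code, List.length_append, List.length_singleton, lang]
    rw [if_neg (by omega), if_neg (by omega), mul_assoc, mul_assoc, mul_assoc]

/-- The languages `langAt` form an invariant: following an edge never leaves them. Since the one at
the last state is `X * r.lang` by `langAt_end`, paths from the first to the last state read only
words of the expression. -/
theorem langAt_edge (r : MExpr (Fin k) m) : ∀ (o : ℕ) (X : Language (RefSym (Fin k) m))
    (x : ℕ × ℕ × ℕ), x ∈ r.edgeList o →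
    r.langAt o X x.1 * labelLang k m x.2.1 ≤ r.langAt o X x.2.2 := by
  induction r with
  | eps =>
    intro o X x hx
    simp only [edgeList, nodeEdges, if_true, List.mem_singleton] at hx
    subst hx
    simp [langAt, labelLang_eps]
  | letter a =>
    intro o X x hx
    have h1 : 4 + (a : ℕ) < 4 + k := by omega
    simp only [edgeList, nodeEdges] at hx
    rw [if_neg (by omega), if_neg (by omega), if_neg (by omega), if_neg (by omega), if_pos h1,
      List.mem_singleton] at hx
    subst hx
    simp [langAt, labelLang, symAt_letter]
  | mul R S ih ih₂ =>
    intro o X x hx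
    have hR := R.one_le_code_length
    have hS := S.one_le_code_length
    simp only [edgeList, List.mem_append] at hx
    rcases hx with (hx | hx) | hx
    · have hb := R.edgeList_bounds hx
      simp only [langAt]
      rw [if_pos (by omega), if_pos (by omega)]
      exact ih o X x hx
    · have hb := S.edgeList_bounds hx
      simp only [langAt]
      rw [if_neg (by omega), if_pos (by omega), if_neg (by omega), if_pos (by omega)]
      exact ih₂ _ _ x hx
    · simp only [nodeEdges, one_ne_zero, if_false, if_true, List.mem_cons, List.not_mem_nil,
        or_false] at hx
      rcases hx with rfl | rfl | rfl <;> simp only [langAt, labelLang_eps, mul_one]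
      · rw [if_neg (by omega), if_neg (by omega), if_pos trivial, if_pos (by simp only [root]; omega)]
        exact R.le_langAt o X
      · rw [if_pos (by simp only [root]; omega), if_neg (by omega), if_pos (by omega),
          langAt_end]
        exact S.le_langAt _ _
      · rw [if_neg (by omega), if_pos (by omega), if_neg (by omega), if_neg (by omega),
          if_neg (by omega)]
        exact (S.langAt_end _ _).le
  | add R S ih ih₂ =>
    intro o X x hx
    have hR := R.one_le_code_length
    have hS := S.one_le_code_length
    simp only [edgeList, List.mem_append] at hx
    rcases hx with (hx | hx) | hx
    · have hb := R.edgeList_bounds hx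
      simp only [langAt]
      rw [if_pos (by omega), if_pos (by omega)]
      exact ih o X x hx
    · have hb := S.edgeList_bounds hx
      simp only [langAt]
      rw [if_neg (by omega), if_pos (by omega), if_neg (by omega), if_pos (by omega)]
      exact ih₂ _ _ x hx
    · simp only [nodeEdges, OfNat.ofNat_ne_zero, OfNat.ofNat_ne_one, if_false, if_true,
        List.mem_cons, List.not_mem_nil, or_false] at hx
      rcases hx with rfl | rfl | rfl | rfl <;> simp only [langAt, labelLang_eps, mul_one]
      · rw [if_neg (by omega), if_neg (by omega), if_pos trivial, if_pos (by simp only [root]; omega)]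
        exact R.le_langAt o X
      · rw [if_neg (by omega), if_neg (by omega), if_pos trivial, if_neg (by omega), if_pos (by omega)]
        exact S.le_langAt _ X
      · rw [if_pos (by simp only [root]; omega), if_neg (by omega), if_neg (by omega),
          if_neg (by omega), langAt_end, mul_add]
        exact le_self_add
      · rw [if_neg (by omega), if_pos (by omega), if_neg (by omega), if_neg (by omega),
          if_neg (by omega), mul_add]
        exact (S.langAt_end _ _).le.trans le_add_self
  | star R ih =>
    intro o X x hx
    have hR := R.one_le_code_length
    simp only [edgeList, List.mem_append] at hx
    rcases hx with hx | hx
    · have hb := R.edgeList_bounds hx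
      simp only [langAt]
      rw [if_pos (by omega), if_pos (by omega)]
      exact ih _ _ x hx
    · rw [nodeEdges, if_neg (by omega), if_neg (by omega), if_neg (by omega), if_pos rfl] at hx
      simp only [List.mem_cons, List.not_mem_nil, or_false] at hx
      rcases hx with rfl | rfl | rfl <;> simp only [langAt, labelLang_eps, mul_one]
      · rw [if_neg (by omega), if_neg (by omega)]
      · rw [if_neg (by omega), if_pos (by omega)]
        exact R.le_langAt _ _
      -- The edge back to the first state after one iteration stays in the invariant because `L* L ⊆
      -- L*`; this is why the inner expression is started with `X` times the star.
      · rw [if_pos (by omega), if_neg (by omega)]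
        refine (R.langAt_end _ _).le.trans ?_
        rw [mul_assoc]
        exact mul_le_mul_right kstar_mul_le_kstar X
  | bind y R ih =>
    intro o X x hx
    have hR := R.one_le_code_length
    simp only [edgeList, List.mem_append] at hx
    rcases hx with hx | hx
    · have hb := R.edgeList_bounds hx
      simp only [langAt]
      rw [if_pos (by omega), if_pos (by omega)]
      exact ih _ _ x hx
    · rw [nodeEdges, if_neg (by omega), if_neg (by omega), if_neg (by omega), if_neg (by omega),
        if_neg (by omega)] at hx
      have e1 : 4 + k + (y : ℕ) - 4 = k + y := by omega
      rw [e1] at hx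
      simp only [List.mem_cons, List.not_mem_nil, or_false] at hx
      rcases hx with rfl | rfl <;> simp only [langAt, labelLang, symAt_opn, symAt_cls]
      · rw [if_neg (by omega), if_pos trivial, if_pos (by omega)]
        exact R.le_langAt _ _
      · rw [if_pos (by omega), if_neg (by omega), if_neg (by omega)]
        exact mul_le_mul_left (R.langAt_end _ _).le _

end MExpr

theorem Path.append {E : ℕ → ℕ → ℕ → Prop} {p q r : ℕ} {u v : List (RefSym (Fin k) m)}
    (h : Path E p u q) (h₂ : Path E q v r) : Path E p (u ++ v) r := by
  induction h with
  | nil => exact h₂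
  | eps h1 h2 _ ih => exact .eps h1 h2 (ih h₂)
  | sym h1 h2 _ ih => exact .sym h1 h2 (ih h₂)

/-- An invariant that is closed under every edge is closed under paths. -/
theorem Path.mem_of_closed {E : ℕ → ℕ → ℕ → Prop} {A : ℕ → Language (RefSym (Fin k) m)}
    (hA : ∀ p j q, E p j q → A p * MExpr.labelLang k m j ≤ A q) {p q : ℕ}
    {w : List (RefSym (Fin k) m)} (h : Path E p w q) : ∀ {u}, u ∈ A p → u ++ w ∈ A q := by
  induction h with
  | nil => intro u hu; simpa using hu
  | @eps p j q r w h1 h2 _ ih =>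
    intro u hu
    have : u ∈ A p * MExpr.labelLang k m j := by
      rw [MExpr.labelLang, h2, mul_one]
      exact hu
    exact ih (hA _ _ _ h1 this)
  | @sym p j q r b w h1 h2 _ ih =>
    intro u hu
    have : u ++ [b] ∈ A q := by
      refine hA _ _ _ h1 (Language.append_mem_mul hu ?_)
      rw [MExpr.labelLang, h2]
      exact rfl
    simpa using ih this

namespace MExpr

/-- The converse of the invariant: the paths of the subexpressions are joined by the edges of the
node. For a star the path returns to the first state after each factor, and from there it continues
or leaves. -/
theorem path_of_mem_lang {E : ℕ → ℕ → ℕ → Prop} (r : MExpr (Fin k) m) : ∀ (o : ℕ),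
    (∀ x ∈ r.edgeList o, E x.1 x.2.1 x.2.2) → ∀ w ∈ r.lang,
      Path E (2 * r.root o) w (2 * r.root o + 1) := by
  have heps : symAt k m (k + 2 * m) = none := by
    unfold symAt
    rw [dif_neg (by omega), dif_neg (by omega), dif_neg (by omega)]
  have step : ∀ {p q r : ℕ} {w : List (RefSym (Fin k) m)}, E p (k + 2 * m) q → Path E q w r →
      Path E p w r := fun h1 h2 => .eps h1 heps h2
  induction r with
  | eps =>
    intro o hE w hw
    rw [lang, Language.mem_one] at hw
    subst hw
    simp only [edgeList, nodeEdges, if_true, List.mem_singleton, forall_eq] at hE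
    simpa [root, code] using step hE (.nil _)
  | letter a =>
    intro o hE w hw
    rw [lang, mem_singletonLang] at hw
    subst hw
    have h1 : 4 + (a : ℕ) < 4 + k := by omega
    simp only [edgeList, nodeEdges] at hE
    rw [if_neg (by omega), if_neg (by omega), if_neg (by omega), if_neg (by omega), if_pos h1] at hE
    simp only [List.mem_singleton, forall_eq, Nat.add_sub_cancel_left] at hE
    simpa [root, code] using Path.sym hE (symAt_letter a) (.nil _)
  | mul R S ih ih₂ =>
    intro o hE w hw
    rw [lang, Language.mem_mul] at hw
    obtain ⟨u, hu, v, hv, rfl⟩ := hw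
    have p1 := ih o (fun x hx => hE x (by simp [edgeList, hx])) u hu
    have p2 := ih₂ (o + R.code.length) (fun x hx => hE x (by simp [edgeList, hx])) v hv
    have hn : ∀ x ∈ nodeEdges k m 1 (R.root o) (o + R.code.length + S.code.length),
        E x.1 x.2.1 x.2.2 := fun x hx => hE x (by simp [edgeList, hx])
    simp only [nodeEdges, one_ne_zero, if_false, if_true, List.mem_cons, List.not_mem_nil,
      or_false, forall_eq_or_imp, forall_eq] at hn
    obtain ⟨h1, h2, h3⟩ := hn
    have h4 := step h1 ((p1.append (step h2 (p2.append (step h3 (.nil _))))))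
    have hroot : (R.mul S).root o = o + R.code.length + S.code.length := by
      simp only [root, code, List.length_append, List.length_singleton]
      omega
    rw [hroot]
    simpa using h4
  | add R S ih ih₂ =>
    intro o hE w hw
    rw [lang, Language.mem_add] at hw
    have hn : ∀ x ∈ nodeEdges k m 2 (R.root o) (o + R.code.length + S.code.length),
        E x.1 x.2.1 x.2.2 := fun x hx => hE x (by simp [edgeList, hx])
    simp only [nodeEdges, OfNat.ofNat_ne_zero, OfNat.ofNat_ne_one, if_false, if_true,
      List.mem_cons, List.not_mem_nil, or_false, forall_eq_or_imp, forall_eq] at hn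
    obtain ⟨h1, h2, h3, h4⟩ := hn
    have hroot : (R.add S).root o = o + R.code.length + S.code.length := by
      simp only [root, code, List.length_append, List.length_singleton]
      omega
    rw [hroot]
    rcases hw with hw | hw
    · have p1 := ih o (fun x hx => hE x (by simp [edgeList, hx])) w hw
      simpa using step h1 (p1.append (step h3 (.nil _)))
    · have p2 := ih₂ (o + R.code.length) (fun x hx => hE x (by simp [edgeList, hx])) w hw
      simpa using step h2 (p2.append (step h4 (.nil _)))
  | star R ih =>
    intro o hE w hw
    rw [lang, Language.mem_kstar] at hw
    obtain ⟨L, rfl, hL⟩ := hw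
    have hn : ∀ x ∈ nodeEdges k m 3 0 (o + R.code.length),
        E x.1 x.2.1 x.2.2 := fun x hx => hE x (by simp [edgeList, hx])
    rw [nodeEdges, if_neg (by omega), if_neg (by omega), if_neg (by omega), if_pos rfl] at hn
    simp only [List.mem_cons, List.not_mem_nil, or_false, forall_eq_or_imp, forall_eq] at hn
    obtain ⟨h1, h2, h3⟩ := hn
    have hroot : R.star.root o = o + R.code.length := by
      simp only [root, code, List.length_append, List.length_singleton]
      omega
    rw [hroot]
    induction L with
    | nil => exact step h1 (.nil _)
    | cons u L ihL =>
      have p1 := ih o (fun x hx => hE x (by simp [edgeList, hx])) u (hL u (by simp))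
      exact step h2 (p1.append (step h3 (ihL fun y hy => hL y (by simp [hy]))))
  | bind y R ih =>
    intro o hE w hw
    rw [lang, mul_assoc, Language.mem_mul] at hw
    obtain ⟨u, hu, v, hv, rfl⟩ := hw
    rw [Language.mem_mul] at hv
    obtain ⟨v, hv, z, hz, rfl⟩ := hv
    rw [mem_singletonLang] at hu hz
    subst hu hz
    have p1 := ih o (fun x hx => hE x (by simp [edgeList, hx])) v hv
    have hn : ∀ x ∈ nodeEdges k m (4 + k + y) 0 (o + R.code.length),
        E x.1 x.2.1 x.2.2 := fun x hx => hE x (by simp [edgeList, hx])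
    have e1 : 4 + k + (y : ℕ) - 4 = k + y := by omega
    rw [nodeEdges, if_neg (by omega), if_neg (by omega), if_neg (by omega), if_neg (by omega),
        if_neg (by omega), e1] at hn
    simp only [List.mem_cons, List.not_mem_nil, or_false, forall_eq_or_imp, forall_eq] at hn
    have hroot : (R.bind y).root o = o + R.code.length := by
      simp only [root, code, List.length_append, List.length_singleton]
      omega
    rw [hroot]
    exact .sym hn.1 (symAt_opn y) (p1.append (.sym hn.2 (symAt_cls y) (.nil _)))

/-- One inclusion is the invariant `langAt` started with `X = 1`, the other one is
`path_of_mem_lang`. -/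
theorem pathLang_eq_lang (r : MExpr (Fin k) m) {E : ℕ → ℕ → ℕ → Prop}
    (hE : ∀ p j q, E p j q ↔ (p, j, q) ∈ r.edgeList 0) {I F : ℕ → Prop}
    (hI : ∀ p, I p ↔ p = 2 * r.root 0) (hF : ∀ p, F p ↔ p = 2 * r.root 0 + 1) :
    pathLang k m E I F = r.lang := by
  ext w
  constructor
  · rintro ⟨p, q, hp, hq, h1⟩
    rw [hI] at hp
    rw [hF] at hq
    subst hp hq
    have h2 := h1.mem_of_closed (A := r.langAt 0 1)
      (fun p j q h => r.langAt_edge 0 1 (p, j, q) ((hE p j q).1 h))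
      (u := []) (r.le_langAt 0 1 (Language.nil_mem_one))
    rwa [langAt_end, one_mul] at h2
  · intro hw
    exact ⟨_, _, (hI _).2 rfl, (hF _).2 rfl,
      r.path_of_mem_lang 0 (fun x hx => (hE _ _ _).2 hx) w hw⟩

/-! #### The words of an expression are multiref-words -/

open Classical in
theorem filter_eq_nil_of_not_mentions {A : Type*} (r : MExpr A m) {x : Fin m}
    (hx : ¬ r.Mentions x) : ∀ w ∈ r.lang,
      w.filter (fun s => s = .opn x ∨ s = .cls x) = [] := by
  induction r with
  | eps =>
    intro w hw
    rw [lang, Language.mem_one] at hw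
    simp [hw]
  | letter a =>
    intro w hw
    rw [lang, mem_singletonLang] at hw
    simp [hw]
  | mul R S ih ih₂ =>
    intro w hw
    simp only [Mentions, not_or] at hx
    obtain ⟨u, hu, v, hv, rfl⟩ := Language.mem_mul.1 hw
    rw [List.filter_append, ih hx.1 u hu, ih₂ hx.2 v hv, List.append_nil]
  | add R S ih ih₂ =>
    intro w hw
    simp only [Mentions, not_or] at hx
    rcases (Language.mem_add _ _ _).1 hw with hw | hw
    · exact ih hx.1 w hw
    · exact ih₂ hx.2 w hw
  | star R ih =>
    intro w hw
    obtain ⟨L, rfl, hL⟩ := Language.mem_kstar.1 hw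
    clear hw
    induction L with
    | nil => rfl
    | cons u L ihL =>
      rw [List.flatten_cons, List.filter_append, ih hx u (hL u (by simp)),
        ihL (fun y hy => hL y (by simp [hy])), List.append_nil]
  | bind y R ih =>
    intro w hw
    simp only [Mentions, not_or] at hx
    rw [lang, mul_assoc] at hw
    obtain ⟨u, hu, v, hv, rfl⟩ := Language.mem_mul.1 hw
    obtain ⟨v, hv', z, hz, rfl⟩ := Language.mem_mul.1 hv
    rw [mem_singletonLang] at hu hz
    subst hu hz
    rw [List.filter_append, List.filter_append, ih hx.2 v hv']
    simp [Ne.symm hx.1]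

theorem isMultirefWord_nil {A : Type*} : IsMultirefWord ([] : List (RefSym A m)) :=
  fun _ => ⟨0, rfl⟩

theorem isMultirefWord_append {A : Type*} {u v : List (RefSym A m)} (hu : IsMultirefWord u)
    (hv : IsMultirefWord v) : IsMultirefWord (u ++ v) := by
  intro x
  obtain ⟨c, hc⟩ := hu x
  obtain ⟨d, hd⟩ := hv x
  exact ⟨c + d, by rw [List.filter_append, hc, hd, List.replicate_add, List.flatten_append]⟩

/-- The side condition of the grammar is needed only for `x{R}`: no bracket of `x` occurs in the
words of `R`, so the brackets of `x` are exactly one opening and one closing bracket. -/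
theorem isMultirefWord_of_mem_lang {A : Type*} (r : MExpr A m) (hr : r.WellFormed) :
    ∀ w ∈ r.lang, IsMultirefWord w := by
  induction r with
  | eps =>
    intro w hw
    rw [lang, Language.mem_one] at hw
    rw [hw]
    exact isMultirefWord_nil
  | letter a =>
    intro w hw x
    rw [lang, mem_singletonLang] at hw
    exact ⟨0, by simp [hw]⟩
  | mul R S ih ih₂ =>
    intro w hw
    obtain ⟨u, hu, v, hv, rfl⟩ := Language.mem_mul.1 hw
    exact isMultirefWord_append (ih hr.1 u hu) (ih₂ hr.2 v hv)
  | add R S ih ih₂ =>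
    intro w hw
    rcases (Language.mem_add _ _ _).1 hw with hw | hw
    · exact ih hr.1 w hw
    · exact ih₂ hr.2 w hw
  | star R ih =>
    intro w hw
    obtain ⟨L, rfl, hL⟩ := Language.mem_kstar.1 hw
    clear hw
    induction L with
    | nil => exact isMultirefWord_nil
    | cons u L ihL =>
      rw [List.flatten_cons]
      exact isMultirefWord_append (ih hr u (hL u (by simp))) (ihL fun y hy => hL y (by simp [hy]))
  | bind y R ih =>
    intro w hw x
    rw [lang, mul_assoc] at hw
    obtain ⟨u, hu, v, hv, rfl⟩ := Language.mem_mul.1 hw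
    obtain ⟨v, hv', z, hz, rfl⟩ := Language.mem_mul.1 hv
    rw [mem_singletonLang] at hu hz
    subst hu hz
    by_cases hxy : x = y
    · subst hxy
      refine ⟨1, ?_⟩
      rw [List.filter_append, List.filter_append, filter_eq_nil_of_not_mentions R hr.1 v hv']
      simp
    · obtain ⟨c, hc⟩ := ih hr.2 v hv' x
      refine ⟨c, ?_⟩
      rw [List.filter_append, List.filter_append, hc]
      simp [Ne.symm hxy]

end MExpr

end Expressions

/-! ### Building the automaton from the postfix code. -/

section LoadExpression

variable {R Ω : Type*} {h k m : ℕ} {T : DSST (Fin h) (RefSym (Fin k) m) R Ω}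
  {s s₁ : Store R Ω}

/-! #### The lengths of the subexpressions -/

/-- The length of the subexpression that ends with the token `v` at position `i`, where `L` maps
earlier positions to lengths. -/
def nodeLen (k : ℕ) (L : ℕ → ℕ) (v i : ℕ) : ℕ :=
  if v = 0 then 1
  else if v = 1 ∨ v = 2 then 1 + L (i - 1) + L (i - 1 - L (i - 1))
  else if v = 3 then 1 + L (i - 1)
  else if v < 4 + k then 1
  else 1 + L (i - 1)

/-- The lengths of the subexpressions that end at the first positions. -/
def lenTab (k : ℕ) (c : ℕ → ℕ) : ℕ → ℕ → ℕ
  | 0 => fun _ => 0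
  | j + 1 => Function.update (lenTab k c j) j (nodeLen k (lenTab k c j) (c j) j)

theorem lenTab_of_lt (c : ℕ → ℕ) {i : ℕ} : ∀ {j : ℕ}, i < j →
    lenTab k c j i = nodeLen k (lenTab k c i) (c i) i := by
  intro j
  induction j with
  | zero => exact fun h => absurd h (by omega)
  | succ j ih =>
    intro hij
    rw [lenTab, Function.update_apply]
    split_ifs with h1
    · rw [h1]
    · exact ih (by omega)

/-- The edges of the node at position `i`. -/
def edgesAtPos (k m : ℕ) (c : ℕ → ℕ) (i : ℕ) : List (ℕ × ℕ × ℕ) :=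
  nodeEdges k m (c i) (i - 1 - lenTab k c i (i - 1)) i

/-- The code of `r` is at position `o`. -/
def Placed (c : ℕ → ℕ) (r : MExpr (Fin k) m) (o : ℕ) : Prop :=
  ∀ t < r.code.length, c (o + t) = r.code.getD t 0

theorem Placed.left {c : ℕ → ℕ} {r R : MExpr (Fin k) m} {o : ℕ} (hp : Placed c r o) {l : List ℕ}
    (h : r.code = R.code ++ l) : Placed c R o := by
  intro t ht
  rw [hp t (by rw [h, List.length_append]; omega), h, List.getD_append _ _ _ _ ht]

theorem Placed.right {c : ℕ → ℕ} {r S : MExpr (Fin k) m} {o : ℕ} (hp : Placed c r o)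
    {l l' : List ℕ} (h : r.code = l ++ S.code ++ l') : Placed c S (o + l.length) := by
  intro t ht
  rw [add_assoc, hp _ (by rw [h, List.length_append, List.length_append]; omega), h,
    List.append_assoc, List.getD_append_right _ _ _ _ (by omega), Nat.add_sub_cancel_left,
    List.getD_append _ _ _ _ ht]

theorem Placed.last {c : ℕ → ℕ} {r : MExpr (Fin k) m} {o v : ℕ} (hp : Placed c r o)
    {l : List ℕ} (h : r.code = l ++ [v]) : c (o + l.length) = v := by
  rw [hp _ (by rw [h, List.length_append, List.length_singleton]; omega), h,
    List.getD_append_right _ _ _ _ le_rfl]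
  simp

/-- The invariant for a subexpression. -/
theorem Placed.spec {c : ℕ → ℕ} : ∀ {r : MExpr (Fin k) m} {o : ℕ}, Placed c r o →
    lenTab k c (o + r.code.length) (r.root o) = r.code.length ∧
    ∀ x, (∃ i, o ≤ i ∧ i < o + r.code.length ∧ x ∈ edgesAtPos k m c i) ↔ x ∈ r.edgeList o := by
  have single : ∀ (o : ℕ) (x : ℕ × ℕ × ℕ),
      (∃ i, o ≤ i ∧ i < o + 1 ∧ x ∈ edgesAtPos k m c i) ↔ x ∈ edgesAtPos k m c o := by
    intro o x
    constructor
    · rintro ⟨i, h1, h2, h3⟩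
      obtain rfl : i = o := by omega
      exact h3
    · exact fun h => ⟨o, le_rfl, by omega, h⟩
  have split : ∀ (o a b : ℕ) (x : ℕ × ℕ × ℕ),
      (∃ i, o ≤ i ∧ i < o + (a + b) ∧ x ∈ edgesAtPos k m c i) ↔
        (∃ i, o ≤ i ∧ i < o + a ∧ x ∈ edgesAtPos k m c i) ∨
        (∃ i, o + a ≤ i ∧ i < o + a + b ∧ x ∈ edgesAtPos k m c i) := by
    intro o a b x
    constructor
    · rintro ⟨i, h1, h2, h3⟩
      by_cases h4 : i < o + a
      · exact .inl ⟨i, h1, h4, h3⟩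
      · exact .inr ⟨i, by omega, by omega, h3⟩
    · rintro (⟨i, h1, h2, h3⟩ | ⟨i, h1, h2, h3⟩)
      · exact ⟨i, h1, by omega, h3⟩
      · exact ⟨i, by omega, by omega, h3⟩
  intro r
  induction r with
  | eps =>
    intro o hp
    have hv : c o = 0 := by simpa [MExpr.code] using hp 0 (by simp [MExpr.code])
    simp only [MExpr.code, List.length_singleton, MExpr.root, Nat.add_sub_cancel]
    refine ⟨by rw [lenTab_of_lt c (by omega), hv]; rfl, fun x => ?_⟩
    rw [single, edgesAtPos, hv]
    rfl
  | letter a =>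
    intro o hp
    have hv : c o = 4 + a := by simpa [MExpr.code] using hp 0 (by simp [MExpr.code])
    have ha := a.2
    simp only [MExpr.code, List.length_singleton, MExpr.root, Nat.add_sub_cancel]
    refine ⟨?_, fun x => ?_⟩
    · rw [lenTab_of_lt c (by omega), hv, nodeLen, if_neg (by omega), if_neg (by omega),
        if_neg (by omega), if_pos (by omega)]
    · rw [single, edgesAtPos, hv, MExpr.edgeList]
      -- The left child matters only for the tokens `1` and `2`; for all others the value computed
      -- for it is meaningless and ignored.
      simp only [nodeEdges, show 4 + (a : ℕ) ≠ 1 by omega, show 4 + (a : ℕ) ≠ 2 by omega, if_false]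
  | mul A B ih ih₂ =>
    intro o hp
    obtain ⟨hA, eA⟩ := ih (hp.left (l := B.code ++ [1]) (by simp [MExpr.code]))
    obtain ⟨hB, eB⟩ := ih₂ (hp.right (l := A.code) (l' := [1]) (by simp [MExpr.code]))
    have hv : c (o + (A.code.length + B.code.length)) = 1 := by
      have := hp.last (l := A.code ++ B.code) (v := 1) (by simp [MExpr.code])
      rwa [List.length_append] at this
    have pA := A.one_le_code_length
    have pB := B.one_le_code_length
    set i := o + (A.code.length + B.code.length) with hi
    have hlen : (A.mul B).code.length = A.code.length + B.code.length + 1 := by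
      simp [MExpr.code]; omega
    -- In postfix notation the right child ends at `i - 1`; stepping back by its length leads to the
    -- end of the left child, which is its root.
    have l1 : lenTab k c i (i - 1) = B.code.length := by
      rw [← hB, hi, ← add_assoc]
    have l2 : i - 1 - B.code.length = A.root o := by simp only [MExpr.root]; omega
    -- Entries of the table never change once written, so the length found for the left child is
    -- still there.
    have l3 : lenTab k c i (A.root o) = A.code.length := by
      rw [← hA, lenTab_of_lt c (by simp only [MExpr.root]; omega),
        lenTab_of_lt c (by simp only [MExpr.root]; omega)]
    rw [MExpr.root, hlen, show o + (A.code.length + B.code.length + 1) - 1 = i by omega,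
      show o + (A.code.length + B.code.length + 1) = i + 1 by omega]
    refine ⟨?_, fun x => ?_⟩
    · rw [lenTab_of_lt c (by omega), hv, nodeLen, if_neg (by omega), if_pos (by omega), l1, l2, l3]
      omega
    · rw [hi, show o + (A.code.length + B.code.length) + 1 = o + (A.code.length + B.code.length + 1)
        by omega, split, split, ← hi, single, eA, eB, edgesAtPos, hv, l1, l2, MExpr.edgeList,
        List.mem_append, List.mem_append, hi, ← add_assoc]
  | add A B ih ih₂ =>
    intro o hp
    obtain ⟨hA, eA⟩ := ih (hp.left (l := B.code ++ [2]) (by simp [MExpr.code]))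
    obtain ⟨hB, eB⟩ := ih₂ (hp.right (l := A.code) (l' := [2]) (by simp [MExpr.code]))
    have hv : c (o + (A.code.length + B.code.length)) = 2 := by
      have := hp.last (l := A.code ++ B.code) (v := 2) (by simp [MExpr.code])
      rwa [List.length_append] at this
    have pA := A.one_le_code_length
    have pB := B.one_le_code_length
    set i := o + (A.code.length + B.code.length) with hi
    have hlen : (A.add B).code.length = A.code.length + B.code.length + 1 := by
      simp [MExpr.code]; omega
    have l1 : lenTab k c i (i - 1) = B.code.length := by
      rw [← hB, hi, ← add_assoc]
    have l2 : i - 1 - B.code.length = A.root o := by simp only [MExpr.root]; omega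
    have l3 : lenTab k c i (A.root o) = A.code.length := by
      rw [← hA, lenTab_of_lt c (by simp only [MExpr.root]; omega),
        lenTab_of_lt c (by simp only [MExpr.root]; omega)]
    rw [MExpr.root, hlen, show o + (A.code.length + B.code.length + 1) - 1 = i by omega,
      show o + (A.code.length + B.code.length + 1) = i + 1 by omega]
    refine ⟨?_, fun x => ?_⟩
    · rw [lenTab_of_lt c (by omega), hv, nodeLen, if_neg (by omega), if_pos (by omega), l1, l2, l3]
      omega
    · rw [hi, show o + (A.code.length + B.code.length) + 1 = o + (A.code.length + B.code.length + 1)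
        by omega, split, split, ← hi, single, eA, eB, edgesAtPos, hv, l1, l2, MExpr.edgeList,
        List.mem_append, List.mem_append, hi, ← add_assoc]
  | star A ih =>
    intro o hp
    obtain ⟨hA, eA⟩ := ih (hp.left (l := [3]) (by simp [MExpr.code]))
    have hv : c (o + A.code.length) = 3 := hp.last (l := A.code) (v := 3) (by simp [MExpr.code])
    have pA := A.one_le_code_length
    have hlen : A.star.code.length = A.code.length + 1 := by simp [MExpr.code]
    rw [MExpr.root, hlen]
    refine ⟨?_, fun x => ?_⟩
    · rw [show o + (A.code.length + 1) - 1 = o + A.code.length by omega, lenTab_of_lt c (by omega),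
        hv, nodeLen, if_neg (by omega), if_neg (by omega), if_pos rfl, hA]
      omega
    · rw [split, single, eA, edgesAtPos, hv, MExpr.edgeList, List.mem_append]
      rfl
  | bind y A ih =>
    intro o hp
    obtain ⟨hA, eA⟩ := ih (hp.left (l := [4 + k + y]) (by simp [MExpr.code]))
    have hv : c (o + A.code.length) = 4 + k + y :=
      hp.last (l := A.code) (v := 4 + k + y) (by simp [MExpr.code])
    have pA := A.one_le_code_length
    have hlen : (A.bind y).code.length = A.code.length + 1 := by simp [MExpr.code]
    rw [MExpr.root, hlen]
    refine ⟨?_, fun x => ?_⟩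
    · rw [show o + (A.code.length + 1) - 1 = o + A.code.length by omega, lenTab_of_lt c (by omega),
        hv, nodeLen, if_neg (by omega), if_neg (by omega), if_neg (by omega), if_neg (by omega), hA]
      omega
    · rw [split, single, eA, edgesAtPos, hv, MExpr.edgeList, List.mem_append]
      simp only [nodeEdges, show 4 + k + (y : ℕ) ≠ 1 by omega, show 4 + k + (y : ℕ) ≠ 2 by omega, if_false]

/-! #### The program -/

/-- Append several edges to the list. -/
def addEdges : List (NExpr × NExpr × NExpr) → Prog
  | [] => .skip
  | x :: l => .seq (addEdge x.1 x.2.1 x.2.2) (addEdges l)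

theorem addEdges_writes (l : List (NExpr × NExpr × NExpr)) :
    ∀ a ∈ (addEdges l).writes, 19 ≤ a ∧ a < 24 := by
  induction l with
  | nil => simp [addEdges, Prog.writes]
  | cons x l ih =>
    intro a ha
    simp only [addEdges, Prog.writes, addEdge_writes, List.mem_append, List.mem_cons,
      List.not_mem_nil, or_false] at ha
    rcases ha with ha | ha
    · omega
    · exact ih a ha

theorem addEdges_run (l : List (NExpr × NExpr × NExpr)) : ∀ {s : Store R Ω},
    (∀ x ∈ l, x.1.NoEdge ∧ x.2.1.NoEdge ∧ x.2.2.NoEdge) →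
    ((addEdges l).run s).num 19 0 = s.num 19 0 + l.length ∧
    ∀ p j q, ((addEdges l).run s).edges p j q ↔ s.edges p j q ∨
      (p, j, q) ∈ l.map fun x => (x.1.eval s, x.2.1.eval s, x.2.2.eval s) := by
  induction l with
  | nil => intro s _; simp [addEdges, Prog.run]
  | cons x l ih =>
    intro s hl
    obtain ⟨h1, h2, h3⟩ := hl x (by simp)
    obtain ⟨e1, e2⟩ := addEdge_run (s := s) (p := x.1) h2 h3
    set s₁ := (addEdge x.1 x.2.1 x.2.2).run s with hs₁
    have hsame : Same (fun a => a < 19 ∨ 24 ≤ a) s s₁ := Same.run (by simp [addEdge_writes])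
    obtain ⟨e3, e4⟩ := ih (s := s₁) fun y hy => hl y (by simp [hy])
    have hmap : (l.map fun x => (x.1.eval s₁, x.2.1.eval s₁, x.2.2.eval s₁)) =
        l.map fun x => (x.1.eval s, x.2.1.eval s, x.2.2.eval s) := by
      refine List.map_congr_left fun y hy => ?_
      obtain ⟨g1, g2, g3⟩ := hl y (by simp [hy])
      rw [g1.eval_eq hsame, g2.eval_eq hsame, g3.eval_eq hsame]
    refine ⟨?_, fun p j q => ?_⟩
    · change ((addEdges l).run s₁).num 19 0 = _
      rw [e3, e1, List.length_cons]
      omega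
    · change ((addEdges l).run s₁).edges p j q ↔ _
      rw [e4, e2, hmap, List.map_cons, List.mem_cons, Prod.mk.injEq, Prod.mk.injEq, or_assoc,
        eq_comm (a := p), eq_comm (a := j), eq_comm (a := q)]

theorem addEdges_spec {l : List (NExpr × NExpr × NExpr)} {l' : List (ℕ × ℕ × ℕ)} {c : ℕ}
    (hl : ∀ x ∈ l, x.1.NoEdge ∧ x.2.1.NoEdge ∧ x.2.2.NoEdge) (hc : l.length ≤ c)
    (hl' : (l.map fun x => (x.1.eval s, x.2.1.eval s, x.2.2.eval s)) = l') :
    ((addEdges l).run s).num 19 0 ≤ s.num 19 0 + c ∧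
    ∀ p j q, ((addEdges l).run s).edges p j q ↔ s.edges p j q ∨ (p, j, q) ∈ l' := by
  obtain ⟨e1, e2⟩ := addEdges_run (s := s) l hl
  rw [hl'] at e2
  exact ⟨by omega, e2⟩

/-- Branch on the token in `97`. -/
def onToken (P₀ P₁ P₂ P₃ P₄ P₅ : Prog) : Prog :=
  .ite (.var 97) (.ite (.sub (.var 97) (.lit 1)) (.ite (.sub (.var 97) (.lit 2))
    (.ite (.sub (.var 97) (.lit 3)) (.ite (.sub (.add (.lit 4) (.get 0 (.lit 0))) (.var 97))
      P₄ P₅) P₃) P₂) P₁) P₀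

/-- The tests are truncated differences: once the smaller tokens are excluded, `v - 1`, `v - 2`, `v
- 3` vanish only at `1`, `2`, `3`. -/
theorem onToken_run (P₀ P₁ P₂ P₃ P₄ P₅ : Prog) {v : ℕ} (hv : s.num 97 0 = v)
    (hk : s.num 0 0 = k) : (onToken P₀ P₁ P₂ P₃ P₄ P₅).run s =
      if v = 0 then P₀.run s else if v = 1 then P₁.run s else if v = 2 then P₂.run s
      else if v = 3 then P₃.run s else if v < 4 + k then P₄.run s else P₅.run s := by
  simp only [onToken, Prog.run, NExpr.eval, hv, hk]
  split_ifs <;> first | rfl | omega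

/-- Append the edges of a node. The variables 92, 93 and 94 hold the first states of the node, of its
last child and of its left child, and 95 the label of the edges that read nothing. -/
def exprEdges : Prog :=
  onToken (addEdges [(.var 92, .var 95, .add (.var 92) (.lit 1))])
    (addEdges [(.var 92, .var 95, .var 94), (.add (.var 94) (.lit 1), .var 95, .var 93),
      (.add (.var 93) (.lit 1), .var 95, .add (.var 92) (.lit 1))])
    (addEdges [(.var 92, .var 95, .var 94), (.var 92, .var 95, .var 93),
      (.add (.var 94) (.lit 1), .var 95, .add (.var 92) (.lit 1)),
      (.add (.var 93) (.lit 1), .var 95, .add (.var 92) (.lit 1))])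
    (addEdges [(.var 92, .var 95, .add (.var 92) (.lit 1)), (.var 92, .var 95, .var 93),
      (.add (.var 93) (.lit 1), .var 95, .var 92)])
    (addEdges [(.var 92, .sub (.var 97) (.lit 4), .add (.var 92) (.lit 1))])
    (addEdges [(.var 92, .sub (.var 97) (.lit 4), .var 93),
      (.add (.var 93) (.lit 1), .add (.sub (.var 97) (.lit 4)) (.get 0 (.lit 1)),
        .add (.var 92) (.lit 1))])

/-- The sum has four edges and no other node has more, which gives the bound `4 * ℓ` for the whole
automaton. -/
theorem exprEdges_run {v l i : ℕ} (h97 : s.num 97 0 = v) (h0 : s.num 0 0 = k) (h1 : s.num 0 1 = m)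
    (h92 : s.num 92 0 = 2 * i) (h93 : s.num 93 0 = 2 * (i - 1)) (h94 : s.num 94 0 = 2 * l)
    (h95 : s.num 95 0 = k + 2 * m) :
    (exprEdges.run s).num 19 0 ≤ s.num 19 0 + 4 ∧
    ∀ p j q, (exprEdges.run s).edges p j q ↔ s.edges p j q ∨ (p, j, q) ∈ nodeEdges k m v l i := by
  rw [exprEdges, onToken_run _ _ _ _ _ _ h97 h0]
  simp only [nodeEdges]
  split_ifs
  all_goals
    refine addEdges_spec (s := s) ?_ ?_ ?_
    · simp [NExpr.NoEdge]
    · simp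
    · simp [NExpr.eval, h97, h1, h92, h93, h94, h95]

/-- Write the length of the subexpression. -/
def exprLen : Prog :=
  onToken (.setNum 90 (.var 91) (.lit 1))
    (.setNum 90 (.var 91) (.add (.add (.lit 1) (.var 96)) (.var 98)))
    (.setNum 90 (.var 91) (.add (.add (.lit 1) (.var 96)) (.var 98)))
    (.setNum 90 (.var 91) (.add (.lit 1) (.var 96)))
    (.setNum 90 (.var 91) (.lit 1))
    (.setNum 90 (.var 91) (.add (.lit 1) (.var 96)))

theorem exprLen_run {v i : ℕ} (L : ℕ → ℕ) (h97 : s.num 97 0 = v) (h0 : s.num 0 0 = k)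
    (h91 : s.num 91 0 = i) (h96 : s.num 96 0 = L (i - 1))
    (h98 : s.num 98 0 = L (i - 1 - L (i - 1))) :
    exprLen.run s = s.setNum 90 i (nodeLen k L v i) := by
  rw [exprLen, onToken_run _ _ _ _ _ _ h97 h0]
  simp only [nodeLen, Prog.run, NExpr.eval, h91, h96, h98]
  split_ifs <;> first | rfl | omega

/-- Handle one token: append its edges and write the length of the subexpression. -/
def exprStep : Prog :=
  .seq (.seq (.setVar 97 (.get 3 (.var 91)))
    -- At position `0` the truncated subtraction addresses cell `0`, which is still zero; a postfix
    -- code starts with a leaf, which does not use this value.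
    (.seq (.setVar 96 (.get 90 (.sub (.var 91) (.lit 1))))
    (.seq (.setVar 98 (.sub (.sub (.var 91) (.lit 1)) (.var 96)))
    (.seq (.setVar 92 (.add (.var 91) (.var 91)))
    (.seq (.setVar 93 (.add (.sub (.var 91) (.lit 1)) (.sub (.var 91) (.lit 1))))
    (.seq (.setVar 94 (.add (.var 98) (.var 98)))
      -- The variable `98` first holds the position of the root of the left child and from here on
      -- the length of this child.
      (.setVar 98 (.get 90 (.var 98)))))))))
    (.seq exprEdges exprLen)

/-- Compute the automaton of an expression. -/
def loadExpr : Prog :=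
  .seq (.setVar 95 numSyms) (.seq (.for 91 (.get 0 (.lit 4)) exprStep)
    (.seq (.setVar 20 (.add (.get 0 (.lit 4)) (.get 0 (.lit 4))))
      (.seq (.setNum 4 (.sub (.var 20) (.lit 2)) (.lit 1))
        (.setNum 5 (.sub (.var 20) (.lit 1)) (.lit 1)))))

/-- The root is the last token `ℓ - 1`, so its two states `2 * ℓ - 2` and `2 * ℓ - 1` become the
initial and the accepting one. The lengths in array `90` and the counter of the edges start from the
zeros of the given memory. -/
theorem halts_loadExpr {c : ℕ → ℕ} {ℓ : ℕ} (h3 : s.num 3 = c) (h0 : s.num 0 0 = k)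
    (h1 : s.num 0 1 = m) (h4 : s.num 0 4 = ℓ) (h19 : s.num 19 0 = 0)
    (h90 : ∀ i, s.num 90 i = 0) :
    Halts loadExpr s (1000 * (ℓ + 1)) fun s₂ =>
      Same (fun a => a < 19 ∧ a ≠ 4 ∧ a ≠ 5) s s₂ ∧ s₂.num 20 0 = 2 * ℓ ∧
      (∀ i, s₂.num 4 i = if i = 2 * ℓ - 2 then 1 else s.num 4 i) ∧
      (∀ i, s₂.num 5 i = if i = 2 * ℓ - 1 then 1 else s.num 5 i) ∧ s₂.num 19 0 ≤ 4 * ℓ ∧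
      ∀ p j q, s₂.edges p j q ↔ ∃ i < ℓ, (p, j, q) ∈ edgesAtPos k m c i := by
  set s' := (Prog.setVar 95 numSyms).run s with hs'
  have hsame : Same (fun a => a ≠ 95) s s' := Same.run (by simp [Prog.writes])
  have h95 : s'.num 95 0 = k + 2 * m := by
    simp only [hs', Prog.run, NExpr.eval, Store.num_setNum, h0, h1]
    norm_num
    ring
  refine Halts.run_seq ((500 + 2 + 20) * ((ℓ + 1) * 1) + 30) rfl ?_ ?_
  · simp only [Prog.bound, NExpr.cost]
    omega
  refine Halts.seq_le ((500 + 2 + 20) * ((ℓ + 1) * 1)) 30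
    (Halts.forK (K := fun a => a < 19 ∨ a = 95) (fun j s₁ => s₁.num 90 = lenTab k c j ∧
      s₁.num 19 0 ≤ 4 * j ∧ ∀ p l q, s₁.edges p l q ↔ ∃ i < j, (p, l, q) ∈ edgesAtPos k m c i)
      ℓ 500 1 le_rfl (by omega) ?_ ?_ ?_ ?_) le_rfl ?_
  · intro j s₁ i y hJ
    have hsm : Same (fun a => a ≠ 91) s₁ (s₁.setNum 91 i y) := (Same.refl _ _).setNum (by simp) _ _
    rw [Store.edges_of_same hsm (by omega) (by omega) (by omega) (by omega), (hsm 90 (by omega)).1,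
      (hsm 19 (by omega)).1]
    exact hJ
  · refine ⟨?_, ?_, ?_⟩
    · rw [(hsame 90 (by omega)).1]
      exact funext h90
    · rw [(hsame 19 (by omega)).1, h19]
    · intro p l q
      simp only [Store.edges, edgeRel]
      rw [(hsame 19 (by omega)).1, h19]
      simp
  · intro s₁ hs₁
    simp only [NExpr.eval]
    rw [(hs₁ 0 (by omega)).1, (hsame 0 (by omega)).1, h4]
  · intro i s₁ hi hs₁ ⟨hL, hne, hedges⟩ h91
    have e0 : s₁.num 0 = s.num 0 := by rw [(hs₁ 0 (by omega)).1, (hsame 0 (by omega)).1]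
    have e3 : s₁.num 3 = c := by rw [(hs₁ 3 (by omega)).1, (hsame 3 (by omega)).1, h3]
    refine Halts.of_run rfl ?_ ?_
    · simp [exprStep, exprEdges, exprLen, onToken, addEdges, Prog.bound, addEdge_bound, NExpr.cost]
    set L := lenTab k c i with hLdef
    simp only [exprStep]
    rw [Prog.run]
    set s₂ := Prog.run (.seq (.setVar 97 (.get 3 (.var 91)))
      (.seq (.setVar 96 (.get 90 (.sub (.var 91) (.lit 1))))
      (.seq (.setVar 98 (.sub (.sub (.var 91) (.lit 1)) (.var 96)))
      (.seq (.setVar 92 (.add (.var 91) (.var 91)))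
      (.seq (.setVar 93 (.add (.sub (.var 91) (.lit 1)) (.sub (.var 91) (.lit 1))))
      (.seq (.setVar 94 (.add (.var 98) (.var 98)))
        (.setVar 98 (.get 90 (.var 98))))))))) s₁ with hs₂
    have hsm₂ : Same (fun a => a < 92 ∨ a = 95) s₁ s₂ := Same.run (by simp [Prog.writes])
    have f97 : s₂.num 97 0 = c i := by
      simp [hs₂, Prog.run, NExpr.eval, Store.num_setNum, h91, e3]
    have f96 : s₂.num 96 0 = L (i - 1) := by
      simp [hs₂, Prog.run, NExpr.eval, Store.num_setNum, h91, hL]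
    have f98 : s₂.num 98 0 = L (i - 1 - L (i - 1)) := by
      simp [hs₂, Prog.run, NExpr.eval, Store.num_setNum, h91, hL]
    have f92 : s₂.num 92 0 = 2 * i := by
      simp [hs₂, Prog.run, NExpr.eval, Store.num_setNum, h91]
      omega
    have f93 : s₂.num 93 0 = 2 * (i - 1) := by
      simp [hs₂, Prog.run, NExpr.eval, Store.num_setNum, h91]
      omega
    have f94 : s₂.num 94 0 = 2 * (i - 1 - L (i - 1)) := by
      simp [hs₂, Prog.run, NExpr.eval, Store.num_setNum, h91, hL]
      omega
    have f95 : s₂.num 95 0 = k + 2 * m := by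
      rw [(hsm₂ 95 (by omega)).1, (hs₁ 95 (by omega)).1, h95]
    have g0 : s₂.num 0 0 = k := by rw [(hsm₂ 0 (by omega)).1, e0, h0]
    have g1 : s₂.num 0 1 = m := by rw [(hsm₂ 0 (by omega)).1, e0, h1]
    obtain ⟨q1, q2⟩ := exprEdges_run (l := i - 1 - L (i - 1)) f97 g0 g1 f92 f93 f94 f95
    rw [Prog.run]
    set s₃ := exprEdges.run s₂ with hs₃
    have hsm₃ : Same (fun a => a < 19 ∨ 24 ≤ a) s₂ s₃ := by
      refine Same.run fun a ha => ?_
      have : 19 ≤ a ∧ a < 24 := by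
        simp only [exprEdges, onToken, Prog.writes, List.mem_append] at ha
        rcases ha with (((((ha | ha) | ha) | ha) | ha) | ha) <;> exact addEdges_writes _ a ha
      omega
    rw [exprLen_run (s := s₃) (k := k) (v := c i) (i := i) L
      (by rw [(hsm₃ 97 (by omega)).1, f97]) (by rw [(hsm₃ 0 (by omega)).1, g0])
      (by rw [(hsm₃ 91 (by omega)).1, (hsm₂ 91 (by omega)).1, h91])
      (by rw [(hsm₃ 96 (by omega)).1, f96]) (by rw [(hsm₃ 98 (by omega)).1, f98])]
    set s₄ := s₃.setNum 90 i (nodeLen k L (c i) i) with hs₄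
    have hsm₄ : Same (fun a => a ≠ 90) s₃ s₄ := (Same.refl _ _).setNum (by simp) _ _
    have hsm : Same (fun a => a < 19 ∨ a = 95 ∨ a = 91) s₁ s₄ :=
      (hsm₂.mono (by intro a ha; omega)).trans ((hsm₃.mono (by intro a ha; omega)).trans
        (hsm₄.mono (by intro a ha; omega)))
    refine ⟨by rw [(hsm 91 (by omega)).1, h91], hsm.mono (by intro a ha; omega), ?_, ?_, ?_⟩
    · have e90 : s₃.num 90 = L := by
        rw [(hsm₃ 90 (by omega)).1, (hsm₂ 90 (by omega)).1, hL]
      simp [hs₄, Store.setNum, lenTab, ← hLdef, e90]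
    · rw [(hsm₄ 19 (by omega)).1]
      have := (hsm₂ 19 (by omega)).1
      rw [this] at q1
      omega
    · intro p l q
      rw [Store.edges_of_same hsm₄ (by omega) (by omega) (by omega) (by omega), q2,
        Store.edges_of_same hsm₂ (by omega) (by omega) (by omega) (by omega), hedges,
        exists_lt_succ_iff]
      rfl
  rintro s₁ ⟨hs₁, -, hne, hedges⟩
  have e0 : s₁.num 0 4 = ℓ := by rw [(hs₁ 0 (by omega)).1, (hsame 0 (by omega)).1, h4]
  have hsm : Same (fun a => a ≠ 20 ∧ a ≠ 4 ∧ a ≠ 5) s₁ (Prog.run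
      (.seq (.setVar 20 (.add (.get 0 (.lit 4)) (.get 0 (.lit 4))))
      (.seq (.setNum 4 (.sub (.var 20) (.lit 2)) (.lit 1))
        (.setNum 5 (.sub (.var 20) (.lit 1)) (.lit 1)))) s₁) := Same.run (by simp [Prog.writes])
  refine Halts.of_run rfl (by simp [Prog.bound, NExpr.cost]) ⟨?_, ?_, ?_, ?_, ?_, ?_⟩
  · exact (hsame.mono (by intro a ha; omega)).trans
      ((hs₁.mono (by intro a ha; omega)).trans (hsm.mono (by intro a ha; omega)))
  · simp [Prog.run, NExpr.eval, Store.num_setNum, e0]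
    omega
  · intro i
    rw [← (hsame 4 (by omega)).1, ← (hs₁ 4 (by omega)).1]
    simp [Prog.run, NExpr.eval, Store.num_setNum, e0, two_mul]
  · intro i
    rw [← (hsame 5 (by omega)).1, ← (hs₁ 5 (by omega)).1]
    simp [Prog.run, NExpr.eval, Store.num_setNum, e0, two_mul]
  · rw [(hsm 19 (by omega)).1]
    exact hne
  · rw [Store.edges_of_same hsm (by omega) (by omega) (by omega) (by omega)]
    exact hedges

/-- From `n + 1 = 3` on, passing to the next number at most doubles the square. The case `n = 2`
shows that the constant `3` cannot be replaced by `2`. -/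
theorem succ_sq_le_two_pow (n : ℕ) : (n + 1) * (n + 1) ≤ 3 * 2 ^ n := by
  induction n using Nat.strong_induction_on with
  | _ n ih =>
    rcases n with _ | _ | _ | n
    · norm_num
    · norm_num
    · norm_num
    · have := ih (n + 2) (by omega)
      rw [pow_succ]
      nlinarith

/-- The automaton has two states per token, so its sets alone cost `2 ^ (2 * ℓ)`. Because the number
of its edges is linear in `ℓ`, the remaining factor is quadratic and costs only another `2 ^ (2 *
ℓ)`. -/
theorem constructs_inputExpr (r : MExpr (Fin k) m)
    (T : DSST (Fin h) (RefSym (Fin k) m) R Ω) (hk : 1 ≤ k) (hm : 1 ≤ m) (hr : r.WellFormed) :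
    Constructs (.seq loadExpr constructProg) (inputExpr r T)
      (300000 * (2 ^ (4 * r.size + 9 * m) * k ^ 3 * m ^ 2 * h ^ 2))
      (etSem r.spanner T.eval) := by
  have hhpos : 1 ≤ h := by have := T.start.2; omega
  set X := 2 ^ (4 * r.size + 9 * m) * k ^ 3 * m ^ 2 * h ^ 2 with hX
  set ℓ := r.code.length with hℓ
  have hℓ1 : 1 ≤ ℓ := r.one_le_code_length
  have hsize : ℓ ≤ r.size := r.code_length_le_size
  have hXle : (2 ^ (2 * ℓ) * 2 ^ (2 * ℓ)) *
      (2 ^ (3 * m) * (2 ^ (3 * m) * 2 ^ (3 * m)) * (k * (k * k) * ((m * m) * (h * h)))) ≤ X := by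
    calc _ = 2 ^ (4 * ℓ + 9 * m) * k ^ 3 * m ^ 2 * h ^ 2 := by
          rw [pow_add, show 4 * ℓ = 2 * ℓ + 2 * ℓ by ring,
            show 9 * m = 3 * m + (3 * m + 3 * m) by ring]
          simp only [pow_add]
          ring
      _ ≤ X := by
        rw [hX]
        gcongr
        norm_num
  have hP : 1 ≤ 2 ^ (3 * m) := Nat.one_le_two_pow
  have hW : 1 ≤ 2 ^ (2 * ℓ) := Nat.one_le_two_pow
  have hcost1 : ℓ + 1 ≤ X := by
    have h1 : 2 * ℓ < 2 ^ (2 * ℓ) := Nat.lt_two_pow_self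
    calc ℓ + 1 ≤ (2 ^ (2 * ℓ) * 1) * (1 * (1 * 1) * (1 * (1 * 1) * ((1 * 1) * (1 * 1)))) := by omega
      _ ≤ _ := by gcongr
      _ ≤ X := hXle
  have hsq := succ_sq_le_two_pow (2 * ℓ)
  refine Halts.seq_le (t := 1000 * (ℓ + 1)) (t₂ := 240000 * X)
    (halts_loadExpr (k := k) (m := m) (ℓ := ℓ) rfl ?_ ?_ ?_ ?_ ?_) (by omega) ?_
  · simp [inputExpr, DSST.store]
  · simp [inputExpr, DSST.store]
  · simp [inputExpr, hℓ]
  · simp [inputExpr, DSST.store]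
  · simp [inputExpr, DSST.store]
  rintro s₁ ⟨hs₁, h20, h4, h5, hne, hedges⟩
  have hl := loaded_of_same (T := T) (s₀ := inputExpr r T) (s := s₁)
    (by intro i hi; simp [inputExpr]; omega) (by funext i; simp [inputExpr])
    (by funext i; simp [inputExpr]) rfl rfl (hs₁.mono (by intro a ha; omega))
  rw [h20] at hl
  have hplaced : Placed ((inputExpr r T).num 3) r 0 := by
    intro t _
    simp [inputExpr]
  have hedges' : ∀ p j q, s₁.edges p j q ↔ (p, j, q) ∈ r.edgeList 0 := by
    intro p j q
    rw [hedges, ← hplaced.spec.2]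
    simp [hℓ]
  have hE : ∀ e < s₁.num 19 0, s₁.num 21 e < 2 * ℓ ∧ s₁.num 23 e < 2 * ℓ := by
    intro e he
    have := r.edgeList_bounds ((hedges' _ _ _).1 ⟨e, he, rfl, rfl, rfl⟩)
    simp only at this
    omega
  have hlang : pathLang k m (edgeRel (s₁.num 19 0) (s₁.num 21) (s₁.num 22) (s₁.num 23))
      (fun p => p < 2 * ℓ ∧ s₁.num 4 p ≠ 0) (fun p => s₁.num 5 p ≠ 0) = r.lang := by
    refine r.pathLang_eq_lang hedges' (fun p => ?_) (fun p => ?_)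
    · rw [h4]
      have : (inputExpr r T).num 4 p = 0 := by simp [inputExpr, DSST.store]
      rw [this]
      simp only [MExpr.root]
      split_ifs <;> omega
    · rw [h5]
      have : (inputExpr r T).num 5 p = 0 := by simp [inputExpr, DSST.store]
      rw [this]
      simp only [MExpr.root]
      split_ifs <;> omega
  refine (hl.halts_constructProg hE hk ?_ ?_).mono ?_ ?_
  · intro i
    rw [(hs₁ 11 (by omega)).1]
    simp [inputExpr, DSST.store]
  · rw [(hs₁ 10 (by omega)).1]
    simp [inputExpr, DSST.store]
  -- There are at most `4 * ℓ` edges, and `m` is positive.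
  · have hY : m + s₁.num 19 0 + 1 ≤ 2 * ((2 * ℓ + 1) * m) := by nlinarith
    calc _ ≤ 40000 * (2 ^ (2 * ℓ) * (k * (2 ^ (3 * m) * ((2 * ℓ + 1) * (h * (2 ^ (3 * m) *
          (2 * ((2 * ℓ + 1) * m)))))))) := by gcongr
      _ = 80000 * (2 ^ (2 * ℓ) * (k * (2 ^ (3 * m) * (h * (2 ^ (3 * m) *
          (((2 * ℓ + 1) * (2 * ℓ + 1)) * m)))))) := by ring
      _ ≤ 80000 * (2 ^ (2 * ℓ) * (k * (2 ^ (3 * m) * (h * (2 ^ (3 * m) *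
          ((3 * 2 ^ (2 * ℓ)) * m)))))) := by gcongr
      _ = 240000 * ((2 ^ (2 * ℓ) * 2 ^ (2 * ℓ)) *
        (2 ^ (3 * m) * (2 ^ (3 * m) * 1) * (k * (1 * 1) * ((m * 1) * (h * 1))))) := by ring
      _ ≤ 240000 * ((2 ^ (2 * ℓ) * 2 ^ (2 * ℓ)) * (2 ^ (3 * m) * (2 ^ (3 * m) * 2 ^ (3 * m)) *
        (k * (k * k) * ((m * m) * (h * h))))) := by gcongr
      _ ≤ 240000 * X := Nat.mul_le_mul_left _ hXle
  · intro s₂ h2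
    refine ⟨_, _, h2, fun D => ?_⟩
    rw [outputNSST_sem hE (by rw [hlang]; exact r.isMultirefWord_of_mem_lang hr) D, hlang]
    rfl

end LoadExpression

end ET

theorem theorem1 :
    (∃ (P : ET.Prog) (c : ℕ), ∀ (k m h : ℕ) (R Ω : Type) [Finite R] [Finite Ω]
      (r : ET.MExpr (Fin k) m) (T : ET.DSST (Fin h) (ET.RefSym (Fin k) m) R Ω),
      1 ≤ k → 1 ≤ m → r.WellFormed →
      ET.Constructs P (ET.inputExpr r T)
        (c * (2 ^ (4 * r.size + 9 * m) * k ^ 3 * m ^ 2 * h ^ 2))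
        (ET.etSem r.spanner T.eval)) ∧
    (∃ (P : ET.Prog) (c : ℕ), ∀ (k m h n : ℕ) (R Ω : Type) [Finite R] [Finite Ω]
      (M : NFA (ET.RefSym (Fin k) m) (Fin n)) (T : ET.DSST (Fin h) (ET.RefSym (Fin k) m) R Ω),
      1 ≤ k → 1 ≤ m → (∀ w ∈ M.accepts, ET.IsMultirefWord w) →
      ET.Constructs P (ET.inputNFA M T)
        (c * (2 ^ (4 * n + 9 * m) * k ^ 3 * m ^ 2 * h ^ 2))
        (ET.etSem (ET.spannerOf M.accepts) T.eval)) :=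
  ⟨⟨_, 300000, fun _ _ _ _ _ _ _ r T hk hm hr => ET.constructs_inputExpr r T hk hm hr⟩,
    ⟨_, 200000, fun _ _ _ _ _ _ _ _ M T hk hm hM => ET.constructs_inputNFA M T hk hm hM⟩⟩
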